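/- **Setting (type $C_n$, $n\ge 1$).** Let $[\overline n]=\{1<\dots<n<\overline n<\dots<\overline 1\}$, with $\overline{\overline{\imath}}=i$ and $|i|=|\overline\imath|=i$, and let $W=B_n$ be the group of signed permutations, i.e. bijections $w$ of $[\overline n]$ with $w(\overline\imath)=\overline{w(i)}$, with length $\ell(w)=\#\{(k,l)\in[n]\times[\overline n]: k\le |l|,\ w(k)>w(l)\}$. For $1\le i<j\le n$ write $(i,j)$, $(i,\overline\jmath)$ for the positive roots $\varepsilon_i-\varepsilon_j$, $\varepsilon_i+\varepsilon_j$, and $(i,\overline\imath)$ ($1\le i\le n$) for $2\varepsilon_i$; the corresponding reflections $s_\beta\in W$ are the products of transpositions $t_{ij}t_{\overline\jmath\,\overline\imath}$, $t_{i\overline\jmath}t_{j\overline\imath}$ and $t_{i\overline\imath}$. Put $\rho=(n,n-1,\dots,1)$ and $\beta^\vee=2\beta/\langle\beta,\beta\rangle$. Let $\mu=(\mu_1\ge\dots\ge\mu_n\ge 0)$ be a dominant weight, with conjugate partition $\mu'$. For $1\le k\le n$ let $\Gamma(k)=\Gamma_r(k)\Gamma_l(k)$, where $\Gamma_r(k)=\Gamma_2\cdots\Gamma_k$,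 $\Gamma_l(k)=\Gamma_{k1}\cdots\Gamma_{kk}$, with $\Gamma_i=((1,\overline\imath),\dots,(i-1,\overline\imath))$ and $$\Gamma_{ki}=\big((1,\overline\imath),\dots,(i-1,\overline\imath),\ (i,\overline{k+1}),\dots,(i,\overline n),\ (i,\overline\imath),\ (i,n),(i,n-1),\dots,(i,k+1)\big).$$ Let $\Gamma=\Gamma^{\mu_1}\cdots\Gamma^1=(\beta_1,\dots,\beta_m)$ with $\Gamma^j=\Gamma(\mu'_j)$. A folding pair is a pair $(w,J)$ with $w\in W$ and $J=\{j_1<\dots<j_s\}\subseteq[m]$; put $w_i=w\,s_{\beta_{j_1}}\cdots s_{\beta_{j_i}}$, $\mathrm{end}(w,J)=w_s$, and $J^-=\{j_i: w_{i-1}<w_i\text{ in Bruhat order}\}$. Let $\overline{\mathcal F}(\mu)$ be the set of folding pairs with $$\tfrac12\big(\ell(w)+\ell(\mathrm{end}(w,J))-\#J\big)+\sum_{j\in J^-}\langle\rho,\beta_j^\vee\rangle=0 .$$ A filling of shape $2\mu$ is a sequence of columns $C_r^{\mu_1}C_l^{\mu_1}\cdots C_r^1C_l^1$, where $C_r^j,C_l^j$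 have height $\mu_j'$ and each column has entries in $[\overline n]$ with distinct absolute values. The filling map $f$ sends $(w,J)$ to the filling with $C_r^j=\pi_r^j(1)\cdots\pi_r^j(\mu_j')$ and $C_l^j=\pi_l^j(1)\cdots\pi_l^j(\mu_j')$. Here $\pi_r^j$ is the product of $w$ with the reflections $s_{\beta_q}$, $q\in J$, over the positions $q$ in the factors $\Gamma^{\mu_1},\dots,\Gamma^{j+1}$ (multiplied on the right, in increasing order of $q$), and $\pi_l^j$ is the product of $\pi_r^j$ with those at the positions $q\in J$ in the factor $\Gamma_r(\mu_j')$ of $\Gamma^j$. *Split columns.* Let $D$ be a strictly increasing column of height $k$ with entries in $[\overline n]$, and let $z_1>\dots>z_r$ be the letters $z\in[n]$ such that $z$ and $\overline z$ both occur in $D$. The column $D$ is a Kashiwara–Nakashima (KN) column if there are letters $t_1>\dots>t_r$ in $[n]$ such that each $t_i$ is the greatest $t\in[n]$ with $t<z_i$, $t<t_{i-1}$ (if $i\ge2$), $t\notin D$ and $\overline t\notin D$. Then $rD$ (resp. $lD$) is obtained from $D$ by replacing each $\overline{z_i}$ by $\overline{t_i}$ (resp. each $z_i$ by $t_i$) and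 sorting increasingly. *Condition 1$'$* for adjacent columns $C'C$ ($C'$ immediately to the left of $C$): for all $1\le i<l\le\#C'$, neither $C(i)=C'(l)$ nor $C(i)\prec C'(l)\prec C'(i)$ holds, where $\prec$ is the circular order on $[\overline n]$ starting at $C(i)$. **Proposition.** The restriction of $f$ to $\overline{\mathcal F}(\mu)$ is injective. Its image consists exactly of the fillings $C_r^{\mu_1}C_l^{\mu_1}\cdots C_r^1C_l^1$ of shape $2\mu$ such that: (i) $C_l^1$ is increasing (a void condition if $\mu=0$); (ii) for every $j$ there is a KN column $D^j$ with $(\mathrm{ord}(C_r^j),\mathrm{ord}(C_l^j))=(rD^j,lD^j)$, where $\mathrm{ord}$ sorts a column increasingly; (iii) any two adjacent columns satisfy Condition 1$'$. -/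

import Mathlib

namespace TypeC

/-! ### Letters, signed permutations, length -/

/-- The ordered alphabet `1 < 2 < … < n < n̄ < … < 2̄ < 1̄`: the letter `i` is the element `i - 1`
of `Fin (2 * n)`, and the letter `ī` is the element `2 * n - i`. -/
abbrev Letter (n : ℕ) : Type := Fin (2 * n)

/-- The involution `x ↦ x̄`. -/
def bar {n : ℕ} (x : Letter n) : Letter n := Fin.rev x

/-- The unbarred letter `i`. -/
def unbarred {n : ℕ} (i : Fin n) : Letter n := Fin.castLE (Nat.le_mul_of_pos_left n two_pos) i

/-- `x` is one of the letters `1, …, n`. -/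
def IsUnbarred {n : ℕ} (x : Letter n) : Prop := x.val < n

/-- The absolute value of a letter: `|i| = |ī| = i`. -/
def absLetter {n : ℕ} (x : Letter n) : Letter n := min x (bar x)

/-- The group `B_n` of signed permutations: bijections `w` of the alphabet to itself such that
`w(x̄)` is the bar of `w(x)`. -/
def SignedPerm (n : ℕ) : Subgroup (Equiv.Perm (Letter n)) where
  carrier := {w | ∀ x, w (bar x) = bar (w x)}
  one_mem' := fun _ => rfl
  mul_mem' := by
    intro a b ha hb x
    rw [Equiv.Perm.mul_apply, Equiv.Perm.mul_apply, hb x, ha (b x)]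
  inv_mem' := by
    intro a ha x
    have ha' : ∀ y, a (bar y) = bar (a y) := ha
    apply a.injective
    rw [ha']
    simp

/-- The length `ℓ(w) = #{(k, l) ∈ [n] × [n̄] : k ≤ |l|, w(k) > w(l)}`. -/
def length {n : ℕ} (w : SignedPerm n) : ℕ :=
  ((Finset.univ : Finset (Fin n × Letter n)).filter
    (fun p => unbarred p.1 ≤ absLetter p.2 ∧ w.1 p.2 < w.1 (unbarred p.1))).card

/-! ### Positive roots and reflections -/

/-- The positive roots of type `C_n`. -/
inductive PosRoot (n : ℕ) : Type
  /-- the root `(i, j) = ε_i - ε_j`, for `i < j` -/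
  | sub (i j : Fin n) (h : i < j) : PosRoot n
  /-- the root `(i, j̄) = ε_i + ε_j`, for `i < j` -/
  | add (i j : Fin n) (h : i < j) : PosRoot n
  /-- the root `(i, ī) = 2 ε_i` -/
  | long (i : Fin n) : PosRoot n

/-- The root as a vector of coordinates with respect to `ε_1, …, ε_n`. -/
def PosRoot.vec {n : ℕ} : PosRoot n → (Fin n → ℚ)
  | .sub i j _ => Pi.single i 1 - Pi.single j 1
  | .add i j _ => Pi.single i 1 + Pi.single j 1
  | .long i => Pi.single i 2

/-- The vector `ρ = (n, n - 1, …, 1)`. -/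
def rho (n : ℕ) : Fin n → ℚ := fun i => (n : ℚ) - (i.val : ℚ)

/-- `⟨ρ, β^∨⟩`, where `β^∨ = 2 β / ⟨β, β⟩` is the coroot. -/
def rhoCoroot {n : ℕ} (β : PosRoot n) : ℚ :=
  2 * dotProduct (rho n) β.vec / dotProduct β.vec β.vec

/-- The permutation of the alphabet given by the reflection `s_β`. -/
def PosRoot.perm {n : ℕ} : PosRoot n → Equiv.Perm (Letter n)
  | .sub i j _ => Equiv.swap (unbarred i) (unbarred j) *
      Equiv.swap (bar (unbarred j)) (bar (unbarred i))
  | .add i j _ => Equiv.swap (unbarred i) (bar (unbarred j)) *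
      Equiv.swap (unbarred j) (bar (unbarred i))
  | .long i => Equiv.swap (unbarred i) (bar (unbarred i))

lemma bar_bar {n : ℕ} (x : Letter n) : bar (bar x) = x := Fin.rev_rev x

lemma bar_injective {n : ℕ} : Function.Injective (bar : Letter n → Letter n) :=
  Fin.rev_injective

lemma swap_bar {n : ℕ} (a b x : Letter n) :
    Equiv.swap a b (bar x) = bar (Equiv.swap (bar a) (bar b) x) := by
  rw [bar_injective.map_swap, bar_bar, bar_bar]

lemma swap_mul_swap_comm {α : Type*} [DecidableEq α] {a b c d : α}
    (hac : a ≠ c) (had : a ≠ d) (hbc : b ≠ c) (hbd : b ≠ d) :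
    Equiv.swap a b * Equiv.swap c d = Equiv.swap c d * Equiv.swap a b := by
  ext x
  simp only [Equiv.Perm.mul_apply, Equiv.swap_apply_def]
  split_ifs <;> simp_all

lemma PosRoot.perm_mem {n : ℕ} (β : PosRoot n) : β.perm ∈ SignedPerm n := by
  intro x
  cases β with
  | sub i j h =>
    have h' : i.val < j.val := h
    simp only [PosRoot.perm]
    rw [swap_mul_swap_comm, Equiv.Perm.mul_apply, Equiv.Perm.mul_apply, swap_bar, swap_bar,
      bar_bar, bar_bar, Equiv.swap_comm (bar (unbarred i)), ← Equiv.Perm.mul_apply,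
      ← Equiv.Perm.mul_apply, swap_mul_swap_comm, Equiv.swap_comm (unbarred j),
      swap_mul_swap_comm]
    all_goals
      intro e
      have := congrArg Fin.val e
      simp [bar, unbarred, Fin.val_rev] at this
      omega
  | add i j h =>
    have h' : i.val < j.val := h
    simp only [PosRoot.perm]
    rw [swap_mul_swap_comm, Equiv.Perm.mul_apply, Equiv.Perm.mul_apply, swap_bar, swap_bar,
      bar_bar, bar_bar, Equiv.swap_comm (bar (unbarred i)), Equiv.swap_comm (bar (unbarred j)),
      ← Equiv.Perm.mul_apply, ← Equiv.Perm.mul_apply, swap_mul_swap_comm]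
    all_goals
      intro e
      have := congrArg Fin.val e
      simp [bar, unbarred, Fin.val_rev] at this
      omega
  | long i =>
    simp only [PosRoot.perm]
    rw [swap_bar, bar_bar, Equiv.swap_comm]

/-- The reflection `s_β` as an element of `B_n`. -/
def PosRoot.refl {n : ℕ} (β : PosRoot n) : SignedPerm n := ⟨β.perm, β.perm_mem⟩

/-- The (strict) Bruhat order on `B_n`: the transitive closure of the relations `w < w s_β` for
positive roots `β` with `ℓ(w) < ℓ(w s_β)`. -/
def BruhatLT {n : ℕ} : SignedPerm n → SignedPerm n → Prop :=
  Relation.TransGen (fun u v => length u < length v ∧ ∃ β : PosRoot n, v = u * β.refl)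

/-! ### The chain of roots attached to a dominant weight -/

/-- `(1, ī), (2, ī), …, (i - 1, ī)`. -/
def rootsBelow {n : ℕ} (i : Fin n) : List (PosRoot n) :=
  (List.finRange n).filterMap (fun j => if h : j < i then some (PosRoot.add j i h) else none)

/-- `(i, m̄)` for `m > i`, `m = k + 1, …, n`, in increasing order of `m`. -/
def rootsAdd {n : ℕ} (k : ℕ) (i : Fin n) : List (PosRoot n) :=
  (List.finRange n).filterMap
    (fun m => if h : i < m ∧ k ≤ m.val then some (PosRoot.add i m h.1) else none)

/-- `(i, m)` for `m > i`, `m = n, n - 1, …, k + 1`, in decreasing order of `m`. -/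
def rootsSub {n : ℕ} (k : ℕ) (i : Fin n) : List (PosRoot n) :=
  (List.finRange n).reverse.filterMap
    (fun m => if h : i < m ∧ k ≤ m.val then some (PosRoot.sub i m h.1) else none)

/-- `1, …, k`, as elements of the index set of size `n`. -/
def firstRows (n k : ℕ) : List (Fin n) := (List.finRange n).filter (fun i => i.val < k)

/-- `Γ_r(k) = Γ_2 … Γ_k` (the sequence `Γ_1` is empty). -/
def gammaR (n k : ℕ) : List (PosRoot n) := (firstRows n k).flatMap rootsBelow

/-- `Γ_l(k) = Γ_{k1} … Γ_{kk}`. -/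
def gammaL (n k : ℕ) : List (PosRoot n) :=
  (firstRows n k).flatMap
    (fun i => rootsBelow i ++ rootsAdd k i ++ [PosRoot.long i] ++ rootsSub k i)

/-- `Γ(k) = Γ_r(k) Γ_l(k)`. -/
def gamma (n k : ℕ) : List (PosRoot n) := gammaR n k ++ gammaL n k

/-- The height `μ'_{c+1}` of column `c + 1` of the Young diagram of `μ`. -/
def height {n : ℕ} (μ : Fin n → ℕ) (c : ℕ) : ℕ :=
  ((Finset.univ : Finset (Fin n)).filter (fun i => c < μ i)).card

lemma height_le {n : ℕ} (μ : Fin n → ℕ) (c : ℕ) : height μ c ≤ n := by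
  simpa [height] using Finset.card_filter_le (Finset.univ : Finset (Fin n)) (fun i => c < μ i)

lemma height_antitone {n : ℕ} (μ : Fin n → ℕ) : Antitone (height μ) := by
  intro a b hab
  exact Finset.card_le_card fun i hi => by
    simp only [Finset.mem_filter] at hi ⊢
    exact ⟨hi.1, lt_of_le_of_lt hab hi.2⟩

/-- The segment `Γ^{μ_1} Γ^{μ_1 - 1} … Γ^{c+1}` of the chain of `μ`, where
`Γ^j = Γ(μ'_j)`. -/
def chainSegment {n : ℕ} [NeZero n] (μ : Fin n → ℕ) (c : ℕ) : List (PosRoot n) :=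
  (List.range' c (μ 0 - c)).reverse.flatMap (fun d => gamma n (height μ d))

/-- The chain `Γ = Γ^{μ_1} … Γ^1`. -/
def chain {n : ℕ} [NeZero n] (μ : Fin n → ℕ) : List (PosRoot n) := chainSegment μ 0

/-! ### Folding pairs -/

/-- The set `W × 2^{[m]}` of folding pairs of a sequence of `m` roots. -/
abbrev FoldingPair {n : ℕ} (Γ : List (PosRoot n)) : Type :=
  SignedPerm n × Finset (Fin Γ.length)

/-- For a folding pair `(w, J)`, the product `w r_{j_1} … r_{j_i}`, where `j_1 < … < j_i` are the
elements of `J` among the first `p` positions of the chain. -/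
def walk {n : ℕ} {Γ : List (PosRoot n)} (F : FoldingPair Γ) (p : ℕ) : SignedPerm n :=
  F.1 * (((List.finRange Γ.length).filter (fun q => q ∈ F.2 ∧ q.val < p)).map
    (fun q => (Γ.get q).refl)).prod

/-- `end(w, J)`. -/
def endPoint {n : ℕ} {Γ : List (PosRoot n)} (F : FoldingPair Γ) : SignedPerm n :=
  walk F Γ.length

open Classical in
/-- The set `J⁻` of negative foldings: the `j = j_i ∈ J` with `w_{i-1} < w_i` in Bruhat order. -/
noncomputable def negFoldings {n : ℕ} {Γ : List (PosRoot n)} (F : FoldingPair Γ) :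
    Finset (Fin Γ.length) :=
  F.2.filter (fun j => BruhatLT (walk F j.val) (walk F (j.val + 1)))

/-- The set of folding pairs `(w, J)` with
`½ (ℓ(w) + ℓ(end(w, J)) - #J) + ∑_{j ∈ J⁻} ⟨ρ, β_j^∨⟩ = 0`. -/
def FBar {n : ℕ} (Γ : List (PosRoot n)) : Set (FoldingPair Γ) :=
  {F | (1 / 2 : ℚ) * ((length F.1 : ℚ) + (length (endPoint F) : ℚ) - (F.2.card : ℚ)) +
      ∑ j ∈ negFoldings F, rhoCoroot (Γ.get j) = 0}

/-! ### Fillings and the filling map -/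

/-- A sequence of columns `C_r^{μ_1} C_l^{μ_1} … C_r^1 C_l^1` filled with letters, `C_r^j` and
`C_l^j` having height `μ'_j`; here `right c` and `left c` are `C_r^{c+1}` and `C_l^{c+1}`. -/
@[ext]
structure Filling {n : ℕ} [NeZero n] (μ : Fin n → ℕ) : Type where
  right : (c : Fin (μ 0)) → Fin (height μ c.val) → Letter n
  left : (c : Fin (μ 0)) → Fin (height μ c.val) → Letter n

/-- The entries of a column have distinct absolute values. -/
def DistinctAbs {n k : ℕ} (C : Fin k → Letter n) : Prop :=
  Function.Injective (fun i => absLetter (C i))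

/-- `u[1, k] = u(1) … u(k)`. -/
def window {n k : ℕ} (u : SignedPerm n) (hk : k ≤ n) : Fin k → Letter n :=
  fun i => u.1 (unbarred (Fin.castLE hk i))

/-- The filling map: `C_r^j = π_r^j[1, μ'_j]` and `C_l^j = π_l^j[1, μ'_j]`, where
`π_r^j = w T^{μ_1} … T^{j+1}` and `π_l^j = π_r^j T_r^j`. -/
def fillingMap {n : ℕ} [NeZero n] (μ : Fin n → ℕ) (F : FoldingPair (chain μ)) : Filling μ where
  right := fun c =>
    window (walk F (chainSegment μ (c.val + 1)).length) (height_le μ c.val)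
  left := fun c =>
    window (walk F ((chainSegment μ (c.val + 1)).length + (gammaR n (height μ c.val)).length))
      (height_le μ c.val)

/-! ### Conditions on columns -/

/-- `a ≺ b ≺ c` in the circular order starting at `a`. -/
def CircLT {n : ℕ} (a b c : Letter n) : Prop :=
  (a < b ∧ b < c) ∨ (b < c ∧ c < a) ∨ (c < a ∧ a < b)

/-- The condition on a pair of adjacent columns `C' C` (`C'` to the left of `C`, so not longer):
for `i < l ≤ #C'`, both `C(i) = C'(l)` and `C(i) ≺ C'(l) ≺ C'(i)` are false. -/
def AdjacentCond {n k' k : ℕ} (hk : k' ≤ k) (C' : Fin k' → Letter n) (C : Fin k → Letter n) :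
    Prop :=
  ∀ i l : Fin k', i < l →
    C (Fin.castLE hk i) ≠ C' l ∧ ¬ CircLT (C (Fin.castLE hk i)) (C' l) (C' i)

/-- Sorting a column increasingly. -/
def ord {n k : ℕ} (C : Fin k → Letter n) : Fin k → Letter n := C ∘ Tuple.sort C

/-- `z_1 > … > z_r` are the unbarred letters `z` such that `z` and `z̄` both occur in `D`, and
`t_1 > … > t_r` are unbarred letters such that each `t_i` is the greatest unbarred letter `t` with
`t < z_i`, `t < t_{i-1}` (if `i ≥ 2`), `t ∉ D`, and `t̄ ∉ D`. -/
def SplitData {n k r : ℕ} (D : Fin k → Letter n) (z t : Fin r → Letter n) : Prop :=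
  StrictAnti z ∧
  Set.range z = {x | IsUnbarred x ∧ x ∈ Set.range D ∧ bar x ∈ Set.range D} ∧
  ∀ i : Fin r, IsGreatest
    {x | IsUnbarred x ∧ x < z i ∧ (∀ j : Fin r, j.val + 1 = i.val → x < t j) ∧
      x ∉ Set.range D ∧ bar x ∉ Set.range D} (t i)

/-- Kashiwara-Nakashima columns: strictly increasing columns which can be split. -/
def IsKNColumn {n k : ℕ} (D : Fin k → Letter n) : Prop :=
  StrictMono D ∧ ∃ (r : ℕ) (z t : Fin r → Letter n), SplitData D z t

/-- `R = rD` and `L = lD`: the increasing columns whose entries are obtained from those of `D` by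
changing each `z̄_i` into `t̄_i`, respectively each `z_i` into `t_i`. -/
def IsSplitting {n k : ℕ} (D R L : Fin k → Letter n) : Prop :=
  ∃ (r : ℕ) (z t : Fin r → Letter n), SplitData D z t ∧
    StrictMono R ∧
    Set.range R = (Set.range D \ Set.range (fun i => bar (z i))) ∪ Set.range (fun i => bar (t i)) ∧
    StrictMono L ∧
    Set.range L = (Set.range D \ Set.range z) ∪ Set.range t

/-- Fillings of the shape `2μ` (each column having entries with distinct absolute values)
satisfying the three conditions (first left column, split columns, adjacent columns). -/
structure Admissible {n : ℕ} [NeZero n] {μ : Fin n → ℕ} (σ : Filling μ) : Prop where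
  distinct_right : ∀ c, DistinctAbs (σ.right c)
  distinct_left : ∀ c, DistinctAbs (σ.left c)
  /-- `C_l^1` is increasing. -/
  first_increasing : ∀ c : Fin (μ 0), c.val = 0 → StrictMono (σ.left c)
  /-- `(ord C_r^j, ord C_l^j) = (rD, lD)` for some KN column `D`. -/
  split : ∀ c : Fin (μ 0), ∃ D : Fin (height μ c.val) → Letter n,
    IsKNColumn D ∧ IsSplitting D (ord (σ.right c)) (ord (σ.left c))
  /-- The adjacent columns `C_r^j C_l^j` satisfy the condition. -/
  adjacent_inner : ∀ c : Fin (μ 0), AdjacentCond le_rfl (σ.right c) (σ.left c)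
  /-- The adjacent columns `C_l^{j+1} C_r^j` satisfy the condition. -/
  adjacent_outer : ∀ (c : ℕ) (h : c + 1 < μ 0),
    AdjacentCond (height_antitone μ (Nat.le_succ c))
      (σ.left ⟨c + 1, h⟩) (σ.right ⟨c, Nat.lt_of_succ_lt h⟩)

end TypeC

/-!
Telescoping `ℓ(w)` backwards along a folding turns the statistic into `ℓ(end(w, J))` plus, for each
step `v → v s_β`, the term `½ (ℓ(v s_β) - ℓ(v) - 1) + [ℓ(v s_β) < ℓ(v)] ⟨ρ, β^∨⟩`, which is a
nonnegative integer vanishing exactly on the edges of the quantum Bruhat graph. So the foldings with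
statistic `0` are those which, read backwards, are paths from the identity in that graph.

Read backwards, the segment `Γ_ki` takes row `i` from its entry in a column to its entry in the
adjacent column on the left. A path in the quantum Bruhat graph along this segment is determined by
that target entry, and the greedy path reaches it exactly when no entry of the left column lies on
the arc swept by the row, which is Condition 1'. The segments of `Γ_r(k)` only contain roots
`(l, ī)` with both rows inside the column, so every entry stays in its half of the alphabet and
passes no letter whose absolute value is missing from the column; counting shows that two columns
are related in this way exactly when they split a KN column.
-/

namespace TypeC

variable {n : ℕ}

/-! ### Entries of signed permutations -/

/-- The entry `w(i)` of a signed permutation at the unbarred letter `i`. -/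
def entry (w : SignedPerm n) (i : Fin n) : Letter n := w.1 (unbarred i)

lemma val_bar (x : Letter n) : (bar x).val = 2 * n - 1 - x.val := by
  rw [bar, Fin.val_rev]; omega

lemma val_unbarred (i : Fin n) : (unbarred i).val = i.val := rfl

lemma bar_lt_bar {x y : Letter n} : bar x < bar y ↔ y < x := Fin.rev_lt_rev

lemma bar_lt_comm {x y : Letter n} : bar x < y ↔ bar y < x := Fin.rev_lt_iff

lemma apply_bar (w : SignedPerm n) (x : Letter n) : w.1 (bar x) = bar (w.1 x) := w.2 x

lemma exists_eq_unbarred_or_bar (x : Letter n) :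
    ∃ i : Fin n, x = unbarred i ∨ x = bar (unbarred i) := by
  by_cases h : x.val < n
  · exact ⟨⟨x.val, h⟩, Or.inl rfl⟩
  · refine ⟨⟨2 * n - 1 - x.val, by omega⟩, Or.inr (Fin.ext ?_)⟩
    rw [val_bar, val_unbarred]
    dsimp only
    omega

lemma unbarred_ne_bar (i j : Fin n) : unbarred i ≠ bar (unbarred j) := by
  intro h
  have := congrArg Fin.val h
  rw [val_bar, val_unbarred, val_unbarred] at this
  omega

lemma unbarred_injective : Function.Injective (unbarred : Fin n → Letter n) :=
  fun _ _ h => Fin.ext (congrArg (Fin.val : Letter n → ℕ) h)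

lemma entry_ne_bar_entry (w : SignedPerm n) (i j : Fin n) : entry w i ≠ bar (entry w j) := by
  rw [entry, entry, ← apply_bar]
  exact fun h => unbarred_ne_bar i j (w.1.injective h)

lemma entry_injective (w : SignedPerm n) : Function.Injective (entry w) :=
  w.1.injective.comp unbarred_injective

lemma exists_entry_eq_or_bar (w : SignedPerm n) (x : Letter n) :
    ∃ i, x = entry w i ∨ x = bar (entry w i) := by
  obtain ⟨y, rfl⟩ := w.1.surjective x
  obtain ⟨i, rfl | rfl⟩ := exists_eq_unbarred_or_bar y
  · exact ⟨i, Or.inl rfl⟩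
  · exact ⟨i, Or.inr (apply_bar w _)⟩

lemma ext_entry {u w : SignedPerm n} (h : ∀ i, entry u i = entry w i) : u = w := by
  refine Subtype.ext (Equiv.ext fun x => ?_)
  obtain ⟨i, rfl | rfl⟩ := exists_eq_unbarred_or_bar x
  · exact h i
  · rw [apply_bar, apply_bar]
    exact congrArg bar (h i)

lemma entry_mul_sub (w : SignedPerm n) {i j : Fin n} (h : i < j) (p : Fin n) :
    entry (w * (PosRoot.sub i j h).refl) p =
      if p = i then entry w j else if p = j then entry w i else entry w p := by
  change w.1 (Equiv.swap (unbarred i) (unbarred j)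
    (Equiv.swap (bar (unbarred j)) (bar (unbarred i)) (unbarred p))) = _
  rw [Equiv.swap_apply_of_ne_of_ne (unbarred_ne_bar _ _) (unbarred_ne_bar _ _),
    Equiv.swap_apply_def]
  simp only [unbarred_injective.eq_iff]
  split_ifs <;> rfl

lemma entry_mul_long (w : SignedPerm n) (i p : Fin n) :
    entry (w * (PosRoot.long i).refl) p = if p = i then bar (entry w i) else entry w p := by
  change w.1 (Equiv.swap (unbarred i) (bar (unbarred i)) (unbarred p)) = _
  rw [Equiv.swap_apply_def]
  simp only [unbarred_injective.eq_iff, unbarred_ne_bar, if_false]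
  split_ifs
  · exact apply_bar _ _
  · rfl

lemma entry_mul_add (w : SignedPerm n) {i j : Fin n} (h : i < j) (p : Fin n) :
    entry (w * (PosRoot.add i j h).refl) p =
      if p = i then bar (entry w j) else if p = j then bar (entry w i) else entry w p := by
  change w.1 (Equiv.swap (unbarred i) (bar (unbarred j))
    (Equiv.swap (unbarred j) (bar (unbarred i)) (unbarred p))) = _
  by_cases hj : p = j
  · subst hj
    rw [Equiv.swap_apply_left, Equiv.swap_apply_of_ne_of_ne (unbarred_ne_bar _ _).symm
      (fun e => h.ne (unbarred_injective (bar_injective e))), apply_bar, if_neg h.ne', if_pos rfl]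
    rfl
  · rw [Equiv.swap_apply_of_ne_of_ne (fun e => hj (unbarred_injective e)) (unbarred_ne_bar _ _),
      Equiv.swap_apply_def]
    simp only [unbarred_injective.eq_iff, unbarred_ne_bar, if_false, if_neg hj]
    split_ifs
    · exact apply_bar _ _
    · rfl

lemma mul_refl_add (w : SignedPerm n) {i j : Fin n} (h : i < j) :
    w * (PosRoot.add i j h).refl =
      w * (PosRoot.sub i j h).refl * (PosRoot.long i).refl * (PosRoot.long j).refl := by
  refine ext_entry fun p => ?_
  simp only [entry_mul_add, entry_mul_long, entry_mul_sub, if_true, if_neg h.ne', if_neg h.ne]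
  split_ifs <;> simp_all

lemma mul_refl_mul_refl (w : SignedPerm n) (β : PosRoot n) : w * β.refl * β.refl = w := by
  refine ext_entry fun p => ?_
  cases β with
  | sub i j h =>
    simp only [entry_mul_sub]
    split_ifs <;> simp_all
  | add i j h =>
    simp only [entry_mul_add]
    split_ifs <;> simp_all [bar_bar]
  | long i =>
    simp only [entry_mul_long]
    split_ifs <;> simp_all [bar_bar]

lemma mul_refl_ne (w : SignedPerm n) (β : PosRoot n) : w * β.refl ≠ w := by
  intro e
  cases β with
  | sub i j h =>
    have hi := congrArg (fun v => entry v i) e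
    simp only [entry_mul_sub, if_true] at hi
    exact h.ne' (entry_injective w hi)
  | add i j h =>
    have hi := congrArg (fun v => entry v i) e
    simp only [entry_mul_add, if_true] at hi
    exact entry_ne_bar_entry _ _ _ hi.symm
  | long i =>
    have hi := congrArg (fun v => entry v i) e
    simp only [entry_mul_long, if_true] at hi
    exact entry_ne_bar_entry _ _ _ hi.symm

/-! ### Inversion sums -/

/-- The Iverson bracket `[x < y]`. -/
def ltInd {α : Type*} [LinearOrder α] (x y : α) : ℚ := if x < y then 1 else 0

lemma ltInd_eq_zero_or_one {α : Type*} [LinearOrder α] (x y : α) :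
    ltInd x y = 0 ∨ ltInd x y = 1 := by
  unfold ltInd
  split_ifs <;> simp

lemma ltInd_add_swap {α : Type*} [LinearOrder α] {x y : α} (h : x ≠ y) :
    ltInd x y + ltInd y x = 1 := by
  rcases lt_or_gt_of_ne h with h | h <;> simp [ltInd, h, h.not_gt]

lemma ltInd_self {α : Type*} [LinearOrder α] (x : α) : ltInd x x = 0 := by
  simp [ltInd]

lemma ltInd_bar_bar (x y : Letter n) : ltInd (bar x) (bar y) = ltInd y x := by
  simp only [ltInd, bar_lt_bar]

lemma ltInd_bar_comm (x y : Letter n) : ltInd (bar x) y = ltInd (bar y) x := by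
  simp only [ltInd, bar_lt_comm]

lemma sum_letter {M : Type*} [AddCommMonoid M] (f : Letter n → M) :
    ∑ x, f x = ∑ i : Fin n, (f (unbarred i) + f (bar (unbarred i))) := by
  let e : Fin n ⊕ Fin n → Letter n := Sum.elim unbarred (bar ∘ unbarred)
  have he : Function.Bijective e := by
    refine ⟨unbarred_injective.sumElim (bar_injective.comp unbarred_injective)
      fun i j => unbarred_ne_bar i j, fun x => ?_⟩
    obtain ⟨i, rfl | rfl⟩ := exists_eq_unbarred_or_bar x
    exacts [⟨Sum.inl i, rfl⟩, ⟨Sum.inr i, rfl⟩]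
  rw [← Equiv.sum_comp (Equiv.ofBijective e he), Fintype.sum_sum_type, Finset.sum_add_distrib]
  rfl

lemma absLetter_unbarred (i : Fin n) : absLetter (unbarred i) = unbarred i :=
  min_eq_left (Fin.le_def.2 (by rw [val_bar, val_unbarred]; omega))

lemma absLetter_bar (x : Letter n) : absLetter (bar x) = absLetter x := by
  rw [absLetter, absLetter, bar_bar, min_comm]

lemma length_eq_sum (w : SignedPerm n) :
    (length w : ℚ) = ∑ p, ∑ q, if p ≤ q then
      ltInd (entry w q) (entry w p) + ltInd (bar (entry w q)) (entry w p) else 0 := by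
  rw [length, Finset.card_filter, Nat.cast_sum, Fintype.sum_prod_type]
  refine Finset.sum_congr rfl fun p _ => ?_
  rw [sum_letter]
  refine Finset.sum_congr rfl fun q _ => ?_
  have hle : unbarred p ≤ unbarred q ↔ p ≤ q := Iff.rfl
  simp only [absLetter_unbarred, absLetter_bar, apply_bar, hle, ltInd, entry]
  by_cases hpq : p ≤ q
  · simp only [hpq, true_and, if_true, Nat.cast_ite, Nat.cast_one, Nat.cast_zero]
    congr
  · simp [hpq]

lemma two_mul_sum_le_of_symm {ι : Type*} [Fintype ι] [LinearOrder ι] {f : ι → ι → ℚ}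
    (hf : ∀ p q, f p q = f q p) :
    2 * ∑ p, ∑ q, (if p ≤ q then f p q else 0) = ∑ p, ∑ q, f p q + ∑ p, f p p := by
  have hflip : ∑ p, ∑ q, (if p ≤ q then f p q else 0) =
      ∑ p, ∑ q, (if q ≤ p then f p q else 0) := by
    rw [Finset.sum_comm]
    simp only [hf]
  rw [two_mul]
  nth_rewrite 2 [hflip]
  simp only [← Finset.sum_add_distrib]
  refine Finset.sum_congr rfl fun p _ => ?_
  have hdiag : f p p = ∑ q, if q = p then f p q else 0 := by simp
  rw [hdiag, ← Finset.sum_add_distrib]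
  refine Finset.sum_congr rfl fun q _ => ?_
  rcases lt_trichotomy p q with h | rfl | h
  · simp [h.le, h.not_ge, h.ne']
  · simp
  · simp [h.le, h.not_ge, h.ne]

lemma sum_le_comp_perm_of_symm {ι : Type*} [Fintype ι] [LinearOrder ι] {f : ι → ι → ℚ}
    (hf : ∀ p q, f p q = f q p) (σ : Equiv.Perm ι) :
    ∑ p, ∑ q, (if p ≤ q then f (σ p) (σ q) else 0) = ∑ p, ∑ q, (if p ≤ q then f p q else 0) := by
  have h := two_mul_sum_le_of_symm (f := fun p q => f (σ p) (σ q)) fun p q => hf _ _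
  have h' := two_mul_sum_le_of_symm hf
  have hdouble : ∑ p, ∑ q, f (σ p) (σ q) = ∑ p, ∑ q, f p q := by
    rw [← Equiv.sum_comp σ (fun p => ∑ q, f p q)]
    exact Finset.sum_congr rfl fun p _ => Equiv.sum_comp σ (f (σ p))
  rw [hdouble, Equiv.sum_comp σ (fun p => f p p), ← h'] at h
  exact mul_left_cancel₀ two_ne_zero h

/-- The number of pairs of positions `p < q` with `a q < a p`. -/
def inversionSum {α : Type*} [LinearOrder α] (a : Fin n → α) : ℚ :=
  ∑ p, ∑ q, ltInd p q * ltInd (a q) (a p)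

lemma ltInd_swap_sub_ltInd {i j : Fin n} (h : i < j) (p q : Fin n) :
    ltInd (Equiv.swap i j p) (Equiv.swap i j q) - ltInd p q =
      (if p = j then if i < q ∧ q < j then 1 else 0 else 0) -
      (if p = i then if i < q ∧ q < j then 1 else 0 else 0) +
      (if q = i then if i < p ∧ p < j then 1 else 0 else 0) -
      (if q = j then if i < p ∧ p < j then 1 else 0 else 0) +
      (if p = j then if q = i then 1 else 0 else 0) -
      (if p = i then if q = j then 1 else 0 else 0) := by
  simp only [ltInd, Equiv.swap_apply_def]
  by_cases hpi : p = i <;> by_cases hpj : p = j <;> by_cases hqi : q = i <;>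
    by_cases hqj : q = j <;> simp only [hpi, hpj, hqi, hqj] <;> grind

lemma inversionSum_comp_swap {α : Type*} [LinearOrder α] {a : Fin n → α}
    (ha : Function.Injective a) {i j : Fin n} (h : i < j) :
    inversionSum (a ∘ Equiv.swap i j) - inversionSum a = 1 - 2 * ltInd (a j) (a i) +
      2 * ∑ m ∈ Finset.Ioo i j, (ltInd (a i) (a m) - ltInd (a j) (a m)) := by
  have hreindex : inversionSum (a ∘ Equiv.swap i j) =
      ∑ p, ∑ q, ltInd (Equiv.swap i j p) (Equiv.swap i j q) * ltInd (a q) (a p) := by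
    rw [inversionSum, ← Equiv.sum_comp (Equiv.swap i j)]
    refine Finset.sum_congr rfl fun p _ => ?_
    rw [← Equiv.sum_comp (Equiv.swap i j)]
    simp
  have hIoo (f : Fin n → ℚ) :
      ∑ m, (if i < m ∧ m < j then f m else 0) = ∑ m ∈ Finset.Ioo i j, f m := by
    rw [← Finset.sum_filter]
    exact Finset.sum_congr (by ext; simp) fun _ _ => rfl
  have hrow : ∀ m ∈ Finset.Ioo i j, 2 * (ltInd (a i) (a m) - ltInd (a j) (a m)) =
      ltInd (a m) (a j) - ltInd (a m) (a i) + (ltInd (a i) (a m) - ltInd (a j) (a m)) := by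
    intro m hm
    rw [Finset.mem_Ioo] at hm
    linarith [ltInd_add_swap (ha.ne hm.1.ne), ltInd_add_swap (ha.ne hm.2.ne)]
  rw [Finset.mul_sum, Finset.sum_congr rfl hrow, hreindex, inversionSum,
    ← Finset.sum_sub_distrib]
  simp only [← Finset.sum_sub_distrib, ← sub_mul, ltInd_swap_sub_ltInd h]
  simp only [add_mul, sub_mul, Finset.sum_add_distrib, Finset.sum_sub_distrib, ite_mul, one_mul,
    zero_mul, Finset.sum_ite_eq', Finset.mem_univ, if_true, hIoo,
    Finset.sum_ite_irrel, Finset.sum_const_zero]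
  linarith [ltInd_add_swap (ha.ne h.ne)]

lemma length_eq_inversionSum_add (w : SignedPerm n) :
    (length w : ℚ) = inversionSum (entry w) +
      ∑ p, ∑ q, if p ≤ q then ltInd (bar (entry w q)) (entry w p) else 0 := by
  simp only [length_eq_sum, inversionSum, ← Finset.sum_add_distrib]
  refine Finset.sum_congr rfl fun p _ => Finset.sum_congr rfl fun q _ => ?_
  rcases lt_trichotomy p q with h | rfl | h
  · simp [h, h.le, ltInd]
  · simp [ltInd]
  · simp [h.not_gt, h.not_ge, ltInd]

lemma length_mul_sub (u : SignedPerm n) {i j : Fin n} (h : i < j) :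
    (length (u * (PosRoot.sub i j h).refl) : ℚ) - length u =
      1 - 2 * ltInd (entry u j) (entry u i) +
        2 * ∑ m ∈ Finset.Ioo i j,
          (ltInd (entry u i) (entry u m) - ltInd (entry u j) (entry u m)) := by
  have hentry : entry (u * (PosRoot.sub i j h).refl) = entry u ∘ Equiv.swap i j := by
    funext p
    rw [entry_mul_sub, Function.comp_apply, Equiv.swap_apply_def]
    split_ifs <;> rfl
  have hsymm (p q : Fin n) : ltInd (bar (entry u q)) (entry u p) =
      ltInd (bar (entry u p)) (entry u q) := ltInd_bar_comm _ _
  rw [length_eq_inversionSum_add, length_eq_inversionSum_add, hentry,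
    ← inversionSum_comp_swap (entry_injective u) h,
    ← sum_le_comp_perm_of_symm hsymm (Equiv.swap i j)]
  simp only [Function.comp_apply]
  ring

lemma length_mul_long (u : SignedPerm n) (i : Fin n) :
    (length (u * (PosRoot.long i).refl) : ℚ) - length u =
      1 - 2 * ltInd (bar (entry u i)) (entry u i) +
        2 * ∑ m ∈ Finset.Ioi i,
          (ltInd (entry u i) (entry u m) - ltInd (bar (entry u i)) (entry u m)) := by
  have hne {p : Fin n} (hp : p ≠ i) : entry (u * (PosRoot.long i).refl) p = entry u p := by
    rw [entry_mul_long, if_neg hp]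
  have hself : entry (u * (PosRoot.long i).refl) i = bar (entry u i) := by
    rw [entry_mul_long, if_pos rfl]
  have hrow {p : Fin n} (hp : p ≠ i) (q : Fin n) :
      ltInd (entry (u * (PosRoot.long i).refl) q) (entry (u * (PosRoot.long i).refl) p) +
        ltInd (bar (entry (u * (PosRoot.long i).refl) q)) (entry (u * (PosRoot.long i).refl) p) =
      ltInd (entry u q) (entry u p) + ltInd (bar (entry u q)) (entry u p) := by
    rw [hne hp]
    by_cases hq : q = i
    · rw [hq, hself, bar_bar, add_comm]
    · rw [hne hq]
  have hsplit (f : Fin n → ℚ) :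
      ∑ q, (if i ≤ q then f q else 0) = f i + ∑ m ∈ Finset.Ioi i, f m := by
    rw [← Finset.sum_filter, Finset.filter_le_eq_Ici, ← Finset.Ioi_insert,
      Finset.sum_insert Finset.notMem_Ioi_self]
  rw [length_eq_sum, length_eq_sum, ← Finset.sum_sub_distrib,
    Finset.sum_eq_single i (fun p _ hp => by simp only [hrow hp, sub_self]) (by simp),
    hsplit, hsplit, hself, bar_bar, ltInd_self, ltInd_self, Finset.mul_sum]
  have hterm : ∀ m ∈ Finset.Ioi i,
      ltInd (entry (u * (PosRoot.long i).refl) m) (bar (entry u i)) +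
        ltInd (bar (entry (u * (PosRoot.long i).refl) m)) (bar (entry u i)) -
        (ltInd (entry u m) (entry u i) + ltInd (bar (entry u m)) (entry u i)) =
      2 * (ltInd (entry u i) (entry u m) - ltInd (bar (entry u i)) (entry u m)) := by
    intro m hm
    have hm := (Finset.mem_Ioi.1 hm).ne'
    rw [hne hm, ltInd_bar_bar, ltInd_bar_comm (entry u m)]
    linarith [ltInd_add_swap ((entry_injective u).ne hm), ltInd_add_swap (entry_ne_bar_entry u m i)]
  rw [← Finset.sum_congr rfl hterm, Finset.sum_sub_distrib]
  linarith [ltInd_add_swap (entry_ne_bar_entry u i i)]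

lemma sum_Ioi_eq_sum_Ioo_add {i j : Fin n} (h : i < j) (f : Fin n → ℚ) :
    ∑ m ∈ Finset.Ioi i, f m = ∑ m ∈ Finset.Ioo i j, f m + (f j + ∑ m ∈ Finset.Ioi j, f m) := by
  rw [← Finset.sum_insert Finset.notMem_Ioi_self, ← Finset.sum_union]
  · refine Finset.sum_congr (Finset.ext fun m => ?_) fun _ _ => rfl
    simp only [Finset.mem_Ioi, Finset.mem_union, Finset.mem_Ioo, Finset.mem_insert]
    omega
  · refine Finset.disjoint_left.2 fun m hm hm' => ?_
    simp only [Finset.mem_Ioo, Finset.mem_insert, Finset.mem_Ioi] at hm hm'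
    omega

lemma length_mul_add (u : SignedPerm n) {i j : Fin n} (h : i < j) :
    (length (u * (PosRoot.add i j h).refl) : ℚ) - length u =
      3 - 2 * ltInd (bar (entry u j)) (entry u i) - 2 * ltInd (bar (entry u i)) (entry u i) -
        2 * ltInd (bar (entry u j)) (entry u j) +
        2 * ∑ m ∈ Finset.Ioo i j,
          (ltInd (entry u i) (entry u m) - ltInd (bar (entry u j)) (entry u m)) +
        2 * ∑ m ∈ Finset.Ioi j,
          (ltInd (entry u i) (entry u m) - ltInd (bar (entry u j)) (entry u m)) +
        2 * ∑ m ∈ Finset.Ioi j,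
          (ltInd (entry u j) (entry u m) - ltInd (bar (entry u i)) (entry u m)) := by
  set v := u * (PosRoot.sub i j h).refl with hv
  have hvi : entry v i = entry u j := by rw [hv, entry_mul_sub, if_pos rfl]
  have hvj : entry v j = entry u i := by rw [hv, entry_mul_sub, if_neg h.ne', if_pos rfl]
  have hwj : entry (v * (PosRoot.long i).refl) j = entry u i := by
    rw [entry_mul_long, if_neg h.ne', hvj]
  have hvmid : ∀ m ∈ Finset.Ioo i j, entry v m = entry u m := fun m hm => by
    obtain ⟨him, hmj⟩ := Finset.mem_Ioo.1 hm
    rw [hv, entry_mul_sub, if_neg him.ne', if_neg hmj.ne]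
  have hvright : ∀ m ∈ Finset.Ioi j, entry v m = entry u m := fun m hm => by
    have hjm := Finset.mem_Ioi.1 hm
    rw [hv, entry_mul_sub, if_neg (h.trans hjm).ne', if_neg hjm.ne']
  have hwright : ∀ m ∈ Finset.Ioi j, entry (v * (PosRoot.long i).refl) m = entry u m :=
    fun m hm => by
      rw [entry_mul_long, if_neg (h.trans (Finset.mem_Ioi.1 hm)).ne', hvright m hm]
  have hcongr {s : Finset (Fin n)} {w : SignedPerm n} (hw : ∀ m ∈ s, entry w m = entry u m)
      (x y : Letter n) : ∑ m ∈ s, (ltInd x (entry w m) - ltInd y (entry w m)) =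
        ∑ m ∈ s, (ltInd x (entry u m) - ltInd y (entry u m)) :=
    Finset.sum_congr rfl fun m hm => by rw [hw m hm]
  have hsub := length_mul_sub u h
  have hlong_i := length_mul_long v i
  have hlong_j := length_mul_long (v * (PosRoot.long i).refl) j
  rw [sum_Ioi_eq_sum_Ioo_add h, hvi, hcongr hvmid, hcongr hvright, hvj] at hlong_i
  rw [hwj, hcongr hwright] at hlong_j
  rw [mul_refl_add, ← hv]
  simp only [Finset.sum_sub_distrib] at hsub hlong_i hlong_j ⊢
  linarith

/-! ### Quantum Bruhat edges -/

instance (x y z : Letter n) : Decidable (CircLT x y z) := by unfold CircLT; infer_instance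

/-- The number of positions `m ∈ s` with `x ≺ u(m) ≺ y` in the circular order. -/
def circCount (u : SignedPerm n) (s : Finset (Fin n)) (x y : Letter n) : ℕ :=
  (s.filter fun m => CircLT x (entry u m) y).card

lemma circCount_le_card (u : SignedPerm n) (s : Finset (Fin n)) (x y : Letter n) :
    circCount u s x y ≤ s.card := Finset.card_filter_le _ _

lemma circCount_eq_zero {u : SignedPerm n} {s : Finset (Fin n)} {x y : Letter n} :
    circCount u s x y = 0 ↔ ∀ m ∈ s, ¬ CircLT x (entry u m) y := by
  rw [circCount, Finset.card_eq_zero, Finset.filter_eq_empty_iff]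

lemma sum_ltInd_sub_ltInd (u : SignedPerm n) {s : Finset (Fin n)} {x y : Letter n} (hxy : x ≠ y)
    (hx : ∀ m ∈ s, entry u m ≠ x) (hy : ∀ m ∈ s, entry u m ≠ y) :
    ∑ m ∈ s, (ltInd x (entry u m) - ltInd y (entry u m)) =
      circCount u s x y - ltInd y x * s.card := by
  rw [circCount, Finset.card_filter, Nat.cast_sum, mul_comm (ltInd y x), ← nsmul_eq_mul,
    ← Finset.sum_const (ltInd y x), ← Finset.sum_sub_distrib]
  refine Finset.sum_congr rfl fun m hm => ?_
  have := Fin.val_ne_of_ne (hx m hm)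
  have := Fin.val_ne_of_ne (hy m hm)
  have := Fin.val_ne_of_ne hxy
  by_cases hcirc : CircLT x (entry u m) y <;>
    simp only [hcirc, ltInd, if_true, if_false, Fin.lt_def] <;>
    simp only [CircLT, Fin.lt_def] at hcirc <;> split_ifs <;> first | omega | norm_num

/-- The part of the obstruction to `u → u s_β`, `β = (i, j̄)`, that depends on the letters
`x = u(i)` and `y = u(j)` alone. It vanishes when one of them is barred, the other is not, and
`x < ȳ`. -/
def signObstruction (x y : Letter n) : ℕ :=
  if (bar x < x ↔ bar y < y) then 1 else if bar y < x then 2 else 0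

lemma signObstruction_le_two (x y : Letter n) : signObstruction x y ≤ 2 := by
  unfold signObstruction
  split_ifs <;> norm_num

lemma cast_signObstruction {x y : Letter n} (hx : x ≠ bar x) (hy : y ≠ bar y) :
    (signObstruction x y : ℚ) =
      1 + 2 * ltInd (bar y) x - ltInd (bar x) x - ltInd (bar y) y := by
  have hx' := Fin.val_ne_of_ne hx
  have hy' := Fin.val_ne_of_ne hy
  simp only [signObstruction, ltInd, Fin.lt_def]
  rw [val_bar] at hx' hy'
  split_ifs <;> simp only [val_bar] at * <;> first | omega | norm_num

/-- Half the excess of `ℓ(u s_β)` over the value it takes, among those allowed by the signs of the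
letters involved, when `u → u s_β` is an edge of the quantum Bruhat graph. -/
def obstruction (u : SignedPerm n) : PosRoot n → ℕ
  | .sub i j _ => circCount u (Finset.Ioo i j) (entry u i) (entry u j)
  | .long i => circCount u (Finset.Ioi i) (entry u i) (bar (entry u i))
  | .add i j _ =>
    circCount u (Finset.Ioo i j) (entry u i) (bar (entry u j)) +
      circCount u (Finset.Ioi j) (entry u i) (bar (entry u j)) +
      circCount u (Finset.Ioi j) (entry u j) (bar (entry u i)) +
      signObstruction (entry u i) (entry u j)

lemma cast_card_Ioo_add_one {i j : Fin n} (h : i < j) :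
    ((Finset.Ioo i j).card : ℚ) + 1 = (j.val : ℚ) - i.val := by
  have : (Finset.Ioo i j).card + 1 + i.val = j.val := by
    rw [Fin.card_Ioo]
    omega
  rw [eq_sub_iff_add_eq]
  exact_mod_cast this

lemma cast_card_Ioi_add_one (i : Fin n) : ((Finset.Ioi i).card : ℚ) + 1 = (n : ℚ) - i.val := by
  have : (Finset.Ioi i).card + 1 + i.val = n := by
    rw [Fin.card_Ioi]
    omega
  rw [eq_sub_iff_add_eq]
  exact_mod_cast this

lemma rhoCoroot_sub {i j : Fin n} (h : i < j) :
    rhoCoroot (PosRoot.sub i j h) = ((Finset.Ioo i j).card : ℚ) + 1 := by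
  rw [cast_card_Ioo_add_one h]
  simp [rhoCoroot, PosRoot.vec, rho, dotProduct_sub, h.ne, h.ne']
  ring

lemma rhoCoroot_long (i : Fin n) :
    rhoCoroot (PosRoot.long i) = ((Finset.Ioi i).card : ℚ) + 1 := by
  rw [cast_card_Ioi_add_one]
  simp [rhoCoroot, PosRoot.vec, rho]
  ring

lemma rhoCoroot_add {i j : Fin n} (h : i < j) :
    rhoCoroot (PosRoot.add i j h) =
      ((Finset.Ioo i j).card : ℚ) + 2 * (Finset.Ioi j).card + 3 := by
  have hIoo := cast_card_Ioo_add_one h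
  have hIoi := cast_card_Ioi_add_one j
  have hrho : rhoCoroot (PosRoot.add i j h) = (n : ℚ) - i.val + (n - j.val) := by
    simp [rhoCoroot, PosRoot.vec, rho, dotProduct_add, h.ne, h.ne']
    ring
  linarith

lemma obstruction_add_one_le_rhoCoroot (u : SignedPerm n) (β : PosRoot n) :
    (obstruction u β : ℚ) + 1 ≤ rhoCoroot β := by
  have hcirc (s : Finset (Fin n)) (x y : Letter n) : (circCount u s x y : ℚ) ≤ s.card :=
    Nat.cast_le.2 (circCount_le_card u s x y)
  cases β with
  | sub i j h =>
    rw [rhoCoroot_sub, obstruction]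
    linarith [hcirc (Finset.Ioo i j) (entry u i) (entry u j)]
  | long i =>
    rw [rhoCoroot_long, obstruction]
    linarith [hcirc (Finset.Ioi i) (entry u i) (bar (entry u i))]
  | add i j h =>
    have hsign : (signObstruction (entry u i) (entry u j) : ℚ) ≤ 2 :=
      mod_cast signObstruction_le_two _ _
    rw [rhoCoroot_add, obstruction]
    push_cast
    linarith [hcirc (Finset.Ioo i j) (entry u i) (bar (entry u j)),
      hcirc (Finset.Ioi j) (entry u i) (bar (entry u j)),
      hcirc (Finset.Ioi j) (entry u j) (bar (entry u i))]

lemma exists_length_mul_refl (u : SignedPerm n) (β : PosRoot n) :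
    ∃ e : ℚ, (e = 0 ∨ e = 1) ∧
      (length (u * β.refl) : ℚ) - length u = 1 - 2 * e * rhoCoroot β + 2 * obstruction u β := by
  have hne {p q : Fin n} (h : p ≠ q) : entry u p ≠ entry u q := (entry_injective u).ne h
  have hbar (p q : Fin n) : entry u p ≠ bar (entry u q) := entry_ne_bar_entry u p q
  cases β with
  | sub i j h =>
    refine ⟨ltInd (entry u j) (entry u i), ltInd_eq_zero_or_one _ _, ?_⟩
    rw [length_mul_sub, sum_ltInd_sub_ltInd u (hne h.ne)
      (fun m hm => hne (Finset.mem_Ioo.1 hm).1.ne') (fun m hm => hne (Finset.mem_Ioo.1 hm).2.ne),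
      rhoCoroot_sub, obstruction]
    ring
  | long i =>
    refine ⟨ltInd (bar (entry u i)) (entry u i), ltInd_eq_zero_or_one _ _, ?_⟩
    rw [length_mul_long, sum_ltInd_sub_ltInd u (hbar i i)
      (fun m hm => hne (Finset.mem_Ioi.1 hm).ne') (fun m _ => hbar m i), rhoCoroot_long,
      obstruction]
    ring
  | add i j h =>
    refine ⟨ltInd (bar (entry u j)) (entry u i), ltInd_eq_zero_or_one _ _, ?_⟩
    have hi (m : Fin n) (hm : m ∈ Finset.Ioi j) : entry u m ≠ entry u i :=
      hne (h.trans (Finset.mem_Ioi.1 hm)).ne'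
    rw [length_mul_add, sum_ltInd_sub_ltInd u (hbar i j)
      (fun m hm => hne (Finset.mem_Ioo.1 hm).1.ne') (fun m _ => hbar m j),
      sum_ltInd_sub_ltInd u (hbar i j) hi (fun m _ => hbar m j),
      sum_ltInd_sub_ltInd u (hbar j i) (fun m hm => hne (Finset.mem_Ioi.1 hm).ne')
        (fun m _ => hbar m i), rhoCoroot_add, obstruction, ltInd_bar_comm (entry u i) (entry u j)]
    push_cast
    rw [cast_signObstruction (hbar i i) (hbar j j)]
    ring

/-- The pair `u → u s_β` is an edge of the quantum Bruhat graph: either `ℓ(u s_β) = ℓ(u) + 1` or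
`ℓ(u s_β) = ℓ(u) - 2⟨ρ, β^∨⟩ + 1`. -/
def QuantumEdge (u : SignedPerm n) (β : PosRoot n) : Prop :=
  (length (u * β.refl) : ℚ) = length u + 1 ∨
    (length (u * β.refl) : ℚ) = length u - 2 * rhoCoroot β + 1

lemma quantumEdge_iff {u : SignedPerm n} {β : PosRoot n} :
    QuantumEdge u β ↔ obstruction u β = 0 := by
  obtain ⟨e, rfl | rfl, hlen⟩ := exists_length_mul_refl u β
  all_goals
    have : (0 : ℚ) ≤ obstruction u β := Nat.cast_nonneg _
    have hle := obstruction_add_one_le_rhoCoroot u β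
    rw [QuantumEdge, ← Nat.cast_eq_zero (R := ℚ)]
  · exact ⟨fun h => by rcases h with h | h <;> linarith, fun h => Or.inl (by linarith)⟩
  · exact ⟨fun h => by rcases h with h | h <;> linarith, fun h => Or.inr (by linarith)⟩

lemma half_length_sub_add_rhoCoroot (u : SignedPerm n) (β : PosRoot n) :
    (1 / 2 : ℚ) * ((length (u * β.refl) : ℚ) - length u - 1) +
      (if length (u * β.refl) < length u then rhoCoroot β else 0) = obstruction u β := by
  obtain ⟨e, rfl | rfl, hlen⟩ := exists_length_mul_refl u β
  all_goals
    have : (0 : ℚ) ≤ obstruction u β := Nat.cast_nonneg _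
    have hle := obstruction_add_one_le_rhoCoroot u β
    simp only [← Nat.cast_lt (α := ℚ)]
  · rw [if_neg (by linarith)]
    linarith
  · rw [if_pos (by linarith)]
    linarith

lemma quantumEdge_sub_iff {u : SignedPerm n} {i j : Fin n} (h : i < j) :
    QuantumEdge u (PosRoot.sub i j h) ↔
      ∀ m, i < m → m < j → ¬ CircLT (entry u i) (entry u m) (entry u j) := by
  simp only [quantumEdge_iff, obstruction, circCount_eq_zero, Finset.mem_Ioo, and_imp]

lemma quantumEdge_long_iff {u : SignedPerm n} {i : Fin n} :
    QuantumEdge u (PosRoot.long i) ↔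
      ∀ m, i < m → ¬ CircLT (entry u i) (entry u m) (bar (entry u i)) := by
  simp only [quantumEdge_iff, obstruction, circCount_eq_zero, Finset.mem_Ioi]

lemma quantumEdge_add_iff {u : SignedPerm n} {i j : Fin n} (h : i < j) :
    QuantumEdge u (PosRoot.add i j h) ↔
      entry u i < bar (entry u j) ∧
      (bar (entry u i) < entry u i ↔ entry u j < bar (entry u j)) ∧
      (∀ m, i < m → m < j → ¬ CircLT (entry u i) (entry u m) (bar (entry u j))) ∧
      (∀ m, j < m → ¬ CircLT (entry u i) (entry u m) (bar (entry u j))) ∧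
      ∀ m, j < m → ¬ CircLT (entry u j) (entry u m) (bar (entry u i)) := by
  have hij := entry_ne_bar_entry u i j
  have hjj := entry_ne_bar_entry u j j
  simp only [quantumEdge_iff, obstruction, Nat.add_eq_zero_iff, circCount_eq_zero, Finset.mem_Ioo,
    Finset.mem_Ioi, and_imp]
  rw [signObstruction]
  split_ifs with hmix hlt
  · grind
  · grind
  · grind

/-! ### Folding pairs as paths in the quantum Bruhat graph -/

lemma length_one : length (1 : SignedPerm n) = 0 := by
  rw [length, Finset.card_eq_zero, Finset.filter_eq_empty_iff]
  rintro ⟨p, x⟩ - ⟨hle, hlt⟩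
  exact absurd (hle.trans (min_le_left _ _)) (not_le.2 hlt)

lemma eq_one_of_length_eq_zero {w : SignedPerm n} (h : length w = 0) : w = 1 := by
  rw [length, Finset.card_eq_zero, Finset.filter_eq_empty_iff] at h
  have hle {p : Fin n} {x : Letter n} (hx : unbarred p ≤ absLetter x) : entry w p ≤ w.1 x :=
    not_lt.1 fun hlt => h (Finset.mem_univ (p, x)) ⟨hx, hlt⟩
  have hlt (p : Fin n) : (entry w p).val < n := by
    have := Fin.le_def.1 (hle (p := p) (x := bar (unbarred p))
      (by rw [absLetter_bar, absLetter_unbarred]))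
    rw [apply_bar, val_bar] at this
    change (entry w p).val ≤ 2 * n - 1 - (entry w p).val at this
    have := (entry w p).isLt
    omega
  have hmono : StrictMono fun p => (⟨(entry w p).val, hlt p⟩ : Fin n) := fun p q hpq =>
    lt_of_le_of_ne (hle (x := unbarred q) (by rw [absLetter_unbarred]; exact hpq.le))
      fun e => hpq.ne (entry_injective w (Fin.ext (Fin.mk.inj e)))
  have hid : (fun p => (⟨(entry w p).val, hlt p⟩ : Fin n)) = id :=
    (hmono.range_inj strictMono_id).1 <| by
      rw [Set.range_id, (Finite.surjective_of_injective hmono.injective).range_eq]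
  exact ext_entry fun p => Fin.ext (Fin.mk.inj (congrFun hid p))

lemma bruhatLT_mul_refl_iff {w : SignedPerm n} {β : PosRoot n} :
    BruhatLT w (w * β.refl) ↔ length w < length (w * β.refl) := by
  refine ⟨fun h => ?_, fun h => Relation.TransGen.single ⟨h, β, rfl⟩⟩
  exact Relation.TransGen.trans_induction_on h (fun h => h.1) fun _ _ h h' => h.trans h'

section Walk

variable {Γ : List (PosRoot n)}

lemma filter_val_lt_succ {N : ℕ} {P : Fin N → Prop} [DecidablePred P] (p : Fin N) :
    (List.finRange N).filter (fun q => P q ∧ q.val < p.val + 1) =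
      (List.finRange N).filter (fun q => P q ∧ q.val < p.val) ++ if P p then [p] else [] := by
  have hsorted (Q : Fin N → Bool) : ((List.finRange N).filter Q).Pairwise (· < ·) :=
    (List.sortedLT_finRange N).pairwise.filter Q
  refine (hsorted _).eq_of_mem_iff (List.pairwise_append.2 ⟨hsorted _, ?_, fun q hq r hr => ?_⟩)
    fun q => ?_
  · split_ifs <;> simp
  · have hrp : r = p := by
      split_ifs at hr
      · exact List.mem_singleton.1 hr
      · exact absurd hr List.not_mem_nil
    rw [hrp]
    exact (of_decide_eq_true (List.mem_filter.1 hq).2).2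
  · by_cases hqp : q = p
    · by_cases hp : P p <;> simp [hqp, hp]
    · have hval : q.val ≠ p.val := Fin.val_ne_of_ne hqp
      by_cases hp : P p <;> simp [hqp, hp, Nat.le_iff_lt_or_eq, hval]

lemma walk_zero (F : FoldingPair Γ) : walk F 0 = F.1 := by
  simp [walk]

lemma walk_succ (F : FoldingPair Γ) (p : Fin Γ.length) :
    walk F (p.val + 1) = if p ∈ F.2 then walk F p.val * (Γ.get p).refl else walk F p.val := by
  rw [walk, filter_val_lt_succ, List.map_append, List.prod_append, ← mul_assoc]
  change walk F p.val * _ = _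
  split_ifs <;> simp

lemma foldingPair_ext {F F' : FoldingPair Γ} (h : ∀ p ≤ Γ.length, walk F p = walk F' p) :
    F = F' := by
  have hstart : F.1 = F'.1 := by simpa only [walk_zero] using h 0 (Nat.zero_le _)
  refine Prod.ext hstart (Finset.ext fun q => ?_)
  have hsucc := h (q.val + 1) q.isLt
  have hne := mul_refl_ne (walk F' q.val) (Γ.get q)
  rw [walk_succ, walk_succ, h q.val q.isLt.le] at hsucc
  by_cases hq : q ∈ F.2 <;> by_cases hq' : q ∈ F'.2 <;>
    simp only [hq, hq', if_true, if_false] at hsucc ⊢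
  · exact absurd hsucc hne
  · exact absurd hsucc.symm hne

lemma statistic_eq_length_add_sum_obstruction (F : FoldingPair Γ) :
    (1 / 2 : ℚ) * ((length F.1 : ℚ) + (length (endPoint F) : ℚ) - (F.2.card : ℚ)) +
      ∑ j ∈ negFoldings F, rhoCoroot (Γ.get j) =
      length (endPoint F) + ∑ j ∈ F.2, (obstruction (walk F (j.val + 1)) (Γ.get j) : ℚ) := by
  have hstep : ∀ j ∈ F.2, walk F (j.val + 1) * (Γ.get j).refl = walk F j.val := fun j hj => by
    rw [walk_succ, if_pos hj, mul_refl_mul_refl]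
  have htelescope : ∑ j ∈ F.2, ((length (walk F j.val) : ℚ) - length (walk F (j.val + 1))) =
      length F.1 - length (endPoint F) := by
    rw [endPoint, ← walk_zero, ← Finset.sum_range_sub' fun p => (length (walk F p) : ℚ),
      Finset.sum_range]
    refine Finset.sum_subset (Finset.subset_univ _) fun j _ hj => ?_
    rw [walk_succ, if_neg hj, sub_self]
  have hneg : ∑ j ∈ negFoldings F, rhoCoroot (Γ.get j) = ∑ j ∈ F.2,
      if length (walk F j.val) < length (walk F (j.val + 1)) then rhoCoroot (Γ.get j) else 0 := by
    classical
    rw [negFoldings, Finset.sum_filter]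
    refine Finset.sum_congr rfl fun j hj => ?_
    rw [walk_succ, if_pos hj]
    simp only [bruhatLT_mul_refl_iff]
  have hobs : ∑ j ∈ F.2, (obstruction (walk F (j.val + 1)) (Γ.get j) : ℚ) = ∑ j ∈ F.2,
      ((1 / 2 : ℚ) * (length (walk F j.val) - length (walk F (j.val + 1)) - 1) +
        if length (walk F j.val) < length (walk F (j.val + 1)) then rhoCoroot (Γ.get j) else 0) :=
    Finset.sum_congr rfl fun j hj => by rw [← half_length_sub_add_rhoCoroot, hstep j hj]
  rw [hneg, hobs, Finset.sum_add_distrib, ← Finset.mul_sum, Finset.sum_sub_distrib, htelescope,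
    Finset.sum_const, nsmul_one]
  ring

lemma mem_FBar_iff {F : FoldingPair Γ} :
    F ∈ FBar Γ ↔
      endPoint F = 1 ∧ ∀ j ∈ F.2, QuantumEdge (walk F (j.val + 1)) (Γ.get j) := by
  have hlen : length (endPoint F) = 0 ↔ endPoint F = 1 :=
    ⟨eq_one_of_length_eq_zero, fun h => h ▸ length_one⟩
  rw [FBar, Set.mem_ofPred_eq, statistic_eq_length_add_sum_obstruction]
  norm_cast
  simp only [Nat.add_eq_zero_iff, Finset.sum_eq_zero_iff, hlen, quantumEdge_iff]

/-- From position `a` on, the sequence `g` changes only along edges `g (p + 1) → g p` of the quantum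
Bruhat graph labelled by the roots `Γ[p]`. -/
def IsTrace (Γ : List (PosRoot n)) (a : ℕ) (g : ℕ → SignedPerm n) : Prop :=
  ∀ p, a ≤ p → ∀ β, Γ[p]? = some β →
    g p = g (p + 1) ∨ (QuantumEdge (g (p + 1)) β ∧ g p = g (p + 1) * β.refl)

lemma isTrace_walk {F : FoldingPair Γ} (hF : F ∈ FBar Γ) : IsTrace Γ 0 (walk F) := by
  intro p _ β hβ
  obtain ⟨hp, rfl⟩ := List.getElem?_eq_some_iff.1 hβ
  have hsucc := walk_succ F ⟨p, hp⟩
  by_cases hmem : (⟨p, hp⟩ : Fin Γ.length) ∈ F.2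
  · rw [if_pos hmem] at hsucc
    refine Or.inr ⟨(mem_FBar_iff.1 hF).2 _ hmem, ?_⟩
    rw [hsucc]
    exact (mul_refl_mul_refl _ _).symm
  · rw [if_neg hmem] at hsucc
    exact Or.inl hsucc.symm

lemma exists_foldingPair {g : ℕ → SignedPerm n} (hg : IsTrace Γ 0 g) (hend : g Γ.length = 1) :
    ∃ F ∈ FBar Γ, ∀ p ≤ Γ.length, walk F p = g p := by
  classical
  let F : FoldingPair Γ := (g 0, Finset.univ.filter fun q => g q.val ≠ g (q.val + 1))
  have hmem {q : Fin Γ.length} : q ∈ F.2 ↔ g q.val ≠ g (q.val + 1) := by simp [F]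
  have hedge {q : Fin Γ.length} (hq : q ∈ F.2) :
      QuantumEdge (g (q.val + 1)) (Γ.get q) ∧ g q.val = g (q.val + 1) * (Γ.get q).refl :=
    (hg q.val (Nat.zero_le _) _ (List.getElem?_eq_getElem q.isLt)).resolve_left (hmem.1 hq)
  have hwalk : ∀ p ≤ Γ.length, walk F p = g p := by
    intro p
    induction p with
    | zero => exact fun _ => walk_zero F
    | succ p ih =>
      intro hp
      have hsucc := walk_succ F ⟨p, hp⟩
      simp only [ih (Nat.le_of_succ_le hp)] at hsucc
      rw [hsucc]
      split_ifs with hq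
      · rw [(hedge hq).2, mul_refl_mul_refl]
      · exact not_not.1 fun h => hq (hmem.2 h)
  refine ⟨F, mem_FBar_iff.2 ⟨(hwalk _ le_rfl).trans hend, fun j hj => ?_⟩, hwalk⟩
  rw [hwalk _ j.isLt]
  exact (hedge hj).1

end Walk

/-- `QuantumPath L v u`: there is a path from `v` to `u` in the quantum Bruhat graph whose edges are
labelled by a sublist of `L`. -/
inductive QuantumPath : List (PosRoot n) → SignedPerm n → SignedPerm n → Prop
  | nil (v) : QuantumPath [] v v
  | skip {β L v u} : QuantumPath L v u → QuantumPath (β :: L) v u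
  | step {β L v u} : QuantumEdge v β → QuantumPath L (v * β.refl) u → QuantumPath (β :: L) v u

lemma quantumPath_append {A B : List (PosRoot n)} {u v : SignedPerm n} :
    QuantumPath (A ++ B) u v ↔ ∃ w, QuantumPath A u w ∧ QuantumPath B w v := by
  induction A generalizing u with
  | nil => exact ⟨fun h => ⟨u, .nil u, h⟩, by rintro ⟨w, ⟨⟩, h⟩; exact h⟩
  | cons β A ih =>
    constructor
    · rintro (_ | h | ⟨hs, h⟩)
      · obtain ⟨w, hA, hB⟩ := ih.1 h
        exact ⟨w, .skip hA, hB⟩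
      · obtain ⟨w, hA, hB⟩ := ih.1 h
        exact ⟨w, .step hs hA, hB⟩
    · rintro ⟨w, _ | hA | ⟨hs, hA⟩, hB⟩
      · exact .skip (ih.2 ⟨w, hA, hB⟩)
      · exact .step hs (ih.2 ⟨w, hA, hB⟩)

/-- Along `L`, a path in the quantum Bruhat graph is determined by its start and the value of `φ` at
its end: once two paths part, `φ` takes distinct values at their ends. -/
def Separates {α : Type*} (φ : SignedPerm n → α) : List (PosRoot n) → Prop
  | [] => True
  | β :: L => (∀ ⦃v u u'⦄, QuantumEdge v β → QuantumPath L (v * β.refl) u → QuantumPath L v u' →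
      φ u ≠ φ u') ∧ Separates φ L

lemma Separates.append {α γ : Type*} {φ : SignedPerm n → α} {ψ : SignedPerm n → γ}
    {A B : List (PosRoot n)} (hA : Separates ψ A) (hB : Separates φ B)
    (hφψ : ∀ ⦃w w' u u'⦄, QuantumPath B w u → QuantumPath B w' u' → φ u = φ u' → ψ w = ψ w') :
    Separates φ (A ++ B) := by
  induction A with
  | nil => exact hB
  | cons β A ih =>
    refine ⟨fun v u u' hedge hu hu' heq => ?_, ih hA.2⟩
    obtain ⟨w, hvw, hwu⟩ := quantumPath_append.1 hu
    obtain ⟨w', hvw', hwu'⟩ := quantumPath_append.1 hu'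
    exact hA.1 hedge hvw hvw' (hφψ hwu hwu' heq)

lemma Separates.map_append {α ι : Type*} {φ : SignedPerm n → α} {B : List (PosRoot n)}
    (hB : Separates φ B) {r : ι → ι → Prop} {f : ι → PosRoot n} {L : List ι} (hL : L.Pairwise r)
    (hφ : ∀ m ∈ L, ∀ L' ⊆ L, (∀ q ∈ L', r m q) → ∀ ⦃v u u'⦄, QuantumEdge v (f m) →
      QuantumPath (L'.map f ++ B) (v * (f m).refl) u → QuantumPath (L'.map f ++ B) v u' →
      φ u ≠ φ u') :
    Separates φ (L.map f ++ B) := by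
  induction L with
  | nil => exact hB
  | cons m L ih =>
    obtain ⟨hm, hL⟩ := List.pairwise_cons.1 hL
    exact ⟨hφ m List.mem_cons_self L (List.subset_cons_self m L) hm,
      ih hL fun q hq L' hL' =>
        hφ q (List.mem_cons_of_mem m hq) L' (List.subset_cons_of_subset m hL')⟩

lemma getElem?_length_of_isPrefix {α : Type*} {A Γ : List α} {β : α}
    (h : A ++ [β] <+: Γ) : Γ[A.length]? = some β := by
  obtain ⟨B, rfl⟩ := h
  simp

section Trace

variable {Γ A S : List (PosRoot n)} {g g' : ℕ → SignedPerm n}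

lemma IsTrace.mono {a b : ℕ} (hg : IsTrace Γ a g) (hab : a ≤ b) : IsTrace Γ b g :=
  fun p hp => hg p (hab.trans hp)

lemma IsTrace.update {p : ℕ} {β : PosRoot n} {v : SignedPerm n} (hg : IsTrace Γ (p + 1) g)
    (hβ : Γ[p]? = some β)
    (hv : v = g (p + 1) ∨ QuantumEdge (g (p + 1)) β ∧ v = g (p + 1) * β.refl) :
    IsTrace Γ p (Function.update g p v) := by
  intro q hpq γ hγ
  rcases hpq.eq_or_lt with rfl | hpq
  · rw [hβ, Option.some.injEq] at hγ
    subst hγ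
    rwa [Function.update_self, Function.update_of_ne (by omega)]
  · rw [Function.update_of_ne (by omega), Function.update_of_ne (by omega)]
    exact hg q hpq γ hγ

lemma IsTrace.quantumPath (hg : IsTrace Γ A.length g) (hΓ : A ++ S <+: Γ) :
    QuantumPath S.reverse (g (A ++ S).length) (g A.length) := by
  induction S using List.reverseRecOn with
  | nil => simpa using QuantumPath.nil (g A.length)
  | append_singleton S β ih =>
    rw [← List.append_assoc] at hΓ ⊢
    have hpath := ih ((List.prefix_append _ _).trans hΓ)
    have hβ := hg (A ++ S).length (List.prefix_append A S).length_le β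
      (getElem?_length_of_isPrefix hΓ)
    rw [List.reverse_append, List.reverse_singleton, List.singleton_append, List.length_append]
    rcases hβ with hskip | ⟨hedge, hstep⟩
    · exact .skip (hskip ▸ hpath)
    · exact .step hedge (hstep ▸ hpath)

lemma IsTrace.exists_extend (hΓ : A ++ S <+: Γ) (hg : IsTrace Γ (A ++ S).length g)
    {u : SignedPerm n} (hu : QuantumPath S.reverse (g (A ++ S).length) u) :
    ∃ g', IsTrace Γ A.length g' ∧ g' A.length = u ∧ ∀ p, (A ++ S).length ≤ p → g' p = g p := by
  induction S using List.reverseRecOn generalizing g with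
  | nil =>
    rw [List.append_nil] at hg hu ⊢
    cases hu
    exact ⟨g, hg, rfl, fun _ _ => rfl⟩
  | append_singleton S β ih =>
    have hlen : (A ++ (S ++ [β])).length = (A ++ S).length + 1 := by
      rw [← List.append_assoc, List.length_append, List.length_singleton]
    rw [hlen] at hg hu ⊢
    rw [List.reverse_append, List.reverse_singleton, List.singleton_append] at hu
    rw [← List.append_assoc] at hΓ
    have extend_via {v} (hv : v = g ((A ++ S).length + 1) ∨
        QuantumEdge (g ((A ++ S).length + 1)) β ∧ v = g ((A ++ S).length + 1) * β.refl)
        (hpath : QuantumPath S.reverse v u) :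
        ∃ g', IsTrace Γ A.length g' ∧ g' A.length = u ∧
          ∀ p, (A ++ S).length + 1 ≤ p → g' p = g p := by
      obtain ⟨g', htrace, hstart, hagree⟩ := ih ((List.prefix_append _ _).trans hΓ)
        (hg.update (getElem?_length_of_isPrefix hΓ) hv)
        (by rwa [Function.update_self])
      refine ⟨g', htrace, hstart, fun p hp => ?_⟩
      rw [hagree p (by omega), Function.update_of_ne (by omega)]
    cases hu with
    | skip hpath => exact extend_via (Or.inl rfl) hpath
    | step hedge hpath => exact extend_via (Or.inr ⟨hedge, rfl⟩) hpath

lemma IsTrace.eq_of_separates {α : Type*} {φ : SignedPerm n → α} (hΓ : A ++ S <+: Γ)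
    (hsep : Separates φ S.reverse) (hg : IsTrace Γ A.length g) (hg' : IsTrace Γ A.length g')
    (hend : g (A ++ S).length = g' (A ++ S).length) (hstart : φ (g A.length) = φ (g' A.length)) :
    ∀ p, A.length ≤ p → p ≤ (A ++ S).length → g p = g' p := by
  induction S using List.reverseRecOn with
  | nil =>
    rw [List.append_nil] at hend ⊢
    exact fun p hAp hpA => le_antisymm hpA hAp ▸ hend
  | append_singleton S β ih =>
    rw [← List.append_assoc] at hΓ
    have hlen : (A ++ (S ++ [β])).length = (A ++ S).length + 1 := by
      rw [← List.append_assoc, List.length_append, List.length_singleton]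
    have hβ := getElem?_length_of_isPrefix hΓ
    have hΓ := (List.prefix_append _ _).trans hΓ
    have hpath := hg.quantumPath hΓ
    have hpath' := hg'.quantumPath hΓ
    have hAS : A.length ≤ (A ++ S).length := (List.prefix_append A S).length_le
    rw [List.reverse_append, List.reverse_singleton, List.singleton_append] at hsep
    rw [hlen] at hend ⊢
    obtain ⟨hpart, hsep⟩ := hsep
    have heq : g (A ++ S).length = g' (A ++ S).length := by
      rcases hg _ hAS β hβ with e | ⟨hedge, e⟩ <;> rcases hg' _ hAS β hβ with e' | ⟨hedge', e'⟩
      · rw [e, e', hend]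
      · rw [e'] at hpath'
        rw [e, hend] at hpath
        exact absurd hstart.symm (hpart hedge' hpath' hpath)
      · rw [e] at hpath
        rw [e', ← hend] at hpath'
        exact absurd hstart (hpart hedge hpath hpath')
      · rw [e, e', hend]
    intro p hAp hp
    rcases hp.eq_or_lt with rfl | hp
    · exact hend
    · exact ih hΓ hsep heq p hAp (Nat.le_of_lt_succ hp)

end Trace

/-! ### Rows of a signed permutation -/

/-- The entry of `w` in row `i` as a position in the alphabet: the letters `1 < … < 1̄` have
positions `0, …, 2 n - 1`, and the bar of the letter at position `x` is at position
`2 n - 1 - x`. -/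
def rank (w : SignedPerm n) (i : Fin n) : ℕ := (entry w i).val

lemma rank_lt (w : SignedPerm n) (i : Fin n) : rank w i < 2 * n := (entry w i).isLt

lemma sub_rank_lt (w : SignedPerm n) (i : Fin n) : 2 * n - 1 - rank w i < 2 * n := by
  have := rank_lt w i
  omega

lemma sub_sub_rank (w : SignedPerm n) (i : Fin n) :
    2 * n - 1 - (2 * n - 1 - rank w i) = rank w i :=
  Nat.sub_sub_self (Nat.le_sub_one_of_lt (rank_lt w i))

lemma rank_ne (w : SignedPerm n) {p q : Fin n} (h : p ≠ q) :
    rank w p ≠ rank w q ∧ rank w p + rank w q ≠ 2 * n - 1 := by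
  refine ⟨fun e => h (entry_injective w (Fin.ext e)), fun e => entry_ne_bar_entry w p q ?_⟩
  rw [Fin.ext_iff, val_bar]
  exact Nat.eq_sub_of_add_eq e

lemma exists_rank_eq (w : SignedPerm n) {x : ℕ} (hx : x < 2 * n) :
    ∃ i, rank w i = x ∨ rank w i = 2 * n - 1 - x := by
  obtain ⟨i, h | h⟩ := exists_entry_eq_or_bar w ⟨x, hx⟩
  · exact ⟨i, Or.inl (congrArg Fin.val h).symm⟩
  · have hval := congrArg Fin.val h
    rw [val_bar] at hval
    have := rank_lt w i
    simp only [rank] at *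
    exact ⟨i, Or.inr (by omega)⟩

/-- The root `ε_i - ε_m`. The intended range is `i < m`; elsewhere the value is the junk `2 ε_i`. -/
def subRoot (i m : Fin n) : PosRoot n := if h : i < m then .sub i m h else .long i

/-- The root `ε_i + ε_m`. The intended range is `i < m`; elsewhere the value is the junk `2 ε_i`. -/
def addRoot (i m : Fin n) : PosRoot n := if h : i < m then .add i m h else .long i

lemma rank_mul_subRoot (w : SignedPerm n) {i m : Fin n} (h : i < m) (p : Fin n) :
    rank (w * (subRoot i m).refl) p =
      if p = i then rank w m else if p = m then rank w i else rank w p := by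
  rw [subRoot, dif_pos h, rank, entry_mul_sub]
  split_ifs <;> rfl

lemma rank_mul_addRoot (w : SignedPerm n) {i m : Fin n} (h : i < m) (p : Fin n) :
    rank (w * (addRoot i m).refl) p =
      if p = i then 2 * n - 1 - rank w m else if p = m then 2 * n - 1 - rank w i
      else rank w p := by
  rw [addRoot, dif_pos h, rank, entry_mul_add]
  split_ifs
  exacts [val_bar _, val_bar _, rfl]

lemma rank_mul_long (w : SignedPerm n) (i p : Fin n) :
    rank (w * (PosRoot.long i).refl) p = if p = i then 2 * n - 1 - rank w i else rank w p := by
  rw [rank, entry_mul_long]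
  split_ifs
  exacts [val_bar _, rfl]

/-- Right multiplication by `s_β` does not change the entry in row `r`. -/
def FixesRow (β : PosRoot n) (r : Fin n) : Prop :=
  ∀ w : SignedPerm n, rank (w * β.refl) r = rank w r

lemma fixesRow_long {i r : Fin n} (h : r ≠ i) : FixesRow (.long i) r := fun w => by
  rw [rank_mul_long, if_neg h]

lemma fixesRow_subRoot {i m r : Fin n} (hi : r ≠ i) (hm : r ≠ m) : FixesRow (subRoot i m) r := by
  intro w
  by_cases h : i < m
  · rw [rank_mul_subRoot w h, if_neg hi, if_neg hm]
  · rw [subRoot, dif_neg h, fixesRow_long hi]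

lemma fixesRow_addRoot {i m r : Fin n} (hi : r ≠ i) (hm : r ≠ m) : FixesRow (addRoot i m) r := by
  intro w
  by_cases h : i < m
  · rw [rank_mul_addRoot w h, if_neg hi, if_neg hm]
  · rw [addRoot, dif_neg h, fixesRow_long hi]

lemma QuantumPath.rel_of_edges {R : SignedPerm n → SignedPerm n → Prop} (hrefl : ∀ v, R v v)
    (htrans : ∀ ⦃v v' v''⦄, R v v' → R v' v'' → R v v'') {L : List (PosRoot n)}
    (hedge : ∀ β ∈ L, ∀ v, QuantumEdge v β → R v (v * β.refl)) {u u' : SignedPerm n}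
    (h : QuantumPath L u u') : R u u' := by
  induction h with
  | nil v => exact hrefl v
  | skip _ ih => exact ih fun β hβ => hedge β (List.mem_cons_of_mem _ hβ)
  | step hs _ ih =>
    exact htrans (hedge _ List.mem_cons_self _ hs)
      (ih fun β hβ => hedge β (List.mem_cons_of_mem _ hβ))

lemma QuantumPath.rank_eq {L : List (PosRoot n)} {u u' : SignedPerm n} (h : QuantumPath L u u')
    {r : Fin n} (hL : ∀ β ∈ L, FixesRow β r) : rank u' r = rank u r :=
  h.rel_of_edges (R := fun v v' => rank v' r = rank v r) (fun _ => rfl)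
    (fun _ _ _ h h' => h'.trans h) fun β hβ v _ => hL β hβ v

/-! ### Arcs of the circular alphabet -/

/-- `z` does not lie on the closed arc from `c` to `a` of the circular alphabet. -/
def OffArc (z c a : ℕ) : Prop :=
  z ≠ c ∧ z ≠ a ∧ ¬ ((c < z ∧ z < a) ∨ (z < a ∧ a < c) ∨ (a < c ∧ c < z))

/-- `c ≤ a`, and these two positions are both unbarred or both barred. -/
def SameHalf (n c a : ℕ) : Prop := c ≤ a ∧ (c < n ↔ a < n)

lemma OffArc.refl {z c : ℕ} (h : z ≠ c) : OffArc z c c := by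
  simp only [OffArc]; omega

lemma OffArc.trans {z c b a : ℕ} (h : OffArc z c b) (h' : OffArc z b a) : OffArc z c a := by
  simp only [OffArc] at *; omega

lemma OffArc.asymm {c b a : ℕ} (h : OffArc c b a) : ¬ OffArc b c a := by
  simp only [OffArc] at *; omega

lemma OffArc.bar {z c a : ℕ} (hz : z < 2 * n) (hc : c < 2 * n) (ha : a < 2 * n)
    (h : OffArc z c a) : OffArc (2 * n - 1 - z) (2 * n - 1 - a) (2 * n - 1 - c) := by
  simp only [OffArc] at *; omega

lemma OffArc.of_not_offArc {z c b a : ℕ} (h : OffArc z c a) (hb : ¬ OffArc b c a) :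
    OffArc z c b ∧ OffArc z b a := by
  simp only [OffArc] at *; omega

lemma offArc_of_not_offArc {c b a : ℕ} (hb : ¬ OffArc b c a) (hbc : b ≠ c) : OffArc c b a := by
  simp only [OffArc] at *; omega

lemma SameHalf.refl (n c : ℕ) : SameHalf n c c := ⟨le_rfl, Iff.rfl⟩

lemma SameHalf.trans {c b a : ℕ} (h : SameHalf n c b) (h' : SameHalf n b a) : SameHalf n c a :=
  ⟨h.1.trans h'.1, h.2.trans h'.2⟩

lemma SameHalf.offArc {z c a : ℕ} (h : SameHalf n c a) (hz : ¬ (z < n ↔ c < n)) :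
    OffArc z c a := by
  simp only [OffArc, SameHalf] at *; omega

lemma SameHalf.of_not_offArc {c b a : ℕ} (h : SameHalf n c a) (hb : ¬ OffArc b c a) :
    SameHalf n c b ∧ SameHalf n b a := by
  simp only [SameHalf, OffArc] at *; omega

lemma not_circLT_entry_iff (u : SignedPerm n) {i l : Fin n} (hl : l ≠ i) (x : Letter n)
    (hx : rank u l ≠ x.val) :
    ¬ CircLT (entry u i) (entry u l) x ↔ OffArc (rank u l) (rank u i) x.val := by
  have := rank_ne u hl
  simp only [CircLT, Fin.lt_def, OffArc, rank] at *
  omega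

lemma quantumEdge_subRoot_iff {u : SignedPerm n} {i m : Fin n} (h : i < m) :
    QuantumEdge u (subRoot i m) ↔
      ∀ l, i < l → l < m → OffArc (rank u l) (rank u i) (rank u m) := by
  rw [subRoot, dif_pos h, quantumEdge_sub_iff h]
  exact forall₃_congr fun l hil hlm => not_circLT_entry_iff u hil.ne' _ (rank_ne u hlm.ne).1

lemma quantumEdge_long_iff_offArc {u : SignedPerm n} {i : Fin n} :
    QuantumEdge u (.long i) ↔
      ∀ l, i < l → OffArc (rank u l) (rank u i) (2 * n - 1 - rank u i) := by
  rw [quantumEdge_long_iff]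
  refine forall₂_congr fun l hil => ?_
  have hne := rank_ne u hil.ne'
  rw [not_circLT_entry_iff u hil.ne' _ (by rw [val_bar]; simp only [rank] at *; omega), val_bar,
    rank]
  rfl

lemma quantumEdge_addRoot_iff {u : SignedPerm n} {i j : Fin n} (h : i < j) :
    QuantumEdge u (addRoot i j) ↔
      SameHalf n (rank u i) (2 * n - 1 - rank u j) ∧
      (∀ m, i < m → m < j → OffArc (rank u m) (rank u i) (2 * n - 1 - rank u j)) ∧
      ∀ m, j < m → OffArc (rank u m) (rank u i) (2 * n - 1 - rank u j) ∧
        OffArc (rank u m) (rank u j) (2 * n - 1 - rank u i) := by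
  have hi := rank_lt u i
  have hj := rank_lt u j
  have hij := rank_ne u h.ne
  have arc_iff {p q m : Fin n} (hmp : m ≠ p) (hmq : m ≠ q) :
      ¬ CircLT (entry u p) (entry u m) (bar (entry u q)) ↔
        OffArc (rank u m) (rank u p) (2 * n - 1 - rank u q) := by
    have hne := rank_ne u hmq
    rw [not_circLT_entry_iff u hmp _ (by rw [val_bar]; simp only [rank] at *; omega), val_bar]
    rfl
  have half_iff : entry u i < bar (entry u j) ∧
      (bar (entry u i) < entry u i ↔ entry u j < bar (entry u j)) ↔
      SameHalf n (rank u i) (2 * n - 1 - rank u j) := by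
    simp only [Fin.lt_def, val_bar, SameHalf, rank] at *
    omega
  rw [addRoot, dif_pos h, quantumEdge_add_iff h, ← half_iff, and_assoc, ← forall₂_and]
  refine and_congr_right' (and_congr_right' (and_congr ?_ ?_))
  · exact forall₃_congr fun m him hmj => arc_iff him.ne' hmj.ne
  · exact forall₂_congr fun m hjm =>
      and_congr (arc_iff (h.trans hjm).ne' hjm.ne') (arc_iff hjm.ne' (h.trans hjm).ne')

/-! ### Arcs swept by a path along part of a row -/

/-- The position `c` rises to `a` within its half of the alphabet, without passing the entries of
the rows `> k` of `u`, nor their bars. -/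
def RisesClear (k : ℕ) (u : SignedPerm n) (c a : ℕ) : Prop :=
  SameHalf n c a ∧ ∀ l : Fin n, k ≤ l.val →
    OffArc (rank u l) c a ∧ OffArc (2 * n - 1 - rank u l) c a

lemma RisesClear.refl {k : ℕ} (u : SignedPerm n) {r : Fin n} (hr : r.val < k) :
    RisesClear k u (rank u r) (rank u r) := by
  refine ⟨SameHalf.refl _ _, fun l hl => ?_⟩
  have := rank_lt u l
  have hne := rank_ne u (p := l) (q := r) (by rintro rfl; omega)
  exact ⟨OffArc.refl hne.1, OffArc.refl (by omega)⟩

lemma RisesClear.trans {k : ℕ} {u : SignedPerm n} {c b a : ℕ} (h : RisesClear k u c b)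
    (h' : RisesClear k u b a) : RisesClear k u c a :=
  ⟨h.1.trans h'.1, fun l hl => ⟨(h.2 l hl).1.trans (h'.2 l hl).1, (h.2 l hl).2.trans (h'.2 l hl).2⟩⟩

lemma RisesClear.congr {k : ℕ} {u v : SignedPerm n} {c a : ℕ} (h : RisesClear k u c a)
    (huv : ∀ l : Fin n, k ≤ l.val → rank v l = rank u l) : RisesClear k v c a :=
  ⟨h.1, fun l hl => by rw [huv l hl]; exact h.2 l hl⟩

lemma RisesClear.mono {k k' : ℕ} {u : SignedPerm n} {c a : ℕ} (h : RisesClear k u c a)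
    (hk : k ≤ k') : RisesClear k' u c a :=
  ⟨h.1, fun l hl => h.2 l (hk.trans hl)⟩

lemma RisesClear.of_not_offArc {k : ℕ} {u : SignedPerm n} {c b a : ℕ} (h : RisesClear k u c a)
    (hb : ¬ OffArc b c a) : RisesClear k u b a :=
  ⟨(h.1.of_not_offArc hb).2,
    fun l hl => ⟨((h.2 l hl).1.of_not_offArc hb).2, ((h.2 l hl).2.of_not_offArc hb).2⟩⟩

lemma QuantumEdge.risesClear_addRoot {v : SignedPerm n} {p i : Fin n} (hpi : p < i)
    (h : QuantumEdge v (addRoot p i)) :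
    RisesClear (i.val + 1) v (rank v p) (2 * n - 1 - rank v i) ∧
      RisesClear (i.val + 1) v (rank v i) (2 * n - 1 - rank v p) := by
  obtain ⟨hhalf, -, hoff⟩ := (quantumEdge_addRoot_iff hpi).1 h
  have off_bar {l q q' : Fin n} (hl : OffArc (rank v l) (rank v q) (2 * n - 1 - rank v q')) :
      OffArc (2 * n - 1 - rank v l) (rank v q') (2 * n - 1 - rank v q) := by
    have := hl.bar (rank_lt v l) (rank_lt v q) (sub_rank_lt v q')
    rwa [sub_sub_rank] at this
  refine ⟨⟨hhalf, fun l hl => ⟨(hoff l hl).1, off_bar (hoff l hl).2⟩⟩,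
    ⟨?_, fun l hl => ⟨(hoff l hl).2, off_bar (hoff l hl).1⟩⟩⟩
  have hp := rank_lt v p
  have hi := rank_lt v i
  simp only [SameHalf] at *
  omega

section Sweeps

variable {i : Fin n} {L : List (Fin n)} {u u' : SignedPerm n}

lemma QuantumPath.offArc_of_edges {x : SignedPerm n → ℕ} (hne : ∀ v, x v ≠ rank v i)
    {Γ : List (PosRoot n)}
    (hedge : ∀ β ∈ Γ, ∀ v, QuantumEdge v β → x (v * β.refl) = x v ∧
      OffArc (x v) (rank v i) (rank (v * β.refl) i))
    (h : QuantumPath Γ u u') : OffArc (x u) (rank u i) (rank u' i) := by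
  refine (h.rel_of_edges
    (R := fun v v' => x v' = x v ∧ OffArc (x v) (rank v i) (rank v' i))
    (fun v => ⟨rfl, OffArc.refl (hne v)⟩) (fun v v' v'' h h' => ⟨h'.1.trans h.1, ?_⟩) hedge).2
  exact h.2.trans (h.1 ▸ h'.2)

lemma offArc_of_path_subRoot {l : Fin n} (hil : i < l) (hlL : ∀ m ∈ L, l < m)
    (h : QuantumPath (L.map (subRoot i)) u u') : OffArc (rank u l) (rank u i) (rank u' i) := by
  refine h.offArc_of_edges (x := (rank · l)) (fun v => (rank_ne v hil.ne').1) ?_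
  simp only [List.mem_map]
  rintro _ ⟨m, hm, rfl⟩ v hedge
  have him := hil.trans (hlL m hm)
  refine ⟨fixesRow_subRoot hil.ne' (hlL m hm).ne v, ?_⟩
  rw [rank_mul_subRoot v him, if_pos rfl]
  exact (quantumEdge_subRoot_iff him).1 hedge l hil (hlL m hm)

lemma offArc_of_path_long {l : Fin n} (hil : i < l) (h : QuantumPath [.long i] u u') :
    OffArc (rank u l) (rank u i) (rank u' i) := by
  refine h.offArc_of_edges (x := (rank · l)) (fun v => (rank_ne v hil.ne').1) ?_
  simp only [List.mem_singleton]
  rintro _ rfl v hedge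
  refine ⟨fixesRow_long hil.ne' v, ?_⟩
  rw [rank_mul_long, if_pos rfl]
  exact quantumEdge_long_iff_offArc.1 hedge l hil

lemma QuantumPath.risesClear {k : ℕ} {Γ : List (PosRoot n)}
    (hΓ : ∀ β ∈ Γ, ∃ p i : Fin n, p < i ∧ i.val < k ∧ addRoot p i = β) (h : QuantumPath Γ u u')
    {q : Fin n} (hq : q.val < k) : RisesClear k u (rank u q) (rank u' q) := by
  refine (h.rel_of_edges (R := fun v v' => (∀ l : Fin n, k ≤ l.val → rank v' l = rank v l) ∧
    RisesClear k v (rank v q) (rank v' q)) (fun v => ⟨fun _ _ => rfl, .refl v hq⟩)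
    (fun v v' v'' h h' =>
      ⟨fun l hl => (h'.1 l hl).trans (h.1 l hl), h.2.trans (h'.2.congr ?_)⟩) ?_).2
  · exact fun l hl => (h.1 l hl).symm
  intro β hβ v hedge
  obtain ⟨p, i, hpi, hik, rfl⟩ := hΓ β hβ
  have hil {l : Fin n} (hl : k ≤ l.val) : i < l := Fin.lt_def.2 (hik.trans_le hl)
  refine ⟨fun l hl => fixesRow_addRoot (hpi.trans (hil hl)).ne' (hil hl).ne' v, ?_⟩
  rw [rank_mul_addRoot v hpi]
  split_ifs with hqp hqi
  · exact hqp ▸ (hedge.risesClear_addRoot hpi).1.mono hik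
  · exact hqi ▸ (hedge.risesClear_addRoot hpi).2.mono hik
  · exact .refl v hq

lemma risesClear_of_path_below (hLi : ∀ p ∈ L, p < i)
    (h : QuantumPath (L.map fun p => addRoot p i) u u') {q : Fin n} (hq : q ≤ i) :
    RisesClear (i.val + 1) u (rank u q) (rank u' q) := by
  refine h.risesClear (fun β hβ => ?_) (Nat.lt_succ_of_le hq)
  obtain ⟨p, hp, rfl⟩ := List.mem_map.1 hβ
  exact ⟨p, i, hLi p hp, Nat.lt_succ_self _, rfl⟩

lemma offArc_bar_of_path_below (hLi : ∀ p ∈ L, p < i) {r : Fin n} (hri : r < i)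
    (hLr : ∀ p ∈ L, p < r) (h : QuantumPath (L.map fun p => addRoot p i) u u') :
    OffArc (2 * n - 1 - rank u r) (rank u i) (rank u' i) := by
  refine h.offArc_of_edges (x := (2 * n - 1 - rank · r)) (fun v => ?_) ?_
  · have hne := rank_ne v hri.ne
    have := rank_lt v r
    omega
  simp only [List.mem_map]
  rintro _ ⟨p, hp, rfl⟩ v hedge
  have hpi := hLi p hp
  rw [fixesRow_addRoot (hLr p hp).ne' hri.ne v, rank_mul_addRoot v hpi, if_neg hpi.ne', if_pos rfl]
  have hoff := ((quantumEdge_addRoot_iff hpi).1 hedge).2.1 r (hLr p hp) hri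
  have := hoff.bar (rank_lt v r) (rank_lt v p) (sub_rank_lt v i)
  rw [sub_sub_rank] at this
  exact ⟨rfl, this⟩

end Sweeps

/-! ### Greedy paths along a row -/

lemma exists_quantumPath_of_invariant {ι : Type*} {r : ι → ι → Prop} {f : ι → PosRoot n}
    {I : List ι → SignedPerm n → Prop} {L : List ι} (hL : L.Pairwise r)
    (hI : ∀ m ∈ L, ∀ L' ⊆ L, (∀ q ∈ L', r m q) → ∀ v, I (m :: L') v →
      I L' v ∨ QuantumEdge v (f m) ∧ I L' (v * (f m).refl))
    {u : SignedPerm n} (hu : I L u) : ∃ u', QuantumPath (L.map f) u u' ∧ I [] u' := by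
  induction L generalizing u with
  | nil => exact ⟨u, .nil u, hu⟩
  | cons m L ih =>
    obtain ⟨hm, hL⟩ := List.pairwise_cons.1 hL
    have ih {v} := @ih hL (fun q hq L' hL' => hI q (List.mem_cons_of_mem m hq) L'
      (List.subset_cons_of_subset m hL')) v
    rcases hI m List.mem_cons_self L (List.subset_cons_self m L) hm u hu with hu | ⟨hedge, hu⟩
    · obtain ⟨u', hpath, hu'⟩ := ih hu
      exact ⟨u', .skip hpath, hu'⟩
    · obtain ⟨u', hpath, hu'⟩ := ih hu
      exact ⟨u', .step hedge hpath, hu'⟩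

section Greedy

variable {i : Fin n} {L : List (Fin n)} {u : SignedPerm n} {a : ℕ}

lemma exists_path_subRoot (hL : L.Pairwise (· < ·)) (hiL : ∀ m ∈ L, i < m)
    (h : ∀ l, i < l → l ∉ L → OffArc (rank u l) (rank u i) a) :
    ∃ u', QuantumPath (L.map (subRoot i)) u u' ∧ ∀ l, i < l → OffArc (rank u' l) (rank u' i) a := by
  refine (exists_quantumPath_of_invariant (f := subRoot i)
    (I := fun L v => ∀ l, i < l → l ∉ L → OffArc (rank v l) (rank v i) a) hL ?_ h).imp
    fun u' ⟨hpath, hu'⟩ => ⟨hpath, fun l hl => hu' l hl List.not_mem_nil⟩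
  intro m hm L' _ hmL' v hv
  have him := hiL m hm
  by_cases hoff : OffArc (rank v m) (rank v i) a
  · refine Or.inl fun l hil hlL' => ?_
    by_cases hlm : l = m
    · exact hlm ▸ hoff
    · exact hv l hil (List.not_mem_cons_of_ne_of_not_mem hlm hlL')
  · refine Or.inr ⟨(quantumEdge_subRoot_iff him).2 fun l hil hlm => ?_, fun l hil hlL' => ?_⟩
    · refine ((hv l hil (List.not_mem_cons_of_ne_of_not_mem hlm.ne
        fun hl => ?_)).of_not_offArc hoff).1
      exact hlm.not_gt (hmL' l hl)
    · rw [rank_mul_subRoot v him, rank_mul_subRoot v him, if_neg hil.ne', if_pos rfl]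
      split_ifs with hlm
      · exact offArc_of_not_offArc hoff (rank_ne v him.ne').1
      · exact ((hv l hil (List.not_mem_cons_of_ne_of_not_mem hlm hlL')).of_not_offArc hoff).2

lemma exists_path_long (h : ∀ l, i < l → OffArc (rank u l) (rank u i) a) :
    ∃ u', QuantumPath [.long i] u u' ∧ (∀ l, i < l → OffArc (rank u' l) (rank u' i) a) ∧
      OffArc (2 * n - 1 - rank u' i) (rank u' i) a := by
  by_cases hoff : OffArc (2 * n - 1 - rank u i) (rank u i) a
  · exact ⟨u, .skip (.nil u), h, hoff⟩
  · have hne : 2 * n - 1 - rank u i ≠ rank u i := by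
      have := rank_lt u i
      omega
    refine ⟨u * (PosRoot.long i).refl,
      .step (quantumEdge_long_iff_offArc.2 fun l hl => ?_) (.nil _),
      fun l hl => ?_, ?_⟩
    · exact ((h l hl).of_not_offArc hoff).1
    · rw [rank_mul_long, rank_mul_long, if_neg hl.ne', if_pos rfl]
      exact ((h l hl).of_not_offArc hoff).2
    · rw [rank_mul_long, if_pos rfl, sub_sub_rank]
      exact offArc_of_not_offArc hoff hne

lemma quantumEdge_addRoot_of_not_offArc {m : Fin n} (him : i < m)
    (hhalf : SameHalf n (rank u i) a) (h : ∀ l, i < l → l ≠ m → OffArc (rank u l) (rank u i) a)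
    (hbar : ∀ l, m < l → OffArc (2 * n - 1 - rank u l) (rank u i) a)
    (hm : ¬ OffArc (2 * n - 1 - rank u m) (rank u i) a) : QuantumEdge u (addRoot i m) := by
  refine (quantumEdge_addRoot_iff him).2 ⟨(hhalf.of_not_offArc hm).1, fun l hil hlm => ?_,
    fun l hml => ⟨?_, ?_⟩⟩
  · exact ((h l hil hlm.ne).of_not_offArc hm).1
  · exact ((h l (him.trans hml) hml.ne').of_not_offArc hm).1
  · have := ((hbar l hml).of_not_offArc hm).1.bar (sub_rank_lt u l) (rank_lt u i) (sub_rank_lt u m)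
    rwa [sub_sub_rank, sub_sub_rank] at this

lemma exists_path_addRoot {k : ℕ} (hi : i.val < k) (hL : L.Pairwise (· > ·))
    (hkL : ∀ m ∈ L, k ≤ m.val) (hhalf : SameHalf n (rank u i) a)
    (h : ∀ l, i < l → OffArc (rank u l) (rank u i) a)
    (hbar : ∀ l : Fin n, k ≤ l.val → l ∉ L → OffArc (2 * n - 1 - rank u l) (rank u i) a) :
    ∃ u', QuantumPath (L.map (addRoot i)) u u' ∧ (∀ l, i < l → OffArc (rank u' l) (rank u' i) a) ∧
      RisesClear k u' (rank u' i) a := by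
  refine (exists_quantumPath_of_invariant (f := addRoot i)
    (I := fun L v => SameHalf n (rank v i) a ∧ (∀ l, i < l → OffArc (rank v l) (rank v i) a) ∧
      ∀ l : Fin n, k ≤ l.val → l ∉ L → OffArc (2 * n - 1 - rank v l) (rank v i) a)
    hL ?_ ⟨hhalf, h, hbar⟩).imp fun u' ⟨hpath, hhalf', h', hbar'⟩ => ⟨hpath, h', hhalf',
      fun l hl => ⟨h' l (Fin.lt_def.2 (hi.trans_le hl)), hbar' l hl List.not_mem_nil⟩⟩
  rintro m hm L' - hmL' v ⟨hhalf, h, hbar⟩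
  have hmk := hkL m hm
  have him : i < m := Fin.lt_def.2 (hi.trans_le hmk)
  by_cases hoff : OffArc (2 * n - 1 - rank v m) (rank v i) a
  · refine Or.inl ⟨hhalf, h, fun l hl hlL' => ?_⟩
    by_cases hlm : l = m
    · exact hlm ▸ hoff
    · exact hbar l hl (List.not_mem_cons_of_ne_of_not_mem hlm hlL')
  · have hbar_of_gt (l : Fin n) (hml : m < l) : OffArc (2 * n - 1 - rank v l) (rank v i) a :=
      hbar l (hmk.trans hml.le) (List.not_mem_cons_of_ne_of_not_mem hml.ne'
        fun hl => hml.not_gt (hmL' l hl))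
    obtain ⟨hlow, hhigh⟩ := hhalf.of_not_offArc hoff
    refine Or.inr ⟨quantumEdge_addRoot_of_not_offArc him hhalf (fun l hil _ => h l hil) hbar_of_gt
      hoff, ?_, fun l hil => ?_, fun l hl hlL' => ?_⟩
    · rwa [rank_mul_addRoot v him, if_pos rfl]
    · rw [rank_mul_addRoot v him, rank_mul_addRoot v him, if_neg hil.ne', if_pos rfl]
      split_ifs with hlm
      · have := rank_lt v i
        have := rank_lt v m
        exact hhigh.offArc (by simp only [SameHalf] at hlow; omega)
      · exact ((h l hil).of_not_offArc hoff).2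
    · have hil : l ≠ i := by rintro rfl; omega
      rw [rank_mul_addRoot v him, rank_mul_addRoot v him, if_neg hil, if_pos rfl]
      split_ifs with hlm
      · rw [sub_sub_rank]
        refine offArc_of_not_offArc hoff ?_
        have := rank_lt v m
        have := (rank_ne v him.ne').2
        omega
      · exact ((hbar l hl (List.not_mem_cons_of_ne_of_not_mem hlm hlL')).of_not_offArc hoff).2

end Greedy

/-! ### Realizing a target column row by row -/

/-- The first `k` values of `d` are positions of letters with distinct absolute values: the entries
which a path is to reach in the rows `1, …, k`. -/
structure IsTarget (n k : ℕ) (d : Fin n → ℕ) : Prop where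
  lt : ∀ r : Fin n, r.val < k → d r < 2 * n
  ne : ∀ r s : Fin n, r.val < k → s.val < k → r ≠ s → d r ≠ d s ∧ d r + d s ≠ 2 * n - 1

/-- While rising from its entry in `u` to its target `d p`, row `p` does not pass the targets of the
rows `p + 1, …, k`. -/
def RowCond (k : ℕ) (d : Fin n → ℕ) (u : SignedPerm n) (p : Fin n) : Prop :=
  ∀ l : Fin n, p < l → l.val < k → OffArc (d l) (rank u p) (d p)

lemma RowCond.of_not_offArc {k : ℕ} {d : Fin n → ℕ} {u v : SignedPerm n} {p : Fin n}
    (h : RowCond k d u p) (hv : ¬ OffArc (rank v p) (rank u p) (d p)) : RowCond k d v p :=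
  fun l hpl hl => ((h l hpl hl).of_not_offArc hv).2

lemma RowCond.congr {k : ℕ} {d : Fin n → ℕ} {u v : SignedPerm n} {p : Fin n}
    (h : RowCond k d u p) (hv : rank v p = rank u p) : RowCond k d v p := by
  rwa [RowCond, hv]

section Target

variable {k : ℕ} {d : Fin n → ℕ} {i : Fin n} {u v : SignedPerm n}

/-- The rows with target in `M` are at most as many as the rows with entry in `M`, because each
target occurs, up to a bar, as an entry. -/
lemma IsTarget.mem_of_target_mem (hd : IsTarget n k d) {M : ℕ → Prop}
    (hbar : ∀ x < 2 * n, M x → M (2 * n - 1 - x)) (hfree : ∀ f : Fin n, k ≤ f.val → ¬ M (rank u f))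
    (hrow : ∀ r : Fin n, r.val < k → M (rank u r) → M (d r)) {r : Fin n} (hr : r.val < k)
    (h : M (d r)) : M (rank u r) := by
  classical
  let A := Finset.univ.filter fun r : Fin n => r.val < k ∧ M (rank u r)
  let B := Finset.univ.filter fun r : Fin n => r.val < k ∧ M (d r)
  have hAB : A ⊆ B := Finset.monotone_filter_right _ fun r _ h => ⟨h.1, hrow r h.1 h.2⟩
  have hcard : B.card ≤ A.card := by
    refine Finset.card_le_card_of_forall_subsingleton
      (fun s t => rank u t = d s ∨ rank u t = 2 * n - 1 - d s) (fun s hs => ?_) ?_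
    · obtain ⟨hsk, hs⟩ := (Finset.mem_filter.1 hs).2
      obtain ⟨t, ht⟩ := exists_rank_eq u (hd.lt s hsk)
      have hM : M (rank u t) := by
        rcases ht with ht | ht <;> rw [ht]
        exacts [hs, hbar _ (hd.lt s hsk) hs]
      refine ⟨t, Finset.mem_filter.2 ⟨Finset.mem_univ t, ?_, hM⟩, ht⟩
      exact not_le.1 fun htk => hfree t htk hM
    · rintro t - s ⟨hs, hst⟩ s' ⟨hs', hst'⟩
      have hsk := (Finset.mem_filter.1 hs).2.1
      have hsk' := (Finset.mem_filter.1 hs').2.1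
      by_contra hss'
      have := hd.ne s s' hsk hsk' hss'
      have := hd.lt s hsk
      have := hd.lt s' hsk'
      omega
  have hrA : r ∈ A := by
    rw [Finset.eq_of_subset_of_card_le hAB hcard]
    exact Finset.mem_filter.2 ⟨Finset.mem_univ r, hr, h⟩
  exact (Finset.mem_filter.1 hrA).2.2

/-- `x` lies between the bar of `a` and `b`, or between the bar of `b` and `a`. -/
def BarInterval (n a b x : ℕ) : Prop :=
  (2 * n - 1 - a ≤ x ∧ x ≤ b) ∨ (2 * n - 1 - b ≤ x ∧ x ≤ a)

lemma IsTarget.barInterval_rank (hd : IsTarget n k d) (hi : i.val < k)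
    (hdone : ∀ l, i < l → l.val < k → rank v l = d l) (hrow : ∀ p < i, RowCond k d v p) {c : ℕ}
    (hclear : RisesClear k v c (d i)) {q : Fin n} (hq : q.val < k)
    (hoff : ∀ r, q < r → r < i → OffArc (2 * n - 1 - rank v r) c (d i))
    (hiq : 2 * n - 1 - d i ≤ d q) (hqc : d q < 2 * n - 1 - c) {r : Fin n} (hr : r.val < k)
    (h : BarInterval n (d i) (d q) (d r)) : BarInterval n (d i) (d q) (rank v r) := by
  have hdi := hd.lt i hi
  have hdq := hd.lt q hq
  refine hd.mem_of_target_mem (fun x hx hM => ?_) (fun f hf hM => ?_) (fun r hr hM => ?_) hr h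
  · simp only [BarInterval] at *
    omega
  · have := hclear.2 f hf
    have := hclear.1.1
    have := rank_lt v f
    simp only [BarInterval, OffArc] at *
    omega
  rcases lt_trichotomy r i with hri | rfl | hir
  · have hdir := hrow r hri i hri hi
    rcases lt_trichotomy q r with hqr | rfl | hrq
    · have := hoff r hqr hri
      have := rank_lt v r
      simp only [BarInterval, OffArc] at *
      omega
    · simp only [BarInterval]
      omega
    · have := hrow r hri q hrq hq
      simp only [BarInterval, OffArc] at *
      omega
  · simp only [BarInterval]
    omega
  · rwa [← hdone r hir hr]

lemma IsTarget.not_target_between (hd : IsTarget n k d) (hi : i.val < k)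
    (hdone : ∀ l, i < l → l.val < k → rank u l = d l) (hrow : ∀ p < i, RowCond k d u p)
    (hclear : RisesClear k u (rank u i) (d i)) {q : Fin n} (hq : q.val < k)
    (hoff : ∀ r, q < r → r < i → OffArc (2 * n - 1 - rank u r) (rank u i) (d i)) :
    ¬ (2 * n - 1 - d i ≤ d q ∧ d q < 2 * n - 1 - rank u i) := by
  rintro ⟨hiq, hqi⟩
  have hdi := hd.lt i hi
  have hmem : BarInterval n (d i) (d q) (d i) := Or.inr ⟨by omega, le_rfl⟩
  have := hd.barInterval_rank hi hdone hrow hclear hq hoff hiq hqi hi hmem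
  have := hclear.1
  simp only [BarInterval, SameHalf] at *
  omega

lemma IsTarget.risesClear_succ (hd : IsTarget n k d) (hi : i.val < k)
    (hdone : ∀ l, i < l → l.val < k → rank u l = d l) (hrow : ∀ p ≤ i, RowCond k d u p)
    (hclear : RisesClear k u (rank u i) (d i)) : RisesClear (i.val + 1) u (rank u i) (d i) := by
  refine ⟨hclear.1, fun l hil => ?_⟩
  rcases lt_or_ge l.val k with hlk | hkl
  · have hil : i < l := hil
    have hnot := hd.not_target_between hi hdone (fun p hp => hrow p hp.le) hclear hlk
      fun r hlr hri => absurd (hil.trans (hlr.trans hri)) (lt_irrefl i)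
    have hoff := hrow i le_rfl l hil hlk
    have := hclear.1.1
    have := rank_ne u hil.ne
    have := rank_lt u l
    rw [hdone l hil hlk] at *
    refine ⟨hoff, ?_⟩
    simp only [OffArc] at *
    omega
  · exact hclear.2 l hkl

lemma IsTarget.rank_eq_of_risesClear (hd : IsTarget n k d) (hi : i.val < k)
    (hrow : ∀ p < i, RowCond k d v p) (hclear : RisesClear (i.val + 1) v (rank v i) (d i))
    (hbar : ∀ r < i, OffArc (2 * n - 1 - rank v r) (rank v i) (d i)) : rank v i = d i := by
  have hdi := hd.lt i hi
  obtain ⟨t, ht⟩ := exists_rank_eq v hdi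
  rcases lt_trichotomy t i with hti | rfl | hit
  · have hdit := hrow t hti i hti hi
    have := hbar t hti
    simp only [OffArc] at *
    omega
  · have := hclear.1
    simp only [SameHalf] at this
    omega
  · have := hclear.2 t hit
    simp only [OffArc] at this
    omega

lemma IsTarget.quantumEdge_below (hd : IsTarget n k d) (hi : i.val < k)
    (hdone : ∀ l, i < l → l.val < k → rank v l = d l) (hrow : ∀ p < i, RowCond k d v p)
    (hclear : RisesClear (i.val + 1) v (rank v i) (d i)) {p : Fin n} (hpi : p < i)
    (hbar : ∀ r, p < r → r < i → OffArc (2 * n - 1 - rank v r) (rank v i) (d i))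
    (hp : ¬ OffArc (2 * n - 1 - rank v p) (rank v i) (d i)) :
    QuantumEdge v (addRoot p i) ∧ ¬ OffArc (2 * n - 1 - rank v i) (rank v p) (d p) := by
  have hhalf := (hclear.1.of_not_offArc hp).1
  have hvp := rank_lt v p
  have hvi := rank_lt v i
  have off_bar {l : Fin n} (h : OffArc (2 * n - 1 - rank v l) (rank v i) (d i)) :
      OffArc (rank v l) (rank v p) (2 * n - 1 - rank v i) := by
    have := (h.of_not_offArc hp).1.bar (sub_rank_lt v l) hvi (sub_rank_lt v p)
    rwa [sub_sub_rank, sub_sub_rank] at this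
  refine ⟨(quantumEdge_addRoot_iff hpi).2 ⟨?_, fun m hpm hmi => off_bar (hbar m hpm hmi),
    fun m him => ⟨off_bar (hclear.2 m him).2, ((hclear.2 m him).1.of_not_offArc hp).1⟩⟩, ?_⟩
  · simp only [SameHalf] at *
    omega
  · have hnot := hd.not_target_between hi hdone hrow (hclear.mono hi) (q := p)
      ((Fin.lt_def.1 hpi).trans hi) hbar
    have := hclear.1.1
    have := hhalf.1
    simp only [OffArc] at *
    omega

end Target

/-- The rows `i - 1, …, 1`. -/
def belowList (i : Fin n) : List (Fin n) := ((List.finRange n).filter (· < i)).reverse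

/-- The rows `k + 1, …, n`. -/
def freeList (n k : ℕ) : List (Fin n) := (List.finRange n).filter (k ≤ ·.val)

/-- The segment `Γ_i` of the chain of roots, read backwards. -/
def stageR (i : Fin n) : List (PosRoot n) := (belowList i).map fun p => addRoot p i

/-- The segment `Γ_{ki}` of the chain of roots, read backwards. -/
def stageL (k : ℕ) (i : Fin n) : List (PosRoot n) :=
  (freeList n k).map (subRoot i) ++
    ([.long i] ++ ((freeList n k).reverse.map (addRoot i) ++ stageR i))

lemma mem_belowList {i p : Fin n} : p ∈ belowList i ↔ p < i := by simp [belowList]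

lemma mem_freeList {k : ℕ} {m : Fin n} : m ∈ freeList n k ↔ k ≤ m.val := by simp [freeList]

lemma pairwise_belowList (i : Fin n) : (belowList i).Pairwise (· > ·) :=
  List.pairwise_reverse.2 ((List.sortedLT_finRange n).pairwise.filter _)

lemma pairwise_freeList (n k : ℕ) : (freeList n k).Pairwise (· < ·) :=
  (List.sortedLT_finRange n).pairwise.filter _

lemma fixesRow_of_mem_stageR {i r : Fin n} (hir : i < r) :
    ∀ β ∈ stageR i, FixesRow β r := by
  simp only [stageR, List.mem_map, mem_belowList]
  rintro _ ⟨p, hpi, rfl⟩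
  exact fixesRow_addRoot (hpi.trans hir).ne' hir.ne'

lemma fixesRow_of_mem_map_subRoot {k : ℕ} {i r : Fin n} (hri : r ≠ i) (hrk : r.val < k) :
    ∀ β ∈ (freeList n k).map (subRoot i), FixesRow β r := by
  simp only [List.mem_map, mem_freeList]
  rintro _ ⟨m, hm, rfl⟩
  exact fixesRow_subRoot hri (by rintro rfl; omega)

lemma fixesRow_of_mem_map_addRoot {k : ℕ} {i r : Fin n} (hri : r ≠ i) (hrk : r.val < k) :
    ∀ β ∈ (freeList n k).reverse.map (addRoot i), FixesRow β r := by
  simp only [List.mem_map, List.mem_reverse, mem_freeList]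
  rintro _ ⟨m, hm, rfl⟩
  exact fixesRow_addRoot hri (by rintro rfl; omega)

lemma fixesRow_of_mem_stageL {k : ℕ} {i r : Fin n} (hir : i < r) (hrk : r.val < k) :
    ∀ β ∈ stageL k i, FixesRow β r := by
  simp only [stageL, List.mem_append, List.mem_singleton]
  rintro β (hβ | rfl | hβ | hβ)
  exacts [fixesRow_of_mem_map_subRoot hir.ne' hrk β hβ, fixesRow_long hir.ne',
    fixesRow_of_mem_map_addRoot hir.ne' hrk β hβ, fixesRow_of_mem_stageR hir β hβ]

lemma offArc_bar_rank_mul_addRoot {v : SignedPerm n} {p r i : Fin n} {a : ℕ} (hpi : p < i)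
    (hri : r < i) (hp : ¬ OffArc (2 * n - 1 - rank v p) (rank v i) a)
    (hr : r ≠ p → OffArc (2 * n - 1 - rank v r) (rank v i) a) :
    OffArc (2 * n - 1 - rank (v * (addRoot p i).refl) r) (rank (v * (addRoot p i).refl) i) a := by
  rw [rank_mul_addRoot v hpi, rank_mul_addRoot v hpi, if_neg hri.ne, if_neg hpi.ne', if_pos rfl]
  split_ifs with hrp
  · rw [sub_sub_rank]
    have := rank_lt v p
    have := (rank_ne v hpi.ne).2
    exact offArc_of_not_offArc hp (by omega)
  · exact ((hr hrp).of_not_offArc hp).2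

lemma exists_stageR {k : ℕ} {d : Fin n → ℕ} {i : Fin n} {u : SignedPerm n} (hd : IsTarget n k d)
    (hi : i.val < k) (hdone : ∀ l, i < l → l.val < k → rank u l = d l)
    (hrow : ∀ p ≤ i, RowCond k d u p) (hclear : RisesClear k u (rank u i) (d i)) :
    ∃ u', QuantumPath (stageR i) u u' ∧ rank u' i = d i ∧
      ∀ p < i, ¬ OffArc (rank u' p) (rank u p) (d p) := by
  have row_of_not_offArc {v : SignedPerm n} (hv : ∀ p < i, ¬ OffArc (rank v p) (rank u p) (d p)) :
      ∀ p < i, RowCond k d v p := fun p hp => (hrow p hp.le).of_not_offArc (hv p hp)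
  refine (exists_quantumPath_of_invariant (I := fun L v =>
    (∀ p < i, ¬ OffArc (rank v p) (rank u p) (d p)) ∧ (∀ l, i < l → rank v l = rank u l) ∧
    RisesClear (i.val + 1) v (rank v i) (d i) ∧
    ∀ r < i, r ∉ L → OffArc (2 * n - 1 - rank v r) (rank v i) (d i)) (pairwise_belowList i) ?_
    ⟨fun _ _ h => h.1 rfl, fun _ _ => rfl, hd.risesClear_succ hi hdone hrow hclear,
      fun r hri hr => absurd (mem_belowList.2 hri) hr⟩).imp fun u' ⟨hpath, hv, _, hclear, hbar⟩ =>
    ⟨hpath, hd.rank_eq_of_risesClear hi (row_of_not_offArc hv) hclear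
      fun r hri => hbar r hri List.not_mem_nil, hv⟩
  rintro p hp L' - hpL' v ⟨hv, hfix, hclear, hbar⟩
  have hpi := mem_belowList.1 hp
  have hbar_of_ne {r : Fin n} (hri : r < i) (hrp : r ≠ p) (hr : r ∉ L') :=
    hbar r hri (List.not_mem_cons_of_ne_of_not_mem hrp hr)
  by_cases hoff : OffArc (2 * n - 1 - rank v p) (rank v i) (d i)
  · refine Or.inl ⟨hv, hfix, hclear, fun r hri hr => ?_⟩
    by_cases hrp : r = p
    · exact hrp ▸ hoff
    · exact hbar_of_ne hri hrp hr
  obtain ⟨hedge, hbar_i⟩ := hd.quantumEdge_below hi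
    (fun l hil hl => (hfix l hil).trans (hdone l hil hl)) (row_of_not_offArc hv) hclear hpi
    (fun r hpr hri => hbar_of_ne hri hpr.ne' fun hr => hpr.not_gt (hpL' r hr)) hoff
  have hfix' (l : Fin n) (hil : i < l) : rank (v * (addRoot p i).refl) l = rank v l :=
    fixesRow_addRoot (hpi.trans hil).ne' hil.ne' v
  refine Or.inr ⟨hedge, fun q hqi => ?_, fun l hil => (hfix' l hil).trans (hfix l hil), ?_,
    fun r hri hr => ?_⟩
  · rw [rank_mul_addRoot v hpi, if_neg hqi.ne]
    split_ifs with hqp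
    · subst hqp
      exact fun h => hbar_i (h.of_not_offArc (hv q hqi)).2
    · exact hv q hqi
  · rw [rank_mul_addRoot v hpi, if_neg hpi.ne', if_pos rfl]
    exact (hclear.of_not_offArc hoff).congr hfix'
  · exact offArc_bar_rank_mul_addRoot hpi hri hoff fun hrp => hbar_of_ne hri hrp hr

section Stage

variable {k : ℕ} {d : Fin n → ℕ} {i : Fin n} {L : List (Fin n)} {u u' v : SignedPerm n}

lemma IsTarget.sameHalf (hd : IsTarget n k d) (hi : i.val < k)
    (hdone : ∀ l, i < l → l.val < k → rank u l = d l) (hrow : ∀ p < i, RowCond k d u p)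
    (hfree : ∀ m : Fin n, k ≤ m.val → OffArc (rank u m) (rank u i) (d i))
    (hbar : OffArc (2 * n - 1 - rank u i) (rank u i) (d i)) : SameHalf n (rank u i) (d i) := by
  have hdi := hd.lt i hi
  have hui := rank_lt u i
  by_contra hhalf
  have hmem := hd.mem_of_target_mem (u := u) (M := fun x => ¬ OffArc x (2 * n - 1 - d i) (d i))
    (fun x hx hM => ?_) (fun f hf hM => ?_) (fun r hr hM => ?_) hi fun h => h.2.1 rfl
  · simp only [OffArc, SameHalf] at *
    omega
  · simp only [OffArc] at *
    omega
  · have := hfree f hf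
    simp only [OffArc, SameHalf] at *
    omega
  rcases lt_trichotomy r i with hri | rfl | hir
  · have := hrow r hri i hri hi
    simp only [OffArc, SameHalf] at *
    omega
  · exact fun h => h.2.1 rfl
  · rwa [← hdone r hir hr]

lemma exists_stageL (hd : IsTarget n k d) (hi : i.val < k)
    (hdone : ∀ l, i < l → l.val < k → rank u l = d l) (hrow : ∀ p ≤ i, RowCond k d u p) :
    ∃ u', QuantumPath (stageL k i) u u' ∧ rank u' i = d i ∧
      ∀ p < i, ¬ OffArc (rank u' p) (rank u p) (d p) := by
  have lt_of_free {m : Fin n} (hm : k ≤ m.val) : i < m := Fin.lt_def.2 (hi.trans_le hm)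
  obtain ⟨u₁, hpath₁, hoff₁⟩ := exists_path_subRoot (a := d i) (pairwise_freeList n k)
    (fun m hm => lt_of_free (mem_freeList.1 hm)) fun l hil hl => by
      have hlk := not_le.1 (mt mem_freeList.2 hl)
      exact hdone l hil hlk ▸ hrow i le_rfl l hil hlk
  obtain ⟨u₂, hpath₂, hoff₂, hbar₂⟩ := exists_path_long hoff₁
  have hfix₂ {r : Fin n} (hri : r ≠ i) (hrk : r.val < k) : rank u₂ r = rank u r :=
    (hpath₂.rank_eq (by simpa using fixesRow_long hri)).trans
      (hpath₁.rank_eq (fixesRow_of_mem_map_subRoot hri hrk))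
  have hhalf := hd.sameHalf hi (fun l hil hl => (hfix₂ hil.ne' hl).trans (hdone l hil hl))
    (fun p hpi => (hrow p hpi.le).congr (hfix₂ hpi.ne ((Fin.lt_def.1 hpi).trans hi)))
    (fun m hm => hoff₂ m (lt_of_free hm)) hbar₂
  obtain ⟨u₃, hpath₃, hoff₃, hclear⟩ := exists_path_addRoot hi
    (List.pairwise_reverse.2 (pairwise_freeList n k))
    (fun m hm => mem_freeList.1 (List.mem_reverse.1 hm)) hhalf hoff₂
    fun l hl hlL => absurd (List.mem_reverse.2 (mem_freeList.2 hl)) hlL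
  have hfix₃ {r : Fin n} (hri : r ≠ i) (hrk : r.val < k) : rank u₃ r = rank u r :=
    (hpath₃.rank_eq (fixesRow_of_mem_map_addRoot hri hrk)).trans (hfix₂ hri hrk)
  have hdone₃ (l : Fin n) (hil : i < l) (hl : l.val < k) : rank u₃ l = d l :=
    (hfix₃ hil.ne' hl).trans (hdone l hil hl)
  have hrow₃ (p : Fin n) (hpi : p ≤ i) : RowCond k d u₃ p := by
    rcases hpi.lt_or_eq with hpi | rfl
    · exact (hrow p hpi.le).congr (hfix₃ hpi.ne ((Fin.lt_def.1 hpi).trans hi))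
    · exact fun l hil hl => hdone₃ l hil hl ▸ hoff₃ l hil
  obtain ⟨u', hpath, hu'i, hu'⟩ := exists_stageR hd hi hdone₃ hrow₃ hclear
  refine ⟨u', quantumPath_append.2 ⟨u₁, hpath₁, quantumPath_append.2 ⟨u₂, hpath₂,
    quantumPath_append.2 ⟨u₃, hpath₃, hpath⟩⟩⟩, hu'i, fun p hpi => ?_⟩
  rw [← hfix₃ hpi.ne ((Fin.lt_def.1 hpi).trans hi)]
  exact hu' p hpi

lemma IsTarget.not_target_between_of_quantumEdge (hd : IsTarget n k d) (hi : i.val < k)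
    {p l : Fin n} (hpl : p < l) (hli : l < i) (hedge : QuantumEdge u (addRoot p i))
    (hdone : ∀ l, i < l → l.val < k → rank u l = d l)
    (hrow : ∀ q < i, RowCond k d (u * (addRoot p i).refl) q)
    (hclear : RisesClear (i.val + 1) u (rank u i) (d i)) (hle : 2 * n - 1 - rank u p ≤ d i)
    (hbar : ∀ r, p < r → r < i → OffArc (2 * n - 1 - rank u r) (rank u i) (d i)) :
    ¬ (rank u p ≤ d l ∧ d l < 2 * n - 1 - rank u i) := by
  rintro ⟨hple, hlt⟩
  have hpi := hpl.trans hli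
  have hl : l.val < k := (Fin.lt_def.1 hli).trans hi
  have hfix {r : Fin n} (hrp : r ≠ p) (hri : r ≠ i) : rank (u * (addRoot p i).refl) r = rank u r :=
    fixesRow_addRoot hrp hri u
  have hlow : 2 * n - 1 - d i ≤ d l := by omega
  have hmem := hd.barInterval_rank hi
    (fun l hil hl => (hfix (hpi.trans hil).ne' hil.ne').trans (hdone l hil hl)) hrow
    ((hclear.mono hi).congr fun m hm => hfix ?_ ?_) hl
    (fun r hlr hri => ?_) hlow hlt hl (Or.inl ⟨hlow, le_rfl⟩)
  · have := ((quantumEdge_addRoot_iff hpi).1 hedge).2.1 l hpl hli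
    have := hbar l hpl hli
    have := hrow l hli i hli hi
    have := hclear.1
    have := hd.lt i hi
    have := rank_lt u l
    rw [hfix hpl.ne' hli.ne] at *
    simp only [BarInterval, OffArc, SameHalf] at *
    omega
  · rintro rfl
    have := Fin.lt_def.1 hpi
    omega
  · rintro rfl
    omega
  · rw [hfix (hpl.trans hlr).ne' hri.ne]
    exact hbar r (hpl.trans hlr) hri

lemma IsTarget.rowCond_of_quantumEdge_below (hd : IsTarget n k d) (hi : i.val < k) {p : Fin n}
    (hpi : p < i) (hedge : QuantumEdge u (addRoot p i))
    (hdone : ∀ l, i < l → l.val < k → rank u l = d l)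
    (hrow : ∀ q < i, RowCond k d (u * (addRoot p i).refl) q)
    (hclear : RisesClear (i.val + 1) u (rank u i) (d i)) (hle : 2 * n - 1 - rank u p ≤ d i)
    (hbar : ∀ r, p < r → r < i → OffArc (2 * n - 1 - rank u r) (rank u i) (d i)) :
    RowCond k d u p := by
  intro l hpl hl
  have hoff := hrow p hpi l hpl hl
  rw [rank_mul_addRoot u hpi, if_pos rfl] at hoff
  refine OffArc.trans (by_contra fun hnot => ?_) hoff
  obtain ⟨hhalf, -, htop⟩ := (quantumEdge_addRoot_iff hpi).1 hedge
  have hbetween : rank u p ≤ d l ∧ d l < 2 * n - 1 - rank u i := by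
    have := hhalf.1
    have := rank_lt u i
    simp only [OffArc] at *
    omega
  rcases lt_trichotomy l i with hli | rfl | hil
  · exact hd.not_target_between_of_quantumEdge hi hpl hli hedge hdone hrow hclear hle hbar hbetween
  · have := hclear.1
    simp only [SameHalf] at *
    omega
  · exact hnot (hdone l hil hl ▸ (htop l hil).1)

lemma IsTarget.rowCond_of_path_below (hd : IsTarget n k d) (hi : i.val < k)
    (hL : L.Pairwise (· > ·)) (hLi : ∀ p ∈ L, p < i)
    (h : QuantumPath (L.map fun p => addRoot p i) u u') (hui : rank u' i = d i)
    (hdone : ∀ l, i < l → l.val < k → rank u l = d l) (hrow : ∀ p < i, RowCond k d u' p) :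
    ∀ p < i, RowCond k d u p := by
  induction L generalizing u with
  | nil =>
    cases h
    exact hrow
  | cons p L ih =>
    obtain ⟨hpL, hL⟩ := List.pairwise_cons.1 hL
    obtain ⟨hpi, hLi'⟩ := List.forall_mem_cons.1 hLi
    have hpath := h
    rcases h with _ | h | ⟨hedge, h⟩
    · exact ih hL hLi' h hdone
    have hfix {r : Fin n} (hrp : r ≠ p) (hri : r ≠ i) :
        rank (u * (addRoot p i).refl) r = rank u r := fixesRow_addRoot hrp hri u
    have hrow_v := ih hL hLi' h fun l hil hl =>
      (hfix (hpi.trans hil).ne' hil.ne').trans (hdone l hil hl)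
    intro q hqi
    by_cases hqp : q = p
    · subst hqp
      refine hd.rowCond_of_quantumEdge_below hi hqi hedge hdone hrow_v
        (hui ▸ risesClear_of_path_below hLi hpath le_rfl) ?_
        fun r hqr hri => hui ▸ offArc_bar_of_path_below hLi hri ?_ hpath
      · have := (risesClear_of_path_below hLi' h le_rfl).1.1
        rwa [rank_mul_addRoot u hpi, if_neg hpi.ne', if_pos rfl, hui] at this
      · exact List.forall_mem_cons.2 ⟨hqr, fun m hm => (hpL m hm).trans hqr⟩
    · exact (hrow_v q hqi).congr (hfix hqp hqi.ne).symm

/-! ### Paths along a row are determined by its final entry -/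

lemma sameHalf_and_offArc_of_path_add (hL : ∀ m ∈ L, i < m)
    (h : QuantumPath (L.map (addRoot i) ++ stageR i) u u') :
    SameHalf n (rank u i) (rank u' i) ∧
      ∀ l, i < l → OffArc (rank u l) (rank u i) (rank u' i) := by
  suffices h : SameHalf n (rank u i) (rank u' i) ∧ ∀ l, i < l →
      (rank u' l = rank u l ∧ OffArc (rank u l) (rank u i) (rank u' i)) ∨
        ¬ (rank u l < n ↔ rank u i < n) from
    ⟨h.1, fun l hil => (h.2 l hil).elim And.right h.1.offArc⟩
  refine h.rel_of_edges (R := fun v v' => SameHalf n (rank v i) (rank v' i) ∧ ∀ l, i < l →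
      (rank v' l = rank v l ∧ OffArc (rank v l) (rank v i) (rank v' i)) ∨
        ¬ (rank v l < n ↔ rank v i < n))
    (fun v => ⟨.refl _ _, fun l hil => Or.inl ⟨rfl, .refl (rank_ne v hil.ne').1⟩⟩)
    (fun v v' v'' h h' => ⟨h.1.trans h'.1, fun l hil => ?_⟩) ?_
  · have := h.1.2
    rcases h.2 l hil with ⟨hl, hoff⟩ | hl
    · rcases h'.2 l hil with ⟨hl', hoff'⟩ | hl'
      · exact Or.inl ⟨hl'.trans hl, hoff.trans (hl ▸ hoff')⟩
      · rw [hl] at hl'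
        exact Or.inr (by tauto)
    · exact Or.inr hl
  simp only [List.mem_append, stageR, List.mem_map, mem_belowList]
  rintro _ (⟨m, hm, rfl⟩ | ⟨p, hpi, rfl⟩) v hedge
  · have him := hL m hm
    obtain ⟨hhalf, hmid, htop⟩ := (quantumEdge_addRoot_iff him).1 hedge
    rw [rank_mul_addRoot v him, if_pos rfl]
    refine ⟨hhalf, fun l hil => ?_⟩
    rcases lt_trichotomy l m with hlm | rfl | hml
    · exact Or.inl ⟨fixesRow_addRoot hil.ne' hlm.ne v, hmid l hil hlm⟩
    · have := rank_lt v l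
      simp only [SameHalf] at hhalf
      omega
    · exact Or.inl ⟨fixesRow_addRoot hil.ne' hml.ne' v, (htop l hml).1⟩
  · obtain ⟨hhalf, hoff⟩ := (hedge.risesClear_addRoot hpi).2
    rw [rank_mul_addRoot v hpi, if_neg hpi.ne', if_pos rfl]
    exact ⟨hhalf, fun l hil =>
      Or.inl ⟨fixesRow_addRoot (hpi.trans hil).ne' hil.ne' v, (hoff l hil).1⟩⟩

lemma offArc_bar_of_path_add (hL : ∀ m ∈ L, i < m) {l : Fin n} (hil : i < l)
    (hLl : ∀ m ∈ L, m < l) (h : QuantumPath (L.map (addRoot i) ++ stageR i) u u') :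
    OffArc (2 * n - 1 - rank u l) (rank u i) (rank u' i) := by
  refine h.offArc_of_edges (x := (2 * n - 1 - rank · l)) (fun v => ?_) ?_
  · have := rank_ne v hil.ne
    have := rank_lt v l
    omega
  simp only [List.mem_append, stageR, List.mem_map, mem_belowList]
  rintro _ (⟨m, hm, rfl⟩ | ⟨p, hpi, rfl⟩) v hedge
  · have him := hL m hm
    have hoff := (((quantumEdge_addRoot_iff him).1 hedge).2.2 l (hLl m hm)).2.bar
      (rank_lt v l) (rank_lt v m) (sub_rank_lt v i)
    rw [fixesRow_addRoot hil.ne' (hLl m hm).ne' v, rank_mul_addRoot v him, if_pos rfl]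
    exact ⟨rfl, sub_sub_rank v i ▸ hoff⟩
  · rw [fixesRow_addRoot (hpi.trans hil).ne' hil.ne' v, rank_mul_addRoot v hpi, if_neg hpi.ne',
      if_pos rfl]
    exact ⟨rfl, ((hedge.risesClear_addRoot hpi).2.2 l hil).2⟩

lemma offArc_of_path_sub (hi : i.val < k) {l : Fin n} (hil : i < l) (hlL : ∀ m ∈ L, l < m)
    (h : QuantumPath (L.map (subRoot i) ++
      ([.long i] ++ ((freeList n k).reverse.map (addRoot i) ++ stageR i))) u u') :
    OffArc (rank u l) (rank u i) (rank u' i) := by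
  obtain ⟨u₁, hsub, h⟩ := quantumPath_append.1 h
  obtain ⟨u₂, hlong, hadd⟩ := quantumPath_append.1 h
  have hfix₁ : rank u₁ l = rank u l := hsub.rank_eq <| by
    simp only [List.mem_map]
    rintro _ ⟨m, hm, rfl⟩
    exact fixesRow_subRoot hil.ne' (hlL m hm).ne
  have hfix₂ : rank u₂ l = rank u₁ l := hlong.rank_eq (by simpa using fixesRow_long hil.ne')
  have hoff₁ := offArc_of_path_subRoot hil hlL hsub
  have hoff₂ := offArc_of_path_long hil hlong
  have hoff₃ := (sameHalf_and_offArc_of_path_add (fun m hm => Fin.lt_def.2 (hi.trans_le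
    (mem_freeList.1 (List.mem_reverse.1 hm)))) hadd).2 l hil
  rw [hfix₂, hfix₁] at hoff₃
  exact hoff₁.trans ((hfix₁ ▸ hoff₂).trans hoff₃)

lemma separates_stageR (i : Fin n) : Separates (rank · i) (stageR i) := by
  rw [← List.append_nil (stageR i)]
  refine Separates.map_append (φ := (rank · i)) (B := []) trivial (pairwise_belowList i) ?_
  intro p hp L' hL' hpL' v u u' _ hu hu' heq
  rw [List.append_nil] at hu hu'
  have hpi := mem_belowList.1 hp
  have hL'i (q : Fin n) (hq : q ∈ L') : q < i := mem_belowList.1 (hL' hq)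
  have hoff := offArc_bar_of_path_below hL'i hpi hpL' hu
  have hoff' := offArc_bar_of_path_below hL'i hpi hpL' hu'
  rw [rank_mul_addRoot v hpi, rank_mul_addRoot v hpi, if_pos rfl, if_neg hpi.ne', if_pos rfl,
    sub_sub_rank] at hoff
  exact hoff.asymm (heq ▸ hoff')

lemma separates_stageL (hi : i.val < k) : Separates (rank · i) (stageL k i) := by
  have lt_of_free {m : Fin n} (hm : m ∈ freeList n k) : i < m :=
    Fin.lt_def.2 (hi.trans_le (mem_freeList.1 hm))
  have hadd : Separates (rank · i) ((freeList n k).reverse.map (addRoot i) ++ stageR i) := by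
    refine (separates_stageR i).map_append (List.pairwise_reverse.2 (pairwise_freeList n k)) ?_
    intro m hm L' hL' hmL' v u u' _ hu hu' heq
    have him := lt_of_free (List.mem_reverse.1 hm)
    have hiL' (q : Fin n) (hq : q ∈ L') : i < q := lt_of_free (List.mem_reverse.1 (hL' hq))
    have hoff := offArc_bar_of_path_add hiL' him hmL' hu
    have hoff' := offArc_bar_of_path_add hiL' him hmL' hu'
    rw [rank_mul_addRoot v him, rank_mul_addRoot v him, if_neg him.ne', if_pos rfl, if_pos rfl,
      sub_sub_rank] at hoff
    exact hoff.asymm (heq ▸ hoff')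
  have hlong : Separates (rank · i)
      ([.long i] ++ ((freeList n k).reverse.map (addRoot i) ++ stageR i)) := by
    refine ⟨fun v u u' _ hu hu' heq => ?_, hadd⟩
    have hhalf {w w' : SignedPerm n} (h : QuantumPath _ w w') := (sameHalf_and_offArc_of_path_add
      (fun m hm => lt_of_free (List.mem_reverse.1 hm)) h).1
    have hu := hhalf hu
    have hu' := hhalf hu'
    rw [rank_mul_long, if_pos rfl] at hu
    have := rank_lt v i
    simp only [SameHalf] at *
    omega
  refine hlong.map_append (pairwise_freeList n k) ?_
  intro m hm L' _ hmL' v u u' _ hu hu' heq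
  have him := lt_of_free hm
  have hoff := offArc_of_path_sub hi him hmL' hu
  have hoff' := offArc_of_path_sub hi him hmL' hu'
  rw [rank_mul_subRoot v him, rank_mul_subRoot v him, if_neg him.ne', if_pos rfl,
    if_pos rfl] at hoff
  exact hoff.asymm (heq ▸ hoff')

lemma rowCond_of_stageR (hd : IsTarget n k d) (hi : i.val < k) (h : QuantumPath (stageR i) u u')
    (hdone : ∀ l, i ≤ l → l.val < k → rank u' l = d l) (hrow : ∀ p < i, RowCond k d u' p) :
    ∀ p ≤ i, RowCond k d u p := by
  have hLi (p : Fin n) : p ∈ belowList i → p < i := mem_belowList.1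
  have hdone_u (l : Fin n) (hil : i < l) (hl : l.val < k) : rank u l = d l :=
    (h.rank_eq (fixesRow_of_mem_stageR hil)).symm.trans (hdone l hil.le hl)
  intro p hpi
  rcases hpi.lt_or_eq with hpi | rfl
  · exact hd.rowCond_of_path_below hi (pairwise_belowList i) hLi h (hdone i le_rfl hi) hdone_u hrow
      p hpi
  · intro l hpl hl
    rw [← hdone_u l hpl hl, ← hdone p le_rfl hi]
    exact ((risesClear_of_path_below hLi h le_rfl).2 l hpl).1

lemma rowCond_of_stageL (hd : IsTarget n k d) (hi : i.val < k) (h : QuantumPath (stageL k i) u u')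
    (hdone : ∀ l, i ≤ l → l.val < k → rank u' l = d l) (hrow : ∀ p < i, RowCond k d u' p) :
    ∀ p ≤ i, RowCond k d u p := by
  have hdone_u (l : Fin n) (hil : i < l) (hl : l.val < k) : rank u l = d l :=
    (h.rank_eq (fixesRow_of_mem_stageL hil hl)).symm.trans (hdone l hil.le hl)
  intro p hpi
  rcases hpi.lt_or_eq with hpi | rfl
  · obtain ⟨u₁, hsub, htail⟩ := quantumPath_append.1 h
    obtain ⟨u₂, hlong, htail⟩ := quantumPath_append.1 htail
    obtain ⟨u₃, hadd, hbelow⟩ := quantumPath_append.1 htail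
    have hpk := (Fin.lt_def.1 hpi).trans hi
    refine (rowCond_of_stageR hd hi hbelow hdone hrow p hpi.le).congr ?_
    rw [hadd.rank_eq (fixesRow_of_mem_map_addRoot hpi.ne hpk),
      hlong.rank_eq (by simpa using fixesRow_long hpi.ne),
      hsub.rank_eq (fixesRow_of_mem_map_subRoot hpi.ne hpk)]
  · intro l hpl hl
    rw [← hdone_u l hpl hl, ← hdone p le_rfl hi]
    exact offArc_of_path_sub hi hpl
      (fun m hm => Fin.lt_def.2 (hl.trans_le (mem_freeList.1 hm))) h

end Stage

/-! ### Rows combined into columns -/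

/-- The concatenation of the segments `st i` for the rows `i = j, j - 1, …, 1`. -/
def rowsRev (st : Fin n → List (PosRoot n)) (j : ℕ) : List (PosRoot n) :=
  (firstRows n j).reverse.flatMap st

lemma rowsRev_zero (st : Fin n → List (PosRoot n)) : rowsRev st 0 = [] := by
  simp [rowsRev, firstRows]

lemma rowsRev_succ (st : Fin n → List (PosRoot n)) (i : Fin n) :
    rowsRev st (i.val + 1) = st i ++ rowsRev st i.val := by
  have hrows : firstRows n (i.val + 1) = firstRows n i.val ++ [i] := by
    simpa [firstRows] using filter_val_lt_succ (P := fun _ => True) i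
  rw [rowsRev, hrows, List.reverse_append, List.reverse_singleton, List.singleton_append,
    List.flatMap_cons, rowsRev]

lemma filterMap_eq_map_filter {α γ : Type*} {f : α → Option γ} {P : α → Prop} [DecidablePred P]
    {g : α → γ} (l : List α) (h : ∀ a, f a = if P a then some (g a) else none) :
    l.filterMap f = (l.filter P).map g := by
  induction l with
  | nil => rfl
  | cons a l ih => by_cases ha : P a <;> simp [h a, ha, ih]

lemma rootsBelow_reverse (i : Fin n) : (rootsBelow i).reverse = stageR i := by
  rw [rootsBelow, filterMap_eq_map_filter (P := (· < i)) (g := fun p => addRoot p i) _ fun p => ?_,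
    ← List.map_reverse]
  · rfl
  · by_cases h : p < i <;> simp [h, addRoot]

section Columns

variable {k : ℕ} {i : Fin n}

lemma rootsAdd_eq_map_freeList (hi : i.val < k) :
    rootsAdd k i = (freeList n k).map (addRoot i) := by
  refine filterMap_eq_map_filter (P := fun m : Fin n => k ≤ m.val) _ fun m => ?_
  by_cases hm : k ≤ m.val
  · simp [hm, Fin.lt_def.2 (hi.trans_le hm), addRoot]
  · simp [hm]

lemma rootsSub_eq_map_freeList (hi : i.val < k) :
    rootsSub k i = (freeList n k).reverse.map (subRoot i) := by
  rw [freeList, ← List.filter_reverse]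
  refine filterMap_eq_map_filter (P := fun m : Fin n => k ≤ m.val) _ fun m => ?_
  by_cases hm : k ≤ m.val
  · simp [hm, Fin.lt_def.2 (hi.trans_le hm), subRoot]
  · simp [hm]

lemma gammaR_reverse (n k : ℕ) : (gammaR n k).reverse = rowsRev stageR k := by
  simp only [gammaR, List.reverse_flatMap, rowsRev, Function.comp_def, rootsBelow_reverse]

lemma gammaL_reverse (n k : ℕ) : (gammaL n k).reverse = rowsRev (stageL k) k := by
  rw [gammaL, List.reverse_flatMap, rowsRev, List.flatMap_def, List.flatMap_def]
  congr 1
  refine List.map_congr_left fun i hi => ?_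
  have hik : i.val < k := by simpa [firstRows] using hi
  simp only [Function.comp_apply, List.reverse_append, List.reverse_singleton, rootsBelow_reverse,
    rootsAdd_eq_map_freeList hik, rootsSub_eq_map_freeList hik, stageL, ← List.map_reverse,
    List.reverse_reverse]

section Rows

variable {d : Fin n → ℕ} {st : Fin n → List (PosRoot n)} {u u' : SignedPerm n} {j : ℕ}

lemma exists_rowsRev {P : Fin n → SignedPerm n → Prop}
    (hfix : ∀ ⦃i r : Fin n⦄, i < r → r.val < k → ∀ β ∈ st i, FixesRow β r)
    (hst : ∀ (i : Fin n) (u : SignedPerm n), i.val < k →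
      (∀ l, i < l → l.val < k → rank u l = d l) → (∀ p ≤ i, P p u) →
      ∃ u', QuantumPath (st i) u u' ∧ rank u' i = d i ∧ ∀ p < i, P p u')
    (hjk : j ≤ k) (hjn : j ≤ n) (hdone : ∀ l : Fin n, j ≤ l.val → l.val < k → rank u l = d l)
    (hP : ∀ p : Fin n, p.val < j → P p u) :
    ∃ u', QuantumPath (rowsRev st j) u u' ∧ ∀ l : Fin n, l.val < k → rank u' l = d l := by
  induction j generalizing u with
  | zero => exact ⟨u, rowsRev_zero st ▸ .nil u, fun l => hdone l l.val.zero_le⟩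
  | succ j ih =>
    obtain ⟨v, hpath, hv, hPv⟩ := hst ⟨j, hjn⟩ u hjk hdone fun p hp => hP p (Nat.lt_succ_of_le hp)
    refine (ih (by omega) (by omega) (fun l hl hlk => ?_) hPv).imp fun u' ⟨hpath', hu'⟩ =>
      ⟨rowsRev_succ st ⟨j, hjn⟩ ▸ quantumPath_append.2 ⟨v, hpath, hpath'⟩, hu'⟩
    rcases hl.eq_or_lt with rfl | hl
    · exact hv
    · rw [hpath.rank_eq (hfix (i := ⟨j, hjn⟩) hl hlk), hdone l hl hlk]

lemma QuantumPath.rank_eq_of_rowsRev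
    (hfix : ∀ ⦃i r : Fin n⦄, i < r → r.val < k → ∀ β ∈ st i, FixesRow β r)
    (h : QuantumPath (rowsRev st j) u u') {r : Fin n} (hjr : j ≤ r.val) (hrk : r.val < k) :
    rank u' r = rank u r := by
  refine h.rank_eq fun β hβ => ?_
  simp only [rowsRev, firstRows, List.mem_flatMap, List.mem_reverse, List.mem_filter,
    decide_eq_true_eq] at hβ
  obtain ⟨i, ⟨-, hij⟩, hβ⟩ := hβ
  exact hfix (Fin.lt_def.2 (hij.trans_le hjr)) hrk β hβ

lemma rowCond_of_rowsRev
    (hfix : ∀ ⦃i r : Fin n⦄, i < r → r.val < k → ∀ β ∈ st i, FixesRow β r)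
    (hst : ∀ ⦃i : Fin n⦄ ⦃u u' : SignedPerm n⦄, i.val < k → QuantumPath (st i) u u' →
      (∀ l, i ≤ l → l.val < k → rank u' l = d l) → (∀ p < i, RowCond k d u' p) →
      ∀ p ≤ i, RowCond k d u p)
    (hjk : j ≤ k) (hjn : j ≤ n) (h : QuantumPath (rowsRev st j) u u')
    (hd : ∀ l : Fin n, l.val < k → rank u' l = d l) :
    ∀ p : Fin n, p.val < j → RowCond k d u p := by
  induction j generalizing u with
  | zero => exact fun p hp => absurd hp p.val.not_lt_zero
  | succ j ih =>
    rw [rowsRev_succ st ⟨j, hjn⟩] at h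
    obtain ⟨v, hstage, hrows⟩ := quantumPath_append.1 h
    exact fun p hp => hst (i := ⟨j, hjn⟩) hjk hstage
      (fun l hl hlk => (hrows.rank_eq_of_rowsRev hfix hl hlk).symm.trans (hd l hlk))
      (ih (by omega) (by omega) hrows) p (Nat.le_of_lt_succ hp)

lemma rank_castLE (u : SignedPerm n) (hk : k ≤ n) (r : Fin k) :
    rank u (Fin.castLE hk r) = (window u hk r).val := rfl

lemma separates_rowsRev (hk : k ≤ n)
    (hfix : ∀ ⦃i r : Fin n⦄, i < r → r.val < k → ∀ β ∈ st i, FixesRow β r)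
    (hst : ∀ i : Fin n, i.val < k → Separates (rank · i) (st i)) (hjk : j ≤ k) :
    Separates (fun u => window u hk) (rowsRev st j) := by
  induction j with
  | zero => rw [rowsRev_zero]; trivial
  | succ j ih =>
    rw [rowsRev_succ st ⟨j, hjk.trans hk⟩]
    refine (hst ⟨j, hjk.trans hk⟩ hjk).append (ih (by omega)) fun w w' u u' h h' heq => ?_
    rw [← h.rank_eq_of_rowsRev hfix le_rfl hjk, ← h'.rank_eq_of_rowsRev hfix le_rfl hjk]
    exact congrArg Fin.val (congrFun heq ⟨j, hjk⟩)

end Rows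

/-! ### Targets given by columns -/

/-- The ranks prescribed by a column `C`, as a function on all rows; the value `0` in the rows
below `C` is irrelevant. -/
def target (C : Fin k → Letter n) (r : Fin n) : ℕ :=
  if h : r.val < k then (C ⟨r.val, h⟩).val else 0

lemma target_of_lt (C : Fin k → Letter n) {r : Fin n} (h : r.val < k) :
    target C r = (C ⟨r.val, h⟩).val := dif_pos h

lemma target_castLE (C : Fin k → Letter n) (hk : k ≤ n) (r : Fin k) :
    target C (Fin.castLE hk r) = (C r).val := target_of_lt C r.isLt

lemma absLetter_eq_iff (x y : Letter n) :
    absLetter x = absLetter y ↔ x.val = y.val ∨ x.val + y.val = 2 * n - 1 := by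
  have hx := x.isLt
  have hy := y.isLt
  rw [Fin.ext_iff, absLetter, absLetter, Fin.coe_min, Fin.coe_min, val_bar, val_bar]
  omega

lemma DistinctAbs.val_ne {C : Fin k → Letter n} (hC : DistinctAbs C) {r s : Fin k} (h : r ≠ s) :
    (C r).val ≠ (C s).val ∧ (C r).val + (C s).val ≠ 2 * n - 1 :=
  not_or.1 <| (absLetter_eq_iff _ _).not.1 (hC.ne h)

lemma DistinctAbs.offArc_iff {C : Fin k → Letter n} (hC : DistinctAbs C) {i l : Fin k}
    (h : i ≠ l) {x : Letter n} :
    OffArc (C l).val x.val (C i).val ↔ x ≠ C l ∧ ¬ CircLT x (C l) (C i) := by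
  have := hC.val_ne h
  simp only [CircLT, Fin.lt_def, OffArc, ne_eq, Fin.ext_iff]
  omega

lemma AdjacentCond.offArc {C C' : Fin k → Letter n} (h : AdjacentCond le_rfl C' C)
    (hC' : DistinctAbs C') {i l : Fin k} (hil : i < l) :
    OffArc (C' l).val (C i).val (C' i).val :=
  (hC'.offArc_iff hil.ne).2 (h i l hil)

lemma DistinctAbs.isTarget {C : Fin k → Letter n} (hC : DistinctAbs C) :
    IsTarget n k (target C) where
  lt r hr := target_of_lt C hr ▸ (C _).isLt
  ne r s hr hs hrs := by
    rw [target_of_lt C hr, target_of_lt C hs]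
    exact hC.val_ne (by simpa [Fin.ext_iff] using hrs)

section Window

variable (hk : k ≤ n) {u v : SignedPerm n} {C : Fin k → Letter n}

lemma distinctAbs_window (u : SignedPerm n) : DistinctAbs (window u hk) := by
  intro r s h
  by_contra hne
  have := rank_ne u ((Fin.castLE_injective hk).ne hne)
  rw [absLetter_eq_iff, ← rank_castLE, ← rank_castLE] at h
  tauto

lemma window_eq_iff : window u hk = C ↔ ∀ r : Fin n, r.val < k → rank u r = target C r := by
  constructor
  · rintro rfl r hr
    rw [target_of_lt _ hr]
    rfl
  · exact fun h => funext fun r => Fin.ext <|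
      (h (Fin.castLE hk r) r.isLt).trans (target_castLE C hk r)

lemma adjacentCond_iff_rowCond (hC : DistinctAbs C) : AdjacentCond le_rfl C (window v hk) ↔
    ∀ p : Fin n, p.val < k → RowCond k (target C) v p := by
  constructor
  · intro h p hp l hpl hl
    rw [target_of_lt C hl, target_of_lt C hp]
    exact h.offArc hC (i := ⟨p, hp⟩) (l := ⟨l, hl⟩) hpl
  · intro h i l hil
    have hoff := h (Fin.castLE hk i) i.isLt (Fin.castLE hk l) hil l.isLt
    rw [target_castLE, target_castLE] at hoff
    exact (hC.offArc_iff hil.ne).1 hoff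

lemma exists_path_gammaL (hC : DistinctAbs C) (h : AdjacentCond le_rfl C (window v hk)) :
    ∃ u, QuantumPath (gammaL n k).reverse v u ∧ window u hk = C := by
  rw [adjacentCond_iff_rowCond hk hC] at h
  rw [gammaL_reverse]
  refine (exists_rowsRev (P := fun p u => RowCond k (target C) u p)
    (fun i r => fixesRow_of_mem_stageL) (fun i u hi hdone hrow => ?_) le_rfl hk
    (fun l hl hlk => absurd hl hlk.not_ge) h).imp fun u ⟨hpath, hu⟩ =>
    ⟨hpath, (window_eq_iff hk).2 hu⟩
  obtain ⟨u', hpath, hi', hoff⟩ := exists_stageL hC.isTarget hi hdone hrow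
  exact ⟨u', hpath, hi', fun p hp => (hrow p hp.le).of_not_offArc (hoff p hp)⟩

/-- Unlike `Γ_l(k)`, the chain `Γ_r(k)` can change neither the half of the alphabet in which an
entry lies nor the entries in the rows below `k`; hence the extra condition. -/
lemma exists_path_gammaR (hC : DistinctAbs C) (h : AdjacentCond le_rfl C (window v hk))
    (hclear : ∀ r, RisesClear k v (window v hk r).val (C r).val) :
    ∃ u, QuantumPath (gammaR n k).reverse v u ∧ window u hk = C := by
  rw [adjacentCond_iff_rowCond hk hC] at h
  rw [gammaR_reverse]
  refine (exists_rowsRev (P := fun p u => RowCond k (target C) u p ∧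
      RisesClear k u (rank u p) (target C p)) (fun i r hir _ => fixesRow_of_mem_stageR hir)
    (fun i u hi hdone hP => ?_) le_rfl hk (fun l hl hlk => absurd hl hlk.not_ge)
    fun p hp => ⟨h p hp, target_of_lt C hp ▸ hclear ⟨p, hp⟩⟩).imp fun u ⟨hpath, hu⟩ =>
    ⟨hpath, (window_eq_iff hk).2 hu⟩
  obtain ⟨u', hpath, hi', hoff⟩ :=
    exists_stageR hC.isTarget hi hdone (fun p hp => (hP p hp).1) (hP i le_rfl).2
  exact ⟨u', hpath, hi', fun p hp => ⟨(hP p hp.le).1.of_not_offArc (hoff p hp),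
    ((hP p hp.le).2.of_not_offArc (hoff p hp)).congr fun l hl =>
      hpath.rank_eq (fixesRow_of_mem_stageR (Fin.lt_def.2 (hi.trans_le hl)))⟩⟩

lemma risesClear_of_path_gammaR (h : QuantumPath (gammaR n k).reverse v u) (r : Fin k) :
    RisesClear k v (window v hk r).val (window u hk r).val := by
  refine h.risesClear (fun β hβ => ?_) (q := Fin.castLE hk r) r.isLt
  simp only [gammaR_reverse, rowsRev, firstRows, stageR, List.mem_flatMap, List.mem_reverse,
    List.mem_filter, List.mem_map, mem_belowList, decide_eq_true_eq] at hβ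
  obtain ⟨i, ⟨-, hik⟩, p, hpi, rfl⟩ := hβ
  exact ⟨p, i, hpi, hik, rfl⟩

lemma adjacentCond_of_path_gammaL (h : QuantumPath (gammaL n k).reverse v u) :
    AdjacentCond le_rfl (window u hk) (window v hk) := by
  have hC := distinctAbs_window hk u
  rw [adjacentCond_iff_rowCond hk hC]
  rw [gammaL_reverse] at h
  exact rowCond_of_rowsRev (fun i r => fixesRow_of_mem_stageL)
    (fun i u u' => rowCond_of_stageL hC.isTarget) le_rfl hk h ((window_eq_iff hk).1 rfl)

lemma adjacentCond_of_path_gammaR (h : QuantumPath (gammaR n k).reverse v u) :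
    AdjacentCond le_rfl (window u hk) (window v hk) := by
  have hC := distinctAbs_window hk u
  rw [adjacentCond_iff_rowCond hk hC]
  rw [gammaR_reverse] at h
  exact rowCond_of_rowsRev (fun i r hir _ => fixesRow_of_mem_stageR hir)
    (fun i u u' => rowCond_of_stageR hC.isTarget) le_rfl hk h ((window_eq_iff hk).1 rfl)

lemma separates_gammaL : Separates (fun u => window u hk) (gammaL n k).reverse := by
  rw [gammaL_reverse]
  exact separates_rowsRev hk (fun i r => fixesRow_of_mem_stageL) (fun i => separates_stageL) le_rfl

lemma separates_gammaR : Separates (fun u => window u hk) (gammaR n k).reverse := by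
  rw [gammaR_reverse]
  exact separates_rowsRev hk (fun i r hir _ => fixesRow_of_mem_stageR hir)
    (fun i _ => separates_stageR i) le_rfl

end Window

end Columns

/-! ### Counting the entries of a column -/

section Counting

variable {k a b c : ℕ} {C D L R : Fin k → Letter n}

/-- The number of entries of the column `C` at the positions `a, …, b - 1` of the alphabet. -/
noncomputable def countIco (C : Fin k → Letter n) (a b : ℕ) : ℕ :=
  {r | (C r).val ∈ Set.Ico a b}.ncard

lemma countIco_add_countIco (C : Fin k → Letter n) (hab : a ≤ b) (hbc : b ≤ c) :
    countIco C a b + countIco C b c = countIco C a c := by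
  rw [countIco, countIco, countIco, ← Set.ncard_union_eq]
  · simp only [← Set.Ico_union_Ico_eq_Ico hab hbc]
    rfl
  · exact Set.disjoint_left.2 fun r h h' => h.2.not_ge h'.1

lemma countIco_le (h : ∀ r, (C r).val ∈ Set.Ico a b → (D r).val ∈ Set.Ico a b) :
    countIco C a b ≤ countIco D a b :=
  Set.ncard_le_ncard h

lemma countIco_congr (h : ∀ r, (C r).val ∈ Set.Ico a b ↔ (D r).val ∈ Set.Ico a b) :
    countIco C a b = countIco D a b :=
  (countIco_le fun r => (h r).1).antisymm (countIco_le fun r => (h r).2)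

lemma mem_Ico_of_countIco_le (h : ∀ r, (C r).val ∈ Set.Ico a b → (D r).val ∈ Set.Ico a b)
    (hle : countIco D a b ≤ countIco C a b) {r : Fin k} (hr : (D r).val ∈ Set.Ico a b) :
    (C r).val ∈ Set.Ico a b :=
  (Set.eq_of_subset_of_ncard_le (s := {r | (C r).val ∈ Set.Ico a b}) h hle).ge hr

/-- The letters `x` such that `x` or `x̄` occurs in the column `C`. -/
def absSupport (C : Fin k → Letter n) : Set (Letter n) :=
  {x | x ∈ Set.range C ∨ bar x ∈ Set.range C}

lemma bar_mem_absSupport {x : Letter n} : bar x ∈ absSupport C ↔ x ∈ absSupport C := by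
  simp only [absSupport, Set.mem_ofPred_eq, bar_bar, or_comm]

lemma mem_absSupport_iff {x : Letter n} :
    x ∈ absSupport C ↔ ∃ r, (C r).val = x.val ∨ (C r).val = 2 * n - 1 - x.val := by
  simp only [absSupport, Set.mem_ofPred_eq, Set.mem_range, Fin.ext_iff, val_bar, exists_or]

/-- The interval is invariant under the bar, so the count depends on the absolute values only. -/
lemma countIco_symm_le (hR : DistinctAbs R) (h : absSupport R ⊆ absSupport L) (hb : b ≤ 2 * n) :
    countIco R (2 * n - b) b ≤ countIco L (2 * n - b) b := by
  have hmatch : ∀ r, ∃ s, (L s).val = (R r).val ∨ (L s).val = 2 * n - 1 - (R r).val :=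
    fun r => mem_absSupport_iff.1 (h (Or.inl ⟨r, rfl⟩))
  choose f hf using hmatch
  refine Set.ncard_le_ncard_of_injOn f (fun r hr => ?_) fun r _ s _ hrs => ?_
  · have := hf r
    simp only [Set.mem_ofPred_eq, Set.mem_Ico] at hr ⊢
    omega
  · by_contra hne
    have hrL := hf r
    have hsL := hf s
    have := hR.val_ne hne
    have := (R r).isLt
    have := (R s).isLt
    rw [hrs] at hrL
    omega

end Counting

section SplitRel

variable {k : ℕ} {L R : Fin k → Letter n}

/-- The relation between the columns `L = lD` and `R = rD` obtained by splitting a KN column `D`,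
expressed without `D` and invariant under reordering the entries of `L` and of `R`. -/
structure SplitRel (L R : Fin k → Letter n) : Prop where
  absSupport_eq : absSupport R = absSupport L
  countIco_le : ∀ s, countIco L s n ≤ countIco R s n
  countIco_zero : countIco L 0 n = countIco R 0 n
  countIco_eq : ∀ x ∉ absSupport L, countIco L x.val n = countIco R x.val n

namespace SplitRel

lemma countIco_barred_le (h : SplitRel L R) (hR : DistinctAbs R) {b : ℕ} (hnb : n ≤ b)
    (hb : b ≤ 2 * n) : countIco R n b ≤ countIco L n b := by
  have hsymm := countIco_symm_le hR h.absSupport_eq.le hb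
  rw [← countIco_add_countIco R (by omega) hnb, ← countIco_add_countIco L (by omega) hnb] at hsymm
  have := h.countIco_le (2 * n - b)
  omega

lemma countIco_zero_le (h : SplitRel L R) (hR : DistinctAbs R) {b : ℕ} (hb : b ≤ 2 * n) :
    countIco R 0 b ≤ countIco L 0 b := by
  have hzero := h.countIco_zero
  rcases le_total b n with hbn | hnb
  · rw [← countIco_add_countIco R b.zero_le hbn, ← countIco_add_countIco L b.zero_le hbn] at hzero
    have := h.countIco_le b
    omega
  · rw [← countIco_add_countIco R n.zero_le hnb, ← countIco_add_countIco L n.zero_le hnb]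
    have := h.countIco_barred_le hR hnb hb
    omega

/-- In the application `z` is the last entry of `R`. -/
lemma sameHalf_of_pivot (h : SplitRel L R) (hR : DistinctAbs R) {z : ℕ} (hz : z < 2 * n)
    (hpivot : ∀ r, (R r).val = z ∨ OffArc z (L r).val (R r).val) (r : Fin k) :
    SameHalf n (L r).val (R r).val := by
  have hle_iff : (L r).val ≤ z ↔ (R r).val ≤ z := by
    have hforward (r : Fin k) (hr : (L r).val ≤ z) : (R r).val ≤ z := by
      have := hpivot r
      simp only [OffArc] at this
      omega
    refine ⟨hforward r, fun hr => ?_⟩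
    have := mem_Ico_of_countIco_le (a := 0) (b := z + 1)
      (fun r hr => ⟨Nat.zero_le _, Nat.lt_succ_of_le (hforward r (Nat.le_of_lt_succ hr.2))⟩)
      (h.countIco_zero_le hR hz) (r := r) ⟨Nat.zero_le _, Nat.lt_succ_of_le hr⟩
    exact Nat.le_of_lt_succ this.2
  have hpivot_r := hpivot r
  rcases lt_or_ge z n with hzn | hnz
  · have := mem_Ico_of_countIco_le (C := R) (D := L) (a := z + 1) (b := n) (fun r hr => by
      have := hpivot r
      simp only [OffArc, Set.mem_Ico] at this hr ⊢
      omega) (h.countIco_le (z + 1)) (r := r)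
    simp only [SameHalf, OffArc, Set.mem_Ico] at *
    omega
  · have := mem_Ico_of_countIco_le (C := L) (D := R) (a := n) (b := z + 1) (fun r hr => by
      have := hpivot r
      simp only [OffArc, Set.mem_Ico] at this hr ⊢
      omega) (h.countIco_barred_le hR (by omega) hz) (r := r)
    simp only [SameHalf, OffArc, Set.mem_Ico] at *
    omega

lemma sameHalf (h : SplitRel L R) (hR : DistinctAbs R) (hadj : AdjacentCond le_rfl R L)
    (r : Fin k) : SameHalf n (L r).val (R r).val := by
  obtain ⟨k, rfl⟩ := Nat.exists_eq_succ_of_ne_zero r.pos.ne'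
  refine h.sameHalf_of_pivot hR (R (Fin.last k)).isLt (fun i => ?_) r
  rcases (Fin.le_last i).eq_or_lt with rfl | hi
  · exact Or.inl rfl
  · exact Or.inr (hadj.offArc hR hi)

lemma offArc (h : SplitRel L R) (hL : DistinctAbs L)
    (hhalf : ∀ r, SameHalf n (L r).val (R r).val) {x : Letter n} (hx : x ∉ absSupport L)
    (r : Fin k) : OffArc x.val (L r).val (R r).val := by
  have hrL := not_exists.1 (mem_absSupport_iff.not.1 hx) r
  have hrR := not_exists.1 (mem_absSupport_iff.not.1 (h.absSupport_eq ▸ hx)) r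
  have hhalf_r := hhalf r
  have := x.isLt
  rcases lt_or_ge x.val n with hxn | hnx
  · have := mem_Ico_of_countIco_le (C := L) (D := R) (a := x.val) (b := n) (fun r hr => by
      have := hhalf r
      simp only [SameHalf, Set.mem_Ico] at this hr ⊢
      omega) (h.countIco_eq x hx).ge (r := r)
    simp only [SameHalf, OffArc, Set.mem_Ico] at *
    omega
  · have hcount : countIco L n (x.val + 1) ≤ countIco R n (x.val + 1) := by
      have hbar : 2 * n - (x.val + 1) = (bar x).val := by rw [val_bar]; omega
      have hsymm := countIco_symm_le (b := x.val + 1) hL h.absSupport_eq.ge (by omega)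
      rw [← countIco_add_countIco R (b := n) (by omega) (by omega),
        ← countIco_add_countIco L (b := n) (by omega) (by omega), hbar,
        h.countIco_eq _ (bar_mem_absSupport.not.2 hx)] at hsymm
      omega
    have := mem_Ico_of_countIco_le (C := R) (D := L) (a := n) (b := x.val + 1) (fun r hr => by
      have := hhalf r
      simp only [SameHalf, Set.mem_Ico] at this hr ⊢
      omega) hcount (r := r)
    simp only [SameHalf, OffArc, Set.mem_Ico] at *
    omega

end SplitRel

section Window

variable (hk : k ≤ n) {u v : SignedPerm n}

lemma mem_absSupport_window_iff {x : Letter n} : x ∈ absSupport (window u hk) ↔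
    ∀ f : Fin n, k ≤ f.val → rank u f ≠ x.val ∧ rank u f ≠ 2 * n - 1 - x.val := by
  have := x.isLt
  rw [mem_absSupport_iff]
  constructor
  · rintro ⟨r, hr⟩ f hf
    have := rank_ne u (p := f) (q := Fin.castLE hk r)
      (Fin.ext_iff.not.2 (r.isLt.trans_le hf).ne')
    rw [← rank_castLE] at hr
    omega
  · intro h
    obtain ⟨i, hi⟩ := exists_rank_eq u x.isLt
    have hik : i.val < k := not_le.1 fun hki => by
      have := h i hki
      omega
    exact ⟨⟨i, hik⟩, hi⟩

lemma splitRel_of_path_gammaR (h : QuantumPath (gammaR n k).reverse v u) :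
    SplitRel (window v hk) (window u hk) := by
  have hfix (f : Fin n) (hf : k ≤ f.val) : rank u f = rank v f :=
    (gammaR_reverse n k ▸ h).rank_eq_of_rowsRev (k := n)
      (fun i r hir _ => fixesRow_of_mem_stageR hir) hf f.isLt
  have hclear := risesClear_of_path_gammaR hk h
  refine ⟨Set.ext fun x => ?_, fun s => countIco_le fun r hr => ?_, countIco_congr fun r => ?_,
    fun x hx => countIco_congr fun r => ?_⟩
  · simp only [mem_absSupport_window_iff]
    exact forall₂_congr fun f hf => by rw [hfix f hf]
  · have := (hclear r).1
    simp only [SameHalf, Set.mem_Ico] at *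
    omega
  · have := (hclear r).1
    simp only [SameHalf, Set.mem_Ico] at *
    omega
  · have := x.isLt
    simp only [mem_absSupport_window_iff, not_forall] at hx
    obtain ⟨f, hf, hfx⟩ := hx
    have := (hclear r).2 f hf
    have := (hclear r).1
    simp only [SameHalf, OffArc, Set.mem_Ico] at *
    omega

lemma entry_notMem_absSupport_window {f : Fin n} (hf : k ≤ f.val) :
    entry v f ∉ absSupport (window v hk) := fun h =>
  ((mem_absSupport_window_iff hk).1 h f hf).1 rfl

lemma exists_path_gammaR_of_splitRel {C : Fin k → Letter n} (hC : DistinctAbs C)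
    (h : AdjacentCond le_rfl C (window v hk)) (hs : SplitRel (window v hk) C) :
    ∃ u, QuantumPath (gammaR n k).reverse v u ∧ window u hk = C := by
  have hhalf := hs.sameHalf hC h
  refine exists_path_gammaR hk hC h fun r => ⟨hhalf r, fun f hf => ?_⟩
  have hoff {x : Letter n} := hs.offArc (distinctAbs_window hk v) hhalf (x := x)
  have hf' := entry_notMem_absSupport_window hk (v := v) hf
  exact ⟨hoff hf' r, val_bar (entry v f) ▸ hoff (bar_mem_absSupport.not.2 hf') r⟩

end Window

end SplitRel

/-! ### Split columns -/

lemma isUnbarred_bar (x : Letter n) : IsUnbarred (bar x) ↔ ¬ IsUnbarred x := by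
  have := x.isLt
  rw [IsUnbarred, IsUnbarred, val_bar]
  omega

lemma forall_letter_iff {P : Letter n → Prop} :
    (∀ x, P x) ↔ ∀ x, IsUnbarred x → P x ∧ P (bar x) := by
  refine ⟨fun h x _ => ⟨h x, h (bar x)⟩, fun h x => ?_⟩
  by_cases hx : IsUnbarred x
  · exact (h x hx).1
  · simpa only [bar_bar] using (h (bar x) ((isUnbarred_bar x).2 hx)).2

section LetterSets

variable {D E Z T : Set (Letter n)}

lemma bar_mem_image_bar {x : Letter n} : bar x ∈ bar '' Z ↔ x ∈ Z :=
  bar_injective.mem_set_image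

lemma mem_image_bar {x : Letter n} : x ∈ bar '' Z ↔ bar x ∈ Z := by
  rw [← bar_mem_image_bar (x := bar x), bar_bar]

lemma eq_sdiff_union_iff (hZ : ∀ x ∈ Z, IsUnbarred x) (hT : ∀ x ∈ T, IsUnbarred x) :
    E = D \ Z ∪ T ↔ ∀ x, IsUnbarred x →
      (x ∈ E ↔ x ∈ D ∧ x ∉ Z ∨ x ∈ T) ∧ (bar x ∈ E ↔ bar x ∈ D) := by
  rw [Set.ext_iff, forall_letter_iff]
  refine forall₂_congr fun x hx => and_congr Iff.rfl (iff_congr Iff.rfl ?_)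
  have hxZ : bar x ∉ Z := fun h => (isUnbarred_bar x).1 (hZ _ h) hx
  have hxT : bar x ∉ T := fun h => (isUnbarred_bar x).1 (hT _ h) hx
  simp only [Set.mem_union, Set.mem_sdiff, hxZ, hxT, not_false_iff, and_true, or_false]

lemma eq_sdiff_image_bar_union_iff (hZ : ∀ x ∈ Z, IsUnbarred x) (hT : ∀ x ∈ T, IsUnbarred x) :
    E = D \ bar '' Z ∪ bar '' T ↔ ∀ x, IsUnbarred x →
      (x ∈ E ↔ x ∈ D) ∧ (bar x ∈ E ↔ bar x ∈ D ∧ x ∉ Z ∨ x ∈ T) := by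
  rw [Set.ext_iff, forall_letter_iff]
  refine forall₂_congr fun x hx => and_congr (iff_congr Iff.rfl ?_) ?_
  · have hxZ : bar x ∉ Z := fun h => (isUnbarred_bar x).1 (hZ _ h) hx
    have hxT : bar x ∉ T := fun h => (isUnbarred_bar x).1 (hT _ h) hx
    simp only [Set.mem_union, Set.mem_sdiff, mem_image_bar, hxZ, hxT, not_false_iff, and_true,
      or_false]
  · simp only [Set.mem_union, Set.mem_sdiff, bar_mem_image_bar]

end LetterSets

section Columns

variable {k r : ℕ} {C : Fin k → Letter n}

lemma DistinctAbs.injective (hC : DistinctAbs C) : Function.Injective C := fun _ _ h =>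
  hC (congrArg absLetter h)

lemma bar_ne (x : Letter n) : bar x ≠ x := by
  have := x.isLt
  rw [Ne, Fin.ext_iff, val_bar]
  omega

lemma DistinctAbs.bar_notMem (hC : DistinctAbs C) {x : Letter n} (hx : x ∈ Set.range C) :
    bar x ∉ Set.range C := by
  rintro ⟨j, hj⟩
  obtain ⟨i, rfl⟩ := hx
  have hij : j = i := hC (by simp only [hj, absLetter, bar_bar, min_comm])
  exact bar_ne (C i) (hij ▸ hj).symm

lemma range_ord (C : Fin k → Letter n) : Set.range (ord C) = Set.range C :=
  (Tuple.sort C).surjective.range_comp C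

lemma strictMono_ord (hC : Function.Injective C) : StrictMono (ord C) :=
  (Tuple.monotone_sort C).strictMono_of_injective (hC.comp (Tuple.sort C).injective)

lemma exists_strictMono_range_eq {α : Type*} [LinearOrder α] {S : Set α} (hS : S.Finite) :
    ∃ (r : ℕ) (z : Fin r → α), StrictMono z ∧ Set.range z = S :=
  ⟨_, hS.toFinset.orderEmbOfFin rfl, (hS.toFinset.orderEmbOfFin rfl).strictMono, by
    rw [Finset.range_orderEmbOfFin, hS.coe_toFinset]⟩

lemma exists_strictAnti_range_eq {α : Type*} [LinearOrder α] {S : Set α} (hS : S.Finite) :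
    ∃ (r : ℕ) (z : Fin r → α), StrictAnti z ∧ Set.range z = S := by
  obtain ⟨r, z, hz, rfl⟩ := exists_strictMono_range_eq hS
  exact ⟨r, z ∘ Fin.rev, fun i j h => hz (Fin.rev_lt_rev.2 h), Fin.rev_surjective.range_comp z⟩

/-- The greedy choice of the `t_i`, without reference to `t_{i-1}`. -/
lemma forall_isGreatest_iff {α : Type*} [LinearOrder α] {z t : Fin r → α} (hz : StrictAnti z)
    (ht : StrictAnti t) {A : Set α} (htA : ∀ i, t i ∈ A) :
    (∀ i, IsGreatest {x | x ∈ A ∧ x < z i ∧ ∀ j : Fin r, j.val + 1 = i.val → x < t j} (t i)) ↔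
      ∀ i, t i < z i ∧ ∀ x ∈ A, x ∉ Set.range t → x < z i → x < t i := by
  constructor
  · refine fun h i => ⟨(h i).1.2.1, fun x hxA hxt => ?_⟩
    induction i using WellFoundedLT.induction with
    | ind i ih =>
      intro hxz
      have hle : x ≤ t i := (h i).2 ⟨hxA, hxz, fun j hj =>
        have hji : j < i := Fin.lt_def.2 (by omega)
        ih j hji (hxz.trans (hz hji))⟩
      exact hle.lt_of_ne fun hx => hxt ⟨i, hx.symm⟩
  · refine fun h i => ⟨⟨htA i, (h i).1, fun j hj => ht (Fin.lt_def.2 (by omega))⟩,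
      fun x ⟨hxA, hxz, hxt⟩ => ?_⟩
    by_cases hx : x ∈ Set.range t
    · obtain ⟨j, rfl⟩ := hx
      refine ht.antitone (not_lt.1 fun hji => ?_)
      have hlt := hxt ⟨i.val - 1, by omega⟩ (by dsimp only; omega)
      exact (ht.lt_iff_gt.1 hlt).not_ge (Fin.le_def.2 (Nat.le_sub_one_of_lt hji))
    · exact ((h i).2 x hxA hx hxz).le

lemma countIco_eq_ncard {a b : ℕ} (hC : Function.Injective C) :
    countIco C a b = (Set.range C ∩ {x | x.val ∈ Set.Ico a b}).ncard := by
  rw [Set.inter_comm, ← Set.image_preimage_eq_inter_range, Set.ncard_image_of_injective _ hC]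
  rfl

lemma countIco_eq_of_range {k' a b : ℕ} {C' : Fin k' → Letter n} (hC : Function.Injective C)
    (hC' : Function.Injective C')
    (h : ∀ x : Letter n, x.val ∈ Set.Ico a b → (x ∈ Set.range C ↔ x ∈ Set.range C')) :
    countIco C a b = countIco C' a b := by
  rw [countIco_eq_ncard hC, countIco_eq_ncard hC']
  exact congrArg _ (Set.ext fun x => and_congr_left (h x))

lemma countIco_eq_card {a b : ℕ} (h : ∀ r, (C r).val ∈ Set.Ico a b) : countIco C a b = k := by
  rw [countIco, Set.eq_univ_of_forall (s := {r | (C r).val ∈ Set.Ico a b}) h, Set.ncard_univ,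
    Nat.card_fin]

lemma lt_countIco_iff {z : Fin r → Letter n} (hz : StrictAnti z) (hu : ∀ i, IsUnbarred (z i))
    {i : Fin r} {s : ℕ} : i.val < countIco z s n ↔ s ≤ (z i).val := by
  constructor
  · contrapose!
    intro hs
    have hsub : {j | (z j).val ∈ Set.Ico s n} ⊆ Finset.Iio i := fun j hj =>
      Finset.mem_Iio.2 (hz.lt_iff_gt.1 (Fin.lt_def.2 (hs.trans_le hj.1)))
    simpa only [countIco, Set.ncard_coe_finset, Fin.card_Iio] using Set.ncard_le_ncard hsub
  · intro hs
    have hsub : (Finset.Iic i : Set (Fin r)) ⊆ {j | (z j).val ∈ Set.Ico s n} := fun j hj =>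
      ⟨hs.trans (hz.antitone (Finset.mem_Iic.1 hj)), hu j⟩
    have hcard := Set.ncard_le_ncard hsub
    rwa [Set.ncard_coe_finset, Fin.card_Iic] at hcard

lemma countIco_le_countIco_iff {z t : Fin r → Letter n} (hz : StrictAnti z)
    (hzu : ∀ i, IsUnbarred (z i)) (ht : StrictAnti t) (htu : ∀ i, IsUnbarred (t i)) {s : ℕ} :
    countIco t s n ≤ countIco z s n ↔ ∀ i, s ≤ (t i).val → s ≤ (z i).val :=
  ⟨fun h _ hi => (lt_countIco_iff hz hzu).1 (((lt_countIco_iff ht htu).2 hi).trans_le h),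
    fun h => countIco_le fun i hi => ⟨h i hi.1, hzu i⟩⟩

end Columns

section SplitLetters

variable {k r r' : ℕ} {D L R : Fin k → Letter n} {z : Fin r → Letter n} {t : Fin r' → Letter n}

/-- `L` and `R` have the same absolute values, and `z` and `t` enumerate decreasingly the letters
`z_i` and `t_i` exchanged if `L` and `R` are, up to reordering, the two halves of a split column. -/
structure SplitLetters (L R : Fin k → Letter n) (z : Fin r → Letter n) (t : Fin r' → Letter n) :
    Prop where
  absSupport_eq : absSupport R = absSupport L
  strictAnti_z : StrictAnti z
  strictAnti_t : StrictAnti t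
  range_z : Set.range z = {x | IsUnbarred x ∧ x ∈ Set.range R ∧ bar x ∈ Set.range L}
  range_t : Set.range t = {x | IsUnbarred x ∧ x ∈ Set.range L ∧ bar x ∈ Set.range R}

/-- The unbarred letters of the column `D` are those of `R`, and its barred letters are those of
`L`: the condition on `D` in terms of its splitting into `R` and `L`. -/
def IsMerge (D L R : Fin k → Letter n) : Prop :=
  ∀ x, IsUnbarred x → (x ∈ Set.range D ↔ x ∈ Set.range R) ∧
    (bar x ∈ Set.range D ↔ bar x ∈ Set.range L)

namespace SplitLetters

lemma mem_z (h : SplitLetters L R z t) {x : Letter n} (hx : IsUnbarred x) :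
    x ∈ Set.range z ↔ x ∈ Set.range R ∧ bar x ∈ Set.range L := by
  rw [h.range_z]
  exact and_iff_right hx

lemma mem_t (h : SplitLetters L R z t) {x : Letter n} (hx : IsUnbarred x) :
    x ∈ Set.range t ↔ x ∈ Set.range L ∧ bar x ∈ Set.range R := by
  rw [h.range_t]
  exact and_iff_right hx

lemma isUnbarred_z (h : SplitLetters L R z t) (i : Fin r) : IsUnbarred (z i) :=
  (h.range_z.le ⟨i, rfl⟩).1

lemma isUnbarred_t (h : SplitLetters L R z t) (i : Fin r') : IsUnbarred (t i) :=
  (h.range_t.le ⟨i, rfl⟩).1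

lemma mem_or_iff (h : SplitLetters L R z t) (x : Letter n) :
    x ∈ Set.range R ∨ bar x ∈ Set.range R ↔ x ∈ Set.range L ∨ bar x ∈ Set.range L :=
  Set.ext_iff.1 h.absSupport_eq x

lemma countIco_add (h : SplitLetters L R z t) (hL : DistinctAbs L) (hR : DistinctAbs R) (s : ℕ) :
    countIco L s n + countIco z s n = countIco R s n + countIco t s n := by
  have hLz : Disjoint (Set.range L) (Set.range z) := h.range_z ▸
    Set.disjoint_left.2 fun x hx hxz => hL.bar_notMem hx hxz.2.2
  have hRt : Disjoint (Set.range R) (Set.range t) := h.range_t ▸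
    Set.disjoint_left.2 fun x hx hxt => hR.bar_notMem hx hxt.2.2
  simp only [countIco_eq_ncard hL.injective, countIco_eq_ncard hR.injective,
    countIco_eq_ncard h.strictAnti_z.injective, countIco_eq_ncard h.strictAnti_t.injective]
  rw [← Set.ncard_union_eq (hLz.mono Set.inter_subset_left Set.inter_subset_left),
    ← Set.ncard_union_eq (hRt.mono Set.inter_subset_left Set.inter_subset_left),
    ← Set.union_inter_distrib_right, ← Set.union_inter_distrib_right]
  refine congrArg _ (Set.ext fun x => and_congr_left fun hx => ?_)
  have := h.mem_or_iff x
  rw [Set.mem_union, Set.mem_union, h.mem_z hx.2, h.mem_t hx.2]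
  tauto

lemma countIco_z_zero (h : SplitLetters L R z t) : countIco z 0 n = r :=
  countIco_eq_card fun i => ⟨Nat.zero_le _, h.isUnbarred_z i⟩

lemma countIco_t_zero (h : SplitLetters L R z t) : countIco t 0 n = r' :=
  countIco_eq_card fun i => ⟨Nat.zero_le _, h.isUnbarred_t i⟩

section SameLength

variable {t : Fin r → Letter n}

lemma z_ne_t (h : SplitLetters L R z t) (hL : DistinctAbs L) (i : Fin r) : z i ≠ t i := fun hzt =>
  hL.bar_notMem (h.range_t.le ⟨i, rfl⟩).2.1 (hzt ▸ (h.range_z.le ⟨i, rfl⟩).2.2)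

lemma splitRel_iff (h : SplitLetters L R z t) (hL : DistinctAbs L) (hR : DistinctAbs R) :
    SplitRel L R ↔ ∀ i, t i < z i ∧
      ∀ x, IsUnbarred x → x ∉ absSupport L → x < z i → x < t i := by
  have hadd := h.countIco_add hL hR
  have hle_iff (s : ℕ) : countIco L s n ≤ countIco R s n ↔ ∀ i, s ≤ (t i).val → s ≤ (z i).val := by
    rw [← countIco_le_countIco_iff h.strictAnti_z h.isUnbarred_z h.strictAnti_t h.isUnbarred_t]
    have := hadd s
    omega
  have hge_iff (s : ℕ) : countIco R s n ≤ countIco L s n ↔ ∀ i, s ≤ (z i).val → s ≤ (t i).val := by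
    rw [← countIco_le_countIco_iff h.strictAnti_t h.isUnbarred_t h.strictAnti_z h.isUnbarred_z]
    have := hadd s
    omega
  constructor
  · refine fun hs i => ⟨?_, fun x _ hx hxz => ?_⟩
    · exact lt_of_le_of_ne (Fin.le_def.2 ((hle_iff _).1 (hs.countIco_le _) i le_rfl))
        (h.z_ne_t hL i).symm
    · exact ((hge_iff _).1 (hs.countIco_eq x hx).ge i (Fin.le_def.1 hxz.le)).lt_of_ne
        fun hxt => hx (Fin.ext hxt ▸ Or.inl (h.range_t.le ⟨i, rfl⟩).2.1)
  · intro hzt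
    have hle (s : ℕ) : countIco L s n ≤ countIco R s n :=
      (hle_iff s).2 fun i hi => hi.trans (Fin.le_def.1 (hzt i).1.le)
    refine ⟨h.absSupport_eq, hle, (hle 0).antisymm ((hge_iff 0).2 fun i _ => Nat.zero_le _),
      fun x hx => (hle _).antisymm ((hge_iff _).2 fun i hxz => ?_)⟩
    have hxu : IsUnbarred x := lt_of_le_of_lt hxz (h.isUnbarred_z i)
    have hne : x ≠ z i := fun hxz' => hx (hxz' ▸ Or.inr (h.range_z.le ⟨i, rfl⟩).2.2)
    exact Fin.le_def.1 ((hzt i).2 x hxu hx (lt_of_le_of_ne hxz hne)).le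

lemma splitData_iff (h : SplitLetters L R z t) (hL : DistinctAbs L) (hR : DistinctAbs R)
    (hD : IsMerge D L R) : SplitData D z t ↔ ∀ i, t i < z i ∧
      ∀ x, IsUnbarred x → x ∉ absSupport L → x < z i → x < t i := by
  let A : Set (Letter n) := {x | IsUnbarred x ∧ x ∉ Set.range D ∧ bar x ∉ Set.range D}
  have hA (x : Letter n) (hx : IsUnbarred x) : x ∈ A ↔ x ∉ Set.range R ∧ bar x ∉ Set.range L := by
    simp only [A, Set.mem_ofPred_eq, hx, (hD x hx).1, (hD x hx).2, true_and]
  have htA (i : Fin r) : t i ∈ A := by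
    obtain ⟨htu, htL, htR⟩ := h.range_t.le ⟨i, rfl⟩
    exact (hA _ htu).2 ⟨fun ht => hR.bar_notMem ht htR, hL.bar_notMem htL⟩
  have hA_diff (x : Letter n) (hx : IsUnbarred x) :
      x ∈ A ∧ x ∉ Set.range t ↔ x ∉ absSupport L := by
    have := h.mem_or_iff x
    rw [hA x hx, h.mem_t hx, absSupport, Set.mem_ofPred_eq]
    tauto
  have hz : Set.range z = {x | IsUnbarred x ∧ x ∈ Set.range D ∧ bar x ∈ Set.range D} := by
    rw [h.range_z]
    exact Set.ext fun x => and_congr_right fun hx => by rw [(hD x hx).1, (hD x hx).2]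
  have hset (i : Fin r) : {x | IsUnbarred x ∧ x < z i ∧ (∀ j : Fin r, j.val + 1 = i.val → x < t j) ∧
      x ∉ Set.range D ∧ bar x ∉ Set.range D} =
        {x | x ∈ A ∧ x < z i ∧ ∀ j : Fin r, j.val + 1 = i.val → x < t j} :=
    Set.ext fun x => by simp only [A, Set.mem_ofPred_eq]; tauto
  simp only [SplitData, h.strictAnti_z, hz, true_and, hset,
    forall_isGreatest_iff h.strictAnti_z h.strictAnti_t htA]
  refine forall_congr' fun i => and_congr_right fun _ => forall_congr' fun x => ⟨?_, ?_⟩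
  · intro hx hxu hxL
    have hxA := (hA_diff x hxu).2 hxL
    exact hx hxA.1 hxA.2
  · intro hx hxA hxt
    exact hx hxA.1 ((hA_diff x hxA.1).1 ⟨hxA, hxt⟩)

end SameLength

lemma range_right (h : SplitLetters L R z t) (hL : DistinctAbs L) (hR : DistinctAbs R)
    (hD : IsMerge D L R) : Set.range R =
      (Set.range D \ Set.range fun i => bar (z i)) ∪ Set.range fun i => bar (t i) := by
  rw [Set.range_comp' bar z, Set.range_comp' bar t, eq_sdiff_image_bar_union_iff
    (Set.forall_mem_range.2 h.isUnbarred_z) (Set.forall_mem_range.2 h.isUnbarred_t)]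
  intro x hx
  have hxL := @hL.bar_notMem _ _ _ x
  have hxR := @hR.bar_notMem _ _ _ x
  have := h.mem_or_iff x
  rw [h.mem_z hx, h.mem_t hx, (hD x hx).1, (hD x hx).2]
  tauto

lemma range_left (h : SplitLetters L R z t) (hL : DistinctAbs L) (hR : DistinctAbs R)
    (hD : IsMerge D L R) : Set.range L = Set.range D \ Set.range z ∪ Set.range t := by
  rw [eq_sdiff_union_iff (Set.forall_mem_range.2 h.isUnbarred_z)
    (Set.forall_mem_range.2 h.isUnbarred_t)]
  intro x hx
  have hxL := @hL.bar_notMem _ _ _ x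
  have hxR := @hR.bar_notMem _ _ _ x
  have := h.mem_or_iff x
  rw [h.mem_z hx, h.mem_t hx, (hD x hx).1, (hD x hx).2]
  tauto

end SplitLetters

lemma isMerge_and_splitLetters_of_splitData {t : Fin r → Letter n} (hdata : SplitData D z t)
    (hR : Set.range R =
      (Set.range D \ Set.range fun i => bar (z i)) ∪ Set.range fun i => bar (t i))
    (hL : Set.range L = Set.range D \ Set.range z ∪ Set.range t) :
    IsMerge D L R ∧ SplitLetters L R z t := by
  obtain ⟨hz, hzr, ht⟩ := hdata
  have hzu (i : Fin r) : IsUnbarred (z i) := (hzr.le ⟨i, rfl⟩).1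
  have htu (i : Fin r) : IsUnbarred (t i) := (ht i).1.1
  have htD (x : Letter n) : x ∈ Set.range t → x ∉ Set.range D ∧ bar x ∉ Set.range D := by
    rintro ⟨i, rfl⟩
    exact (ht i).1.2.2.2
  have htanti : StrictAnti t := by
    cases r with
    | zero => exact fun i => i.elim0
    | succ r => exact Fin.strictAnti_iff_succ_lt.2 fun i => (ht i.succ).1.2.2.1 i.castSucc rfl
  have hzD (x : Letter n) (hx : IsUnbarred x) :
      x ∈ Set.range z ↔ x ∈ Set.range D ∧ bar x ∈ Set.range D := by
    rw [hzr]
    exact and_iff_right hx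
  rw [Set.range_comp' bar z, Set.range_comp' bar t, eq_sdiff_image_bar_union_iff
    (Set.forall_mem_range.2 hzu) (Set.forall_mem_range.2 htu)] at hR
  rw [eq_sdiff_union_iff (Set.forall_mem_range.2 hzu) (Set.forall_mem_range.2 htu)] at hL
  refine ⟨fun x hx => ⟨(hR x hx).1.symm, (hL x hx).2.symm⟩, ?_, hz, htanti, ?_, ?_⟩
  · refine Set.ext (forall_letter_iff.2 fun x hx => ?_)
    rw [bar_mem_absSupport, bar_mem_absSupport, and_self, absSupport, absSupport,
      Set.mem_ofPred_eq, Set.mem_ofPred_eq, (hR x hx).1, (hR x hx).2, (hL x hx).1, (hL x hx).2]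
    have := hzD x hx
    tauto
  · rw [hzr]
    exact Set.ext fun x => and_congr_right fun hx => by rw [(hR x hx).1, (hL x hx).2]
  · refine Set.ext fun x => ⟨fun hxt => ?_, fun ⟨hx, hxL, hxR⟩ => ?_⟩
    · have hx : IsUnbarred x := Set.forall_mem_range.2 htu x hxt
      exact ⟨hx, (hL x hx).1.2 (Or.inr hxt), (hR x hx).2.2 (Or.inr hxt)⟩
    · rw [(hL x hx).1] at hxL
      rw [(hR x hx).2] at hxR
      have := hzD x hx
      tauto

lemma exists_splitLetters (hL : DistinctAbs L) (hR : DistinctAbs R) (h : SplitRel L R) :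
    ∃ (r : ℕ) (z t : Fin r → Letter n), SplitLetters L R z t := by
  obtain ⟨r, z, hz, hzr⟩ := exists_strictAnti_range_eq (Set.toFinite
    {x : Letter n | IsUnbarred x ∧ x ∈ Set.range R ∧ bar x ∈ Set.range L})
  obtain ⟨r', t, ht, htr⟩ := exists_strictAnti_range_eq (Set.toFinite
    {x : Letter n | IsUnbarred x ∧ x ∈ Set.range L ∧ bar x ∈ Set.range R})
  have hzt : SplitLetters L R z t := ⟨h.absSupport_eq, hz, ht, hzr, htr⟩
  have hadd := hzt.countIco_add hL hR 0
  rw [hzt.countIco_z_zero, hzt.countIco_t_zero, h.countIco_zero, Nat.add_right_inj] at hadd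
  subst hadd
  exact ⟨r, z, t, hzt⟩

lemma exists_isMerge (hL : DistinctAbs L) (hR : DistinctAbs R) (h : SplitRel L R) :
    ∃ D : Fin k → Letter n, StrictMono D ∧ IsMerge D L R := by
  obtain ⟨k', D, hD, hDr⟩ := exists_strictMono_range_eq (Set.toFinite
    {x : Letter n | (IsUnbarred x ∧ x ∈ Set.range R) ∨ (¬ IsUnbarred x ∧ x ∈ Set.range L)})
  have hcard {m : ℕ} (C : Fin m → Letter n) : countIco C 0 n + countIco C n (2 * n) = m := by
    rw [countIco_add_countIco C n.zero_le (Nat.le_mul_of_pos_left n two_pos)]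
    exact countIco_eq_card fun r => ⟨Nat.zero_le _, (C r).isLt⟩
  obtain rfl : k' = k := by
    rw [← hcard D, ← hcard L, h.countIco_zero]
    congr 1
    · refine countIco_eq_of_range hD.injective hR.injective fun x hx => ?_
      have : IsUnbarred x := hx.2
      simp [hDr, this]
    · refine countIco_eq_of_range hD.injective hL.injective fun x hx => ?_
      have : ¬ IsUnbarred x := hx.1.not_gt
      simp [hDr, this]
  refine ⟨D, hD, fun x hx => ?_⟩
  have := (isUnbarred_bar x).not.2 (not_not.2 hx)
  simp [hDr, hx, this]

lemma splitRel_iff_exists_isSplitting (hL : DistinctAbs L) (hR : DistinctAbs R) :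
    SplitRel L R ↔ ∃ D, IsKNColumn D ∧ IsSplitting D (ord R) (ord L) := by
  constructor
  · intro h
    obtain ⟨r, z, t, hzt⟩ := exists_splitLetters hL hR h
    obtain ⟨D, hDmono, hD⟩ := exists_isMerge hL hR h
    have hdata : SplitData D z t := (hzt.splitData_iff hL hR hD).2 ((hzt.splitRel_iff hL hR).1 h)
    refine ⟨D, ⟨hDmono, r, z, t, hdata⟩, r, z, t, hdata, strictMono_ord hR.injective, ?_,
      strictMono_ord hL.injective, ?_⟩
    · rw [range_ord, hzt.range_right hL hR hD]
    · rw [range_ord, hzt.range_left hL hR hD]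
  · rintro ⟨D, -, r, z, t, hdata, -, hRr, -, hLr⟩
    rw [range_ord] at hRr hLr
    obtain ⟨hD, hzt⟩ := isMerge_and_splitLetters_of_splitData hdata hRr hLr
    exact (hzt.splitRel_iff hL hR).2 ((hzt.splitData_iff hL hR hD).1 hdata)

end SplitLetters

/-! ### The filling map -/

lemma adjacentCond_window_one_iff {k : ℕ} (hk : k ≤ n) {C : Fin k → Letter n}
    (hC : Function.Injective C) : AdjacentCond le_rfl C (window 1 hk) ↔ StrictMono C := by
  have hval (i : Fin k) : (window 1 hk (Fin.castLE le_rfl i)).val = i.val := rfl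
  simp only [AdjacentCond, CircLT, Ne, Fin.ext_iff, Fin.lt_def, hval]
  constructor
  · intro h i l hil
    have hle : i.val ≤ (C l).val :=
      not_lt.1 fun hlt => (h ⟨(C l).val, hlt.trans i.isLt⟩ l (hlt.trans hil)).1 rfl
    have hne : (C i).val ≠ (C l).val := fun e => hil.ne (hC (Fin.ext e))
    have := h i l hil
    exact Fin.lt_def.2 (by omega)
  · intro h i l hil
    have hle : i.val ≤ (C i).val := by
      simpa using Finset.card_le_card_of_injOn (s := Finset.Iio i) (t := Finset.Iio (C i)) C
        (fun j hj => by simpa using h (by simpa using hj)) h.injective.injOn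
    have : (C i).val < (C l).val := h hil
    omega

section Chain

variable [NeZero n] {μ : Fin n → ℕ} {c d : ℕ}

/-- The segment `Γ^{μ_1} … Γ^{c+2} Γ_r^{c+1}` of the chain of `μ`, after which the filling map reads
the left column `c`. -/
def leftSegment (μ : Fin n → ℕ) (c : ℕ) : List (PosRoot n) :=
  chainSegment μ (c + 1) ++ gammaR n (height μ c)

lemma leftSegment_append_gammaL (hc : c < μ 0) :
    leftSegment μ c ++ gammaL n (height μ c) = chainSegment μ c := by
  have hlen : μ 0 - c = μ 0 - (c + 1) + 1 := by omega
  rw [leftSegment, chainSegment, chainSegment, hlen, List.range'_succ, List.reverse_cons,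
    List.flatMap_append, List.flatMap_singleton, gamma, List.append_assoc]

lemma chainSegment_eq_nil : chainSegment μ (μ 0) = [] := by
  rw [chainSegment, Nat.sub_self]
  rfl

lemma leftSegment_prefix_chainSegment (hc : c < μ 0) : leftSegment μ c <+: chainSegment μ c :=
  ⟨_, leftSegment_append_gammaL hc⟩

lemma chainSegment_prefix_chainSegment (hcd : c ≤ d) (hd : d ≤ μ 0) :
    chainSegment μ d <+: chainSegment μ c := by
  induction d, hcd using Nat.le_induction with
  | base => exact List.prefix_rfl
  | succ d _ ih =>
    exact ((List.prefix_append _ _).trans (leftSegment_prefix_chainSegment hd)).trans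
      (ih (Nat.le_of_succ_le hd))

lemma chainSegment_prefix_chain (hc : c ≤ μ 0) : chainSegment μ c <+: chain μ :=
  chainSegment_prefix_chainSegment c.zero_le hc

lemma leftSegment_prefix_chain (hc : c < μ 0) : leftSegment μ c <+: chain μ :=
  (leftSegment_prefix_chainSegment hc).trans (chainSegment_prefix_chain hc.le)

lemma length_chainSegment_succ_le (μ : Fin n → ℕ) (c : ℕ) :
    (chainSegment μ (c + 1)).length ≤ (leftSegment μ c).length :=
  (List.prefix_append _ _).length_le

lemma fillingMap_left (F : FoldingPair (chain μ)) (c : Fin (μ 0)) : (fillingMap μ F).left c =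
    window (walk F (leftSegment μ c).length) (height_le μ c) := by
  rw [leftSegment, List.length_append]
  rfl

namespace IsTrace

variable {g g' : ℕ → SignedPerm n}

lemma quantumPath_gammaL (hg : IsTrace (chain μ) (leftSegment μ c).length g) (hc : c < μ 0) :
    QuantumPath (gammaL n (height μ c)).reverse (g (chainSegment μ c).length)
      (g (leftSegment μ c).length) := by
  rw [← leftSegment_append_gammaL hc]
  exact hg.quantumPath (leftSegment_append_gammaL hc ▸ chainSegment_prefix_chain hc.le)

lemma quantumPath_gammaR (hg : IsTrace (chain μ) (chainSegment μ (c + 1)).length g)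
    (hc : c < μ 0) : QuantumPath (gammaR n (height μ c)).reverse (g (leftSegment μ c).length)
      (g (chainSegment μ (c + 1)).length) :=
  hg.quantumPath (leftSegment_prefix_chain hc)

lemma eq_of_column_eq (hg : IsTrace (chain μ) (chainSegment μ (c + 1)).length g)
    (hg' : IsTrace (chain μ) (chainSegment μ (c + 1)).length g') (hc : c < μ 0)
    (hend : g (chainSegment μ c).length = g' (chainSegment μ c).length)
    (hright : window (g (chainSegment μ (c + 1)).length) (height_le μ c) =
      window (g' (chainSegment μ (c + 1)).length) (height_le μ c))
    (hleft : window (g (leftSegment μ c).length) (height_le μ c) =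
      window (g' (leftSegment μ c).length) (height_le μ c))
    {p : ℕ} (hcp : (chainSegment μ (c + 1)).length ≤ p) (hpc : p ≤ (chainSegment μ c).length) :
    g p = g' p := by
  have hL := eq_of_separates (leftSegment_append_gammaL hc ▸ chainSegment_prefix_chain hc.le)
    (separates_gammaL (height_le μ c)) (hg.mono (length_chainSegment_succ_le μ c))
    (hg'.mono (length_chainSegment_succ_le μ c)) (by rwa [leftSegment_append_gammaL hc]) hleft
  rw [leftSegment_append_gammaL hc] at hL
  rcases le_total (leftSegment μ c).length p with hp | hp
  · exact hL p hp hpc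
  · exact eq_of_separates (leftSegment_prefix_chain hc) (separates_gammaR (height_le μ c)) hg hg'
      (hL _ le_rfl (leftSegment_prefix_chainSegment hc).length_le) hright p hcp hp

lemma exists_extend_column (hg : IsTrace (chain μ) (chainSegment μ c).length g) (hc : c < μ 0)
    {L R : Fin (height μ c) → Letter n} (hL : DistinctAbs L) (hR : DistinctAbs R)
    (hadj : AdjacentCond le_rfl L (window (g (chainSegment μ c).length) (height_le μ c)))
    (hRL : AdjacentCond le_rfl R L) (hsplit : SplitRel L R) :
    ∃ g', IsTrace (chain μ) (chainSegment μ (c + 1)).length g' ∧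
      window (g' (chainSegment μ (c + 1)).length) (height_le μ c) = R ∧
      window (g' (leftSegment μ c).length) (height_le μ c) = L ∧
      ∀ p, (chainSegment μ c).length ≤ p → g' p = g p := by
  obtain ⟨v, hv, rfl⟩ := exists_path_gammaL (height_le μ c) hL hadj
  obtain ⟨u, hu, rfl⟩ := exists_path_gammaR_of_splitRel (height_le μ c) hR hRL hsplit
  rw [← leftSegment_append_gammaL hc] at hg hv
  obtain ⟨g₁, hg₁, hg₁v, hg₁g⟩ :=
    exists_extend (leftSegment_append_gammaL hc ▸ chainSegment_prefix_chain hc.le) hg hv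
  obtain ⟨g₂, hg₂, hg₂u, hg₂g₁⟩ :=
    exists_extend (leftSegment_prefix_chain hc) hg₁ (u := u) (hg₁v ▸ hu)
  refine ⟨g₂, hg₂, by rw [hg₂u], by rw [leftSegment, hg₂g₁ _ le_rfl, ← leftSegment, hg₁v],
    fun p hp => ?_⟩
  rw [hg₂g₁ p ((leftSegment_prefix_chainSegment hc).length_le.trans hp),
    hg₁g p (leftSegment_append_gammaL hc ▸ hp)]

end IsTrace

lemma injOn_fillingMap (μ : Fin n → ℕ) : Set.InjOn (fillingMap μ) (FBar (chain μ)) := by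
  intro F hF F' hF' h
  have hwalk (c : ℕ) (hc : c ≤ μ 0) : ∀ p, (chainSegment μ c).length ≤ p →
      p ≤ (chain μ).length → walk F p = walk F' p := by
    induction c with
    | zero =>
      intro p hp hp'
      rw [le_antisymm hp' hp]
      exact (mem_FBar_iff.1 hF).1.trans (mem_FBar_iff.1 hF').1.symm
    | succ c ih =>
      intro p hcp hp
      have ih := ih (Nat.le_of_succ_le hc)
      rcases le_total (chainSegment μ c).length p with hpc | hpc
      · exact ih p hpc hp
      · have hright := congrArg (fun σ => σ.right ⟨c, hc⟩) h
        have hleft := congrArg (fun σ => σ.left ⟨c, hc⟩) h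
        simp only [fillingMap_left] at hleft
        exact ((isTrace_walk hF).mono (Nat.zero_le _)).eq_of_column_eq
          ((isTrace_walk hF').mono (Nat.zero_le _)) hc
          (ih _ le_rfl (chainSegment_prefix_chain (Nat.le_of_succ_le hc)).length_le) hright hleft
          hcp hpc
  refine foldingPair_ext fun p hp => hwalk (μ 0) le_rfl p ?_ hp
  rw [chainSegment_eq_nil]
  exact Nat.zero_le p

lemma admissible_fillingMap {F : FoldingPair (chain μ)} (hF : F ∈ FBar (chain μ)) :
    Admissible (fillingMap μ F) := by
  have htrace (a : ℕ) : IsTrace (chain μ) a (walk F) := (isTrace_walk hF).mono (Nat.zero_le a)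
  have hR (c : Fin (μ 0)) := (htrace _).quantumPath_gammaR c.isLt
  have hL (c : Fin (μ 0)) := (htrace _).quantumPath_gammaL c.isLt
  refine ⟨fun c => distinctAbs_window _ _, fun c => distinctAbs_window _ _, fun c hc => ?_,
    fun c => ?_, fun c => ?_, fun c hc => ?_⟩
  · have hadj := adjacentCond_of_path_gammaL (height_le μ c) (hL c)
    have hend : walk F (chainSegment μ c).length = 1 := by
      rw [hc]
      exact (mem_FBar_iff.1 hF).1
    rw [hend, ← fillingMap_left] at hadj
    exact (adjacentCond_window_one_iff _ (distinctAbs_window _ _).injective).1 hadj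
  · have hsplit := splitRel_of_path_gammaR (height_le μ c) (hR c)
    rw [← fillingMap_left] at hsplit
    exact (splitRel_iff_exists_isSplitting (distinctAbs_window _ _) (distinctAbs_window _ _)).1
      hsplit
  · rw [fillingMap_left]
    exact adjacentCond_of_path_gammaR (height_le μ c) (hR c)
  · rw [fillingMap_left]
    exact adjacentCond_of_path_gammaL (height_le μ (c + 1)) (hL ⟨c + 1, hc⟩)

/-- The trace `g` ends at the identity and its first columns, read from the right, are those with
index less than `c` of the filling `σ`. -/
structure Realizes (σ : Filling μ) (c : ℕ) (g : ℕ → SignedPerm n) : Prop where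
  isTrace : IsTrace (chain μ) (chainSegment μ c).length g
  apply_length : g (chain μ).length = 1
  right (d : Fin (μ 0)) (hd : d.val < c) :
    window (g (chainSegment μ (d + 1)).length) (height_le μ d) = σ.right d
  left (d : Fin (μ 0)) (hd : d.val < c) :
    window (g (leftSegment μ d).length) (height_le μ d) = σ.left d

lemma Admissible.exists_realizes_succ {σ : Filling μ} (hσ : Admissible σ)
    {g : ℕ → SignedPerm n} (hg : Realizes σ c g) (hc : c < μ 0) :
    ∃ g', Realizes σ (c + 1) g' := by
  have hadj : AdjacentCond le_rfl (σ.left ⟨c, hc⟩)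
      (window (g (chainSegment μ c).length) (height_le μ c)) := by
    cases c with
    | zero =>
      have hend : g (chainSegment μ 0).length = 1 := hg.apply_length
      rw [hend, adjacentCond_window_one_iff _ (hσ.distinct_left _).injective]
      exact hσ.first_increasing _ rfl
    | succ c =>
      have houter := hσ.adjacent_outer c hc
      rw [← hg.right _ (Nat.lt_succ_self c)] at houter
      exact houter
  have hL := hσ.distinct_left ⟨c, hc⟩
  have hR := hσ.distinct_right ⟨c, hc⟩
  obtain ⟨g', hg', hright, hleft, hagree⟩ := hg.isTrace.exists_extend_column hc hL hR hadj
    (hσ.adjacent_inner ⟨c, hc⟩) ((splitRel_iff_exists_isSplitting hL hR).2 (hσ.split ⟨c, hc⟩))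
  refine ⟨g', hg', ?_, fun d hd => ?_, fun d hd => ?_⟩
  · rw [hagree _ (chainSegment_prefix_chain hc.le).length_le, hg.apply_length]
  all_goals rcases (Nat.lt_succ_iff.1 hd).eq_or_lt with rfl | hdc
  · exact hright
  · rw [hagree _ (chainSegment_prefix_chainSegment hdc hc.le).length_le, hg.right d hdc]
  · exact hleft
  · rw [hagree _ ((chainSegment_prefix_chainSegment hdc hc.le).length_le.trans
      (length_chainSegment_succ_le μ d)), hg.left d hdc]

lemma Admissible.exists_fillingMap_eq {σ : Filling μ} (hσ : Admissible σ) :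
    ∃ F ∈ FBar (chain μ), fillingMap μ F = σ := by
  have hrealizes (c : ℕ) (hc : c ≤ μ 0) : ∃ g, Realizes σ c g := by
    induction c with
    | zero =>
      exact ⟨fun _ => 1, fun _ _ _ _ => Or.inl rfl, rfl, fun _ hd => absurd hd (Nat.not_lt_zero _),
        fun _ hd => absurd hd (Nat.not_lt_zero _)⟩
    | succ c ih =>
      obtain ⟨g, hg⟩ := ih (Nat.le_of_succ_le hc)
      exact hσ.exists_realizes_succ hg hc
  obtain ⟨g, hg⟩ := hrealizes (μ 0) le_rfl
  have htrace := hg.isTrace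
  rw [chainSegment_eq_nil] at htrace
  obtain ⟨F, hF, hFg⟩ := exists_foldingPair htrace hg.apply_length
  refine ⟨F, hF, Filling.ext (funext fun c => ?_) (funext fun c => ?_)⟩
  · rw [← hg.right c c.isLt, ← hFg _ (chainSegment_prefix_chain c.isLt).length_le]
    rfl
  · rw [fillingMap_left, hFg _ (leftSegment_prefix_chain c.isLt).length_le, hg.left c c.isLt]

end Chain

end TypeC

theorem mainTheorem11 {n : ℕ} [NeZero n] (μ : Fin n → ℕ) (hμ : Antitone μ) :
    Set.InjOn (TypeC.fillingMap μ) (TypeC.FBar (TypeC.chain μ)) ∧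
      TypeC.fillingMap μ '' TypeC.FBar (TypeC.chain μ) =
        {σ : TypeC.Filling μ | TypeC.Admissible σ} := by
  refine ⟨TypeC.injOn_fillingMap μ, Set.Subset.antisymm ?_ fun σ hσ => hσ.exists_fillingMap_eq⟩
  rintro _ ⟨F, hF, rfl⟩
  exact TypeC.admissible_fillingMap hF
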